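/- **Setting.** Let $\gamma:\mathbb R/\mathbb Z\to\mathbb R^3$ be an arclength parametrization of a closed oriented Lipschitz curve $\Gamma$ of length $1$ ($\gamma$ is $1$-Lipschitz and $|\gamma'|=1$ a.e.), with unit tangent $\tau=\gamma'$, and write $|h|$ for the distance from $h$ to $0$ in $\mathbb R/\mathbb Z$. Let $r(s)$ be the supremum of all $r>0$ such that $|\gamma(s+h)-\gamma(s)|\ge r/2$ for all $|h|\ge r$, and $|\gamma'(s+h)-\gamma'(s)|\le |h|/r$ for all $|h|\le r$ for which $\gamma'(s+h)$ exists; $r(s)=0$ if there is no such $r$ or if $\gamma$ is not differentiable at $s$. Put $\kappa^*(s)=1/r(s)\in(0,\infty]$ and assume $$\|\kappa^*\|_{L^{1,\infty}}:=\sup_{\sigma>0}\sigma\,\big|\{s\in\mathbb R/\mathbb Z:\kappa^*(s)\ge\sigma\}\big|<\infty .$$ Let $\mu_\Gamma$ be the vector measure $\int\xi\cdot d\mu_\Gamma=\int_0^1\xi(\gamma(s))\cdot\gamma'(s)\,ds$. For a vector measure $\omega$ on $\mathbb R^3$ let $$\|\omega\|_F=\sup\Big\{\int\xi\cdot d\omega:\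 \xi\in C^1_c(\mathbb R^3;\mathbb R^3),\ \|\nabla\times\xi\|_{L^\infty}\le1\Big\}.$$ Let $\rho\in C_c^\infty(\mathbb R^3)$ be nonnegative and radially symmetric, supported in the closed unit ball, with $\int\rho=1$, and let $\rho^\varepsilon(x)=\varepsilon^{-3}\rho(x/\varepsilon)$. For $0<\varepsilon<\tfrac12$ let $v^\varepsilon=\nabla\times(-\Delta)^{-1}(\rho^\varepsilon*\mu_\Gamma)$, that is, $$v^\varepsilon(x)=\frac1{4\pi}\int_{\mathbb R^3}\frac{y-x}{|y-x|^3}\times(\rho^\varepsilon*\mu_\Gamma)(y)\,dy,\qquad (\rho^\varepsilon*\mu_\Gamma)(y)=\int_0^1\rho^\varepsilon(y-\gamma(s))\,\gamma'(s)\,ds .$$ **Proposition.** Fix $\rho$. There are constants $C$, depending only on $\rho$, and constants $C_q$, depending only on $\rho$ and $q$, such that for all $\gamma$ and $\varepsilon$ as above the following hold. 1. $v^\varepsilon$ is smooth and $\|\nabla\times v^\varepsilon-\mu_\Gamma\|_F\le\varepsilon$, where $\nabla\times v^\varepsilon$ stands for the measure with this density. 2. For every $q\in(2,\infty]$, $v^\varepsilon\in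 L^q$ and $\|v^\varepsilon\|_{L^q}\le C_q\,\varepsilon^{\frac2q-1}\,\|\kappa^*\|_{L^{1,\infty}}$. 3. $v^\varepsilon\in L^2$ and $\Big|\,\|v^\varepsilon\|_{L^2}^2-\dfrac{|\log\varepsilon|}{2\pi}\Big|\le C\,\|\kappa^*\|_{L^{1,\infty}}^2$. 4. For every $\phi\in W^{1,\infty}(\mathbb R^3;\mathbb R^{3\times3})$ (continuous representative), with $\|\phi\|_{W^{1,\infty}}=\|\phi\|_{L^\infty}+\|\nabla\phi\|_{L^\infty}$, $$\Big|\frac{4\pi}{|\log\varepsilon|}\int_{\mathbb R^3}\phi:v^\varepsilon\otimes v^\varepsilon\,dx-\int_\Gamma\phi:(I-\tau\otimes\tau)\,d\mathcal H^1\Big|\le C\,\frac{\|\kappa^*\|_{L^{1,\infty}}^2\,\|\phi\|_{W^{1,\infty}}}{|\log\varepsilon|},$$ where $\int_\Gamma f\,d\mathcal H^1=\int_0^1 f(\gamma(s))\,ds$. -/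

import Mathlib

open MeasureTheory
open scoped ContDiff

/-- Euclidean three-space. -/
abbrev E3 : Type := EuclideanSpace ℝ (Fin 3)

/-- Real `3 × 3` matrices `A`, with entries `A (i, j)` and the Frobenius norm, which is the norm
that belongs to the product `A : B`. -/
abbrev M3 : Type := EuclideanSpace ℝ (Fin 3 × Fin 3)

namespace VortexFilament

noncomputable section

/-! ### Vector calculus -/

/-- The cross product of `ℝ³`. -/
def cross (a b : E3) : E3 :=
  !₂[a 1 * b 2 - a 2 * b 1, a 2 * b 0 - a 0 * b 2, a 0 * b 1 - a 1 * b 0]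

/-- The partial derivative `∂ᵢ fⱼ` at `x`. -/
def partialDeriv (f : E3 → E3) (i j : Fin 3) (x : E3) : ℝ :=
  fderiv ℝ f x (EuclideanSpace.single i 1) j

/-- The curl of a differentiable vector field. -/
def curl (f : E3 → E3) (x : E3) : E3 :=
  !₂[partialDeriv f 1 2 x - partialDeriv f 2 1 x,
     partialDeriv f 2 0 x - partialDeriv f 0 2 x,
     partialDeriv f 0 1 x - partialDeriv f 1 0 x]

/-- The product `A : B = ∑ᵢⱼ Aᵢⱼ Bᵢⱼ` of matrices. -/
def ddot (A B : M3) : ℝ := ∑ i : Fin 3, ∑ j : Fin 3, A (i, j) * B (i, j)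

/-- The tensor product `a ⊗ b`, with entries `aᵢ bⱼ`. -/
def tensor (a b : E3) : M3 := WithLp.toLp 2 fun p => a p.1 * b p.2

/-- The identity matrix. -/
def idMatrix : M3 := WithLp.toLp 2 fun p => if p.1 = p.2 then 1 else 0

/-! ### Closed curves of length one -/

/-- `γ`, a `1`-periodic map on `ℝ`, is an arclength parametrization by `ℝ/ℤ` of a closed oriented
Lipschitz curve of length `1`. Self-intersections are allowed. -/
structure IsArclengthLoop (γ : ℝ → E3) : Prop where
  periodic : Function.Periodic γ 1
  lipschitz : LipschitzWith 1 γ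
  speed : ∀ᵐ s : ℝ, ‖deriv γ s‖ = 1

/-- The two conditions on a radius `r` in the definition of the security radius at `γ s`.
Here `‖(h : UnitAddCircle)‖` is the distance from `h` to `0` modulo `1`. The tangent `γ'` of
a Lipschitz curve exists only almost everywhere; the second condition concerns the points
`s + h` where it exists. -/
def IsSecure (γ : ℝ → E3) (s r : ℝ) : Prop :=
  (∀ h : ℝ, r ≤ ‖(h : UnitAddCircle)‖ → r / 2 ≤ ‖γ (s + h) - γ s‖) ∧
  (∀ h : ℝ, ‖(h : UnitAddCircle)‖ ≤ r → DifferentiableAt ℝ γ (s + h) →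
    ‖deriv γ (s + h) - deriv γ s‖ ≤ ‖(h : UnitAddCircle)‖ / r)

/-- The security radius `r(s)`: the supremum of the `r > 0` that satisfy both conditions, and `0`
where `γ` is not differentiable (or where no such `r` exists). -/
def securityRadius (γ : ℝ → E3) (s : ℝ) : ENNReal :=
  ⨆ (r : ℝ) (_ : 0 < r ∧ DifferentiableAt ℝ γ s ∧ IsSecure γ s r), ENNReal.ofReal r

/-- `κ*(s) = 1 / r(s)`, which is `∞` where `r(s) = 0`. -/
def kappaStar (γ : ℝ → E3) (s : ℝ) : ENNReal := (securityRadius γ s)⁻¹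

/-- The weak `L¹` quasinorm of `κ*` over one period,
`sup_{σ > 0} σ |{s ∈ ℝ/ℤ : κ*(s) ≥ σ}|`. -/
def kappaNorm (γ : ℝ → E3) : ENNReal :=
  ⨆ (σ : ℝ) (_ : 0 < σ), ENNReal.ofReal σ *
    volume {s : ℝ | s ∈ Set.Ioc (0 : ℝ) 1 ∧ ENNReal.ofReal σ ≤ kappaStar γ s}

/-! ### Vector measures, through their pairing with vector fields -/

/-- The pairing `∫ ξ · dμ_Γ = ∫_Γ ξ · τ dℋ¹`. -/
def curvePairing (γ : ℝ → E3) (ξ : E3 → E3) : ℝ :=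
  ∫ s in (0 : ℝ)..1, inner ℝ (ξ (γ s)) (deriv γ s)

/-- The pairing `∫ ξ · w dx` with the measure of density `w`. -/
def densityPairing (w : E3 → E3) (ξ : E3 → E3) : ℝ :=
  ∫ x, inner ℝ (ξ x) (w x)

/-- The homogeneous flat norm of a vector measure, given through its pairing `T`, where `T ξ`
is the integral of the field `ξ`:
the supremum of the pairing over compactly supported `C¹` fields `ξ` with `‖curl ξ‖_∞ ≤ 1`. -/
def flatNorm (T : (E3 → E3) → ℝ) : EReal :=
  ⨆ (ξ : E3 → E3) (_ : ContDiff ℝ 1 ξ ∧ HasCompactSupport ξ ∧ ∀ x, ‖curl ξ x‖ ≤ 1),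
    (T ξ : EReal)

/-! ### The prototype velocity field -/

/-- A radially symmetric standard mollifier (at scale one). -/
structure IsRadialMollifier (ρ : E3 → ℝ) : Prop where
  smooth : ContDiff ℝ ∞ ρ
  nonneg : ∀ x, 0 ≤ ρ x
  radial : ∀ x y, ‖x‖ = ‖y‖ → ρ x = ρ y
  supported : tsupport ρ ⊆ Metric.closedBall 0 1
  integral_eq_one : ∫ x, ρ x = 1

/-- `ρ^ε(x) = ε⁻³ ρ(ε⁻¹ x)`. -/
def rescale (ρ : E3 → ℝ) (ε : ℝ) (x : E3) : ℝ := (ε ^ 3)⁻¹ * ρ (ε⁻¹ • x)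

/-- The density `(ρ^ε * μ_Γ)(y) = ∫ ρ^ε(y - z) dμ_Γ(z)`. -/
def mollifiedCurve (ρ : E3 → ℝ) (ε : ℝ) (γ : ℝ → E3) (y : E3) : E3 :=
  ∫ s in (0 : ℝ)..1, rescale ρ ε (y - γ s) • deriv γ s

/-- The Biot–Savart operator `curl (-Δ)⁻¹`. With the Newtonian potential `1 / (4π|x|)` of `-Δ`,
`curl (-Δ)⁻¹ w (x) = (1/4π) ∫ (y - x)/|y - x|³ × w(y) dy`. -/
def biotSavart (w : E3 → E3) (x : E3) : E3 :=
  (1 / (4 * Real.pi)) • ∫ y, cross ((‖y - x‖ ^ 3)⁻¹ • (y - x)) (w y)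

/-- The prototype field `v^ε = curl (-Δ)⁻¹ (ρ^ε * μ_Γ)`. -/
def prototypeField (ρ : E3 → ℝ) (ε : ℝ) (γ : ℝ → E3) : E3 → E3 :=
  biotSavart (mollifiedCurve ρ ε γ)

/-! ### The space `W^{1,∞}(ℝ³; M^{3×3})` -/

/-- `g` is the weak gradient of `φ`: `∫ (∂_v ψ) φ = - ∫ ψ (g v)` for all test functions `ψ` and all
directions `v`. -/
def IsWeakGradient (φ : E3 → M3) (g : E3 → E3 →L[ℝ] M3) : Prop :=
  ∀ ψ : E3 → ℝ, ContDiff ℝ ∞ ψ → HasCompactSupport ψ → ∀ v : E3,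
    ∫ x, (fderiv ℝ ψ x v) • φ x = - ∫ x, ψ x • g x v

/-- `φ` is (the continuous representative of) an element of `W^{1,∞}(ℝ³; M^{3×3})`, with weak
gradient `g`. -/
structure IsW1Infty (φ : E3 → M3) (g : E3 → E3 →L[ℝ] M3) : Prop where
  continuous : Continuous φ
  memLp : MemLp φ ⊤ volume
  memLp_grad : MemLp g ⊤ volume
  weakGradient : IsWeakGradient φ g

/-- The norm `‖φ‖_{L^∞} + ‖∇φ‖_{L^∞}`, where `g = ∇φ`. -/
def w1InftyNorm (φ : E3 → M3) (g : E3 → E3 →L[ℝ] M3) : ℝ :=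
  (eLpNorm φ ⊤ volume).toReal + (eLpNorm g ⊤ volume).toReal

end

end VortexFilament

/-!
By Fubini's theorem the field `v` is a superposition of the fields of line elements,
`4π v(x) = ∫ k^ε(γ s - x) × γ'(s) ds`, with the kernel `k(z) = z / |z|³` mollified at scale `ε`
(`prototypeField_eq`); pointwise `k^ε` is bounded by a multiple of `(|z| + ε)⁻²`.

*The flat norm.* The curl is formally self-adjoint, and `⟨curl ξ, a × b⟩` is the antisymmetric
part of the derivative of `ξ`. Paired with the superposition above, one half of it gives the
divergence of the kernel, which is `4π` times a Dirac mass (`integral_fderiv_kernE`), and the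
other half is a derivative along the closed curve, whose integral is zero
(`integral_inner_curl_cross_kernE`). So the curl of `v` is the average of the translates of the
curve by vectors `u` with `|u| ≤ ε`. A translation by `u` sweeps out a surface of area at most
`|u|`, and the circulation of `ξ` changes by the flux of its curl through that surface
(`abs_circulation_sub_le`).

*The norms for `q > 2`.* The weak bound on `κ*` implies that the curve spends a time of order `R`
in any ball of radius `R` (`volume_mem_closedBall_le`): either all points there have security
radius of order `R` at most, and these are few, or one of them has a larger security radius, and
then all the other ones are close to it along the curve. Summation over dyadic scales bounds the
integral of `(|γ s - x| + ε)⁻ᵖ` for `p > 1`, and Hölder's inequality along the curve gives the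
bound in `L^q`.

*The quadratic integrals.* The integral `∫ φ : v ⊗ v` is a double integral over pairs of points of
the curve of the interaction of two line elements (`integral_ddot_prototypeField`). The
correlation `∫ ⟨p, k(d + y)⟩ ⟨q, k(y)⟩ dy` equals `|d|⁻¹ (2π ⟨p, q⟩ + β ⟨p, n⟩ ⟨q, n⟩)` with
`n = d / |d|` (`exists_correlation_eq`). For two line elements on a straight line the cross products
with the tangent remove the term with `β`, and the interaction is `2π φ : (I - τ ⊗ τ)` divided by
the distance. If one of two points has a security radius `r`, the curve is nearly straight between
them as long as their distance `d` along the curve is below `r`, and the interaction agrees with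
`2π φ : (I - τ ⊗ τ) / (d + ε)` up to errors of order `ε / (d + ε)²`, `d^(-1/2)` and `1 / r`
(`exists_abs_interaction_sub_le`). The better one of the two security radii can be used. Its
inverse is of the order of the minimum of two independent copies of `κ*`, which is integrable
although `κ*` is only in weak `L¹`, with a bound by the square of the quasinorm
(`lintegral_pairKappa_le`). The other errors are of order one, and since no closed curve of length
one is straight, the quasinorm is at least `2` and absorbs them. The leading term integrates over
the circle to a logarithm (`integral_leading`). The coefficient `φ = I` gives the energy, and a
coefficient in `W^{1,∞}` is Lipschitz (`IsW1Infty.norm_sub_le`), which gives the limit.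
-/

namespace VortexFilament

noncomputable section

/-! ### Vector algebra -/

@[simp] lemma cross_apply_zero (a b : E3) : cross a b 0 = a 1 * b 2 - a 2 * b 1 := by
  simp [cross]

@[simp] lemma cross_apply_one (a b : E3) : cross a b 1 = a 2 * b 0 - a 0 * b 2 := by
  simp [cross]

@[simp] lemma cross_apply_two (a b : E3) : cross a b 2 = a 0 * b 1 - a 1 * b 0 := by
  simp [cross]

lemma inner_eq_sum (a b : E3) : inner ℝ a b = a 0 * b 0 + a 1 * b 1 + a 2 * b 2 := by
  simp only [PiLp.inner_apply, Fin.sum_univ_three, RCLike.inner_apply, conj_trivial]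
  ring

lemma norm_sq_eq_sum (a : E3) : ‖a‖ ^ 2 = a 0 ^ 2 + a 1 ^ 2 + a 2 ^ 2 := by
  rw [← real_inner_self_eq_norm_sq, inner_eq_sum]; ring

lemma ext3 {a b : E3} (h0 : a 0 = b 0) (h1 : a 1 = b 1) (h2 : a 2 = b 2) : a = b := by
  ext i; fin_cases i <;> assumption

lemma norm_cross_le (a b : E3) : ‖cross a b‖ ≤ ‖a‖ * ‖b‖ := by
  refine abs_le_of_sq_le_sq' ?_ (by positivity) |>.2
  rw [mul_pow, norm_sq_eq_sum, norm_sq_eq_sum, norm_sq_eq_sum]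
  simp only [cross_apply_zero, cross_apply_one, cross_apply_two]
  nlinarith [sq_nonneg (a 0 * b 0 + a 1 * b 1 + a 2 * b 2)]

/-- The cross product as a continuous bilinear map. -/
def crossL : E3 →L[ℝ] E3 →L[ℝ] E3 :=
  LinearMap.mkContinuous₂
    (LinearMap.mk₂ ℝ cross
      (fun a b c => by apply ext3 <;> simp <;> ring)
      (fun t a b => by apply ext3 <;> simp <;> ring)
      (fun a b c => by apply ext3 <;> simp <;> ring)
      (fun t a b => by apply ext3 <;> simp <;> ring)) 1
    (fun a b => by simpa using norm_cross_le a b)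

@[simp] lemma crossL_apply (a b : E3) : crossL a b = cross a b := rfl

lemma cross_smul_right (c : ℝ) (a b : E3) : cross a (c • b) = c • cross a b := by
  simp [← crossL_apply]

lemma cross_sub_left (a b c : E3) : cross (a - b) c = cross a c - cross b c := by
  simp [← crossL_apply]

lemma inner_cross_right (p a b : E3) : inner ℝ p (cross a b) = inner ℝ (cross b p) a := by
  simp only [inner_eq_sum, cross_apply_zero, cross_apply_one, cross_apply_two]; ring

/-- The Binet–Cauchy identity for two cross products with a common factor. -/
lemma inner_cross_cross (t p q : E3) :
    inner ℝ (cross t p) (cross t q) = ‖t‖ ^ 2 * inner ℝ p q - inner ℝ p t * inner ℝ q t := by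
  simp only [norm_sq_eq_sum, inner_eq_sum, cross_apply_zero, cross_apply_one, cross_apply_two]
  ring

lemma ddot_eq_inner (A B : M3) : ddot A B = inner ℝ A B := by
  simp only [ddot, PiLp.inner_apply, RCLike.inner_apply, conj_trivial, Fintype.sum_prod_type]
  simp only [mul_comm]

lemma abs_ddot_le (A B : M3) : |ddot A B| ≤ ‖A‖ * ‖B‖ := by
  rw [ddot_eq_inner]; exact abs_real_inner_le_norm A B

lemma norm_tensor (a b : E3) : ‖tensor a b‖ = ‖a‖ * ‖b‖ := by
  refine (sq_eq_sq₀ (by positivity) (by positivity)).1 ?_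
  rw [mul_pow, ← real_inner_self_eq_norm_sq, ← ddot_eq_inner, norm_sq_eq_sum, norm_sq_eq_sum]
  simp only [ddot, tensor, Fin.sum_univ_three]
  ring

@[simp] lemma tensor_apply (a b : E3) (i j : Fin 3) : tensor a b (i, j) = a i * b j := rfl

lemma norm_idMatrix : ‖idMatrix‖ ≤ 2 := by
  refine abs_le_of_sq_le_sq' ?_ (by positivity) |>.2
  rw [← real_inner_self_eq_norm_sq, ← ddot_eq_inner]
  simp [ddot, idMatrix]
  norm_num

/-- The tensor product as a continuous bilinear map. -/
def tensorL : E3 →L[ℝ] E3 →L[ℝ] M3 :=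
  LinearMap.mkContinuous₂
    (LinearMap.mk₂ ℝ tensor
      (fun a b c => by ext ⟨i, j⟩; simp; ring)
      (fun t a b => by ext ⟨i, j⟩; simp; ring)
      (fun a b c => by ext ⟨i, j⟩; simp; ring)
      (fun t a b => by ext ⟨i, j⟩; simp; ring)) 1
    (fun a b => by simpa using (norm_tensor a b).le)

@[simp] lemma tensorL_apply (a b : E3) : tensorL a b = tensor a b := rfl

lemma norm_tensor_sub_tensor_le {a b : E3} (ha : ‖a‖ ≤ 1) (hb : ‖b‖ ≤ 1) :
    ‖tensor a a - tensor b b‖ ≤ 2 * ‖a - b‖ := by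
  have h : tensor a a - tensor b b = tensor a (a - b) + tensor (a - b) b := by
    ext ⟨i, j⟩; simp; ring
  rw [h]
  refine (norm_add_le _ _).trans ?_
  rw [norm_tensor, norm_tensor]
  nlinarith [norm_nonneg (a - b)]

lemma ddot_tensor_eq_sum (A : M3) (a b : E3) :
    ddot A (tensor a b) = ∑ i : Fin 3, ∑ j : Fin 3,
      A (i, j) * (inner ℝ (EuclideanSpace.single i (1 : ℝ)) a *
        inner ℝ (EuclideanSpace.single j (1 : ℝ)) b) := by
  simp [ddot, EuclideanSpace.inner_single_left]

end

end VortexFilament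

namespace VortexFilament

noncomputable section

/-! ### Integrals of products of powers of distances -/

open Set in
/-- Integrability at the origin needs `p < 3`, integrability at infinity needs `3 < p + q`. -/
lemma integrable_rpow_mul_one_add_rpow {p q : ℝ} (hp : p < 3) (hq : 0 ≤ q) (hpq : 3 < p + q) :
    Integrable (fun y : E3 => ‖y‖ ^ (-p) * (1 + ‖y‖) ^ (-q)) := by
  have key : IntegrableOn (fun r : ℝ => r ^ (3 - 1) • (r ^ (-p) * (1 + r) ^ (-q))) (Ioi 0) := by
    have hm : Measurable (fun r : ℝ => r ^ (3 - 1) • (r ^ (-p) * (1 + r) ^ (-q))) := by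
      fun_prop
    rw [← Ioc_union_Ioi_eq_Ioi (zero_le_one' ℝ)]
    refine IntegrableOn.union ?_ ?_
    · have h1 : IntegrableOn (fun r : ℝ => r ^ (2 - p)) (Ioc 0 1) := by
        rw [← intervalIntegrable_iff_integrableOn_Ioc_of_le zero_le_one]
        exact intervalIntegral.intervalIntegrable_rpow' (by linarith)
      refine h1.mono' hm.aestronglyMeasurable ?_
      filter_upwards [ae_restrict_mem measurableSet_Ioc] with r hr
      have hr0 := hr.1
      rw [Real.norm_of_nonneg (by simp only [smul_eq_mul]; positivity)]
      have e : r ^ (2 - p) = r ^ 2 * r ^ (-p) := by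
        rw [← Real.rpow_natCast r 2, ← Real.rpow_add hr0]; norm_num; ring_nf
      rw [e, smul_eq_mul]
      refine mul_le_mul_of_nonneg_left ?_ (sq_nonneg r)
      have : (1 + r) ^ (-q) ≤ 1 := Real.rpow_le_one_of_one_le_of_nonpos (by linarith) (by linarith)
      nlinarith [Real.rpow_nonneg hr0.le (-p)]
    · have h1 : IntegrableOn (fun r : ℝ => r ^ (2 - p - q)) (Ioi 1) :=
        integrableOn_Ioi_rpow_of_lt (by linarith) one_pos
      refine h1.mono' hm.aestronglyMeasurable ?_
      filter_upwards [ae_restrict_mem measurableSet_Ioi] with r hr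
      have hr1 : (1 : ℝ) < r := hr
      have hr0 : 0 < r := by linarith
      rw [Real.norm_of_nonneg (by simp only [smul_eq_mul]; positivity)]
      have e : r ^ (2 - p - q) = r ^ 2 * (r ^ (-p) * r ^ (-q)) := by
        rw [← Real.rpow_natCast r 2, ← Real.rpow_add hr0, ← Real.rpow_add hr0]; norm_num; ring_nf
      rw [e, smul_eq_mul]
      refine mul_le_mul_of_nonneg_left ?_ (sq_nonneg r)
      refine mul_le_mul_of_nonneg_left ?_ (by positivity)
      exact Real.rpow_le_rpow_of_nonpos hr0 (by linarith) (by linarith)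
  have h3 : Module.finrank ℝ E3 = 3 := by simp
  have := (integrable_fun_norm_addHaar (μ := (volume : Measure E3))
    (f := fun r : ℝ => r ^ (-p) * (1 + r) ^ (-q))).2 (by rw [h3]; exact key)
  exact this

lemma finrank_E3 : Module.finrank ℝ E3 = 3 := by simp

/-- By translation and scaling the integral depends on `D` only through a power of `D`. -/
lemma exists_integral_rpow_mul_add_rpow {p q : ℝ} (hp : p < 3) (hq : 0 ≤ q) (hpq : 3 < p + q) :
    ∃ C : ℝ, 0 ≤ C ∧ ∀ D : ℝ, 0 < D → ∀ a : E3,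
      Integrable (fun x : E3 => ‖a - x‖ ^ (-p) * (D + ‖a - x‖) ^ (-q)) ∧
      ∫ x : E3, ‖a - x‖ ^ (-p) * (D + ‖a - x‖) ^ (-q) = C * D ^ (3 - p - q) := by
  have hI := integrable_rpow_mul_one_add_rpow hp hq hpq
  refine ⟨∫ y : E3, ‖y‖ ^ (-p) * (1 + ‖y‖) ^ (-q), integral_nonneg fun y => by positivity,
    fun D hD a => ?_⟩
  have e : ∀ y : E3, ‖y‖ ^ (-p) * (D + ‖y‖) ^ (-q) =
      D ^ (-p - q) * (‖D⁻¹ • y‖ ^ (-p) * (1 + ‖D⁻¹ • y‖) ^ (-q)) := by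
    intro y
    have h1 : ‖y‖ = D * ‖D⁻¹ • y‖ := by
      rw [norm_smul, Real.norm_of_nonneg (by positivity)]; field_simp
    have h2 : D + ‖y‖ = D * (1 + ‖D⁻¹ • y‖) := by rw [h1]; ring
    rw [h2, Real.mul_rpow hD.le (by positivity)]
    conv_lhs => rw [h1]
    rw [Real.mul_rpow hD.le (by positivity), sub_eq_add_neg (-p) q, Real.rpow_add hD]
    ring
  constructor
  · have h1 : Integrable (fun y : E3 => ‖y‖ ^ (-p) * (D + ‖y‖) ^ (-q)) := by
      simp_rw [e]
      exact ((integrable_comp_smul_iff volume _ (by positivity : D⁻¹ ≠ 0)).2 hI).const_mul _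
    exact h1.comp_sub_left a
  · rw [integral_sub_left_eq_self (fun y : E3 => ‖y‖ ^ (-p) * (D + ‖y‖) ^ (-q)) volume a]
    simp_rw [e]
    rw [integral_const_mul, Measure.integral_comp_smul volume
      (fun y : E3 => ‖y‖ ^ (-p) * (1 + ‖y‖) ^ (-q)), finrank_E3, smul_eq_mul,
      abs_of_nonneg (by positivity)]
    have : D ^ (3 - p - q) = D ^ (-p - q) * ((D⁻¹) ^ 3)⁻¹ := by
      rw [show 3 - p - q = (-p - q) + (3 : ℕ) by push_cast; ring, Real.rpow_add hD,
        Real.rpow_natCast]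
      simp
    rw [this]; ring

/-- Only the smaller of the two distances to `a` and `b` can be small. -/
lemma rpow_mul_rpow_le_add {p q : ℝ} (hp : 0 ≤ p) (hq : 0 ≤ q) {a b : E3} (hab : a ≠ b) (x : E3) :
    ‖a - x‖ ^ (-p) * ‖b - x‖ ^ (-q) ≤
      3 ^ q * (‖a - x‖ ^ (-p) * (‖a - b‖ + ‖a - x‖) ^ (-q)) +
      3 ^ p * (‖b - x‖ ^ (-q) * (‖a - b‖ + ‖b - x‖) ^ (-p)) := by
  have hD : 0 < ‖a - b‖ := norm_pos_iff.2 (sub_ne_zero.2 hab)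
  have htri : ‖a - b‖ ≤ ‖a - x‖ + ‖b - x‖ := by
    have := norm_sub_le (a - x) (b - x); simpa using this
  have aux : ∀ (r u v : ℝ), 0 ≤ r → 0 ≤ u → ‖a - b‖ ≤ u + v → u ≤ v →
      v ^ (-r) ≤ 3 ^ r * (‖a - b‖ + u) ^ (-r) := by
    intro r u v hr hu h1 h2
    have hv : 0 < v := by linarith
    have h3 : (‖a - b‖ + u) / 3 ≤ v := by linarith
    calc v ^ (-r) ≤ ((‖a - b‖ + u) / 3) ^ (-r) :=
          Real.rpow_le_rpow_of_nonpos (by positivity) h3 (by linarith)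
      _ = _ := by
          rw [Real.div_rpow (by positivity) (by positivity), Real.rpow_neg (by norm_num : (0:ℝ) ≤ 3)]
          field_simp
  rcases le_total ‖a - x‖ ‖b - x‖ with h | h
  · have := aux q _ _ hq (norm_nonneg _) htri h
    have h2 : 0 ≤ 3 ^ p * (‖b - x‖ ^ (-q) * (‖a - b‖ + ‖b - x‖) ^ (-p)) := by positivity
    have h3 := mul_le_mul_of_nonneg_left this (Real.rpow_nonneg (norm_nonneg (a - x)) (-p))
    linarith
  · have := aux p _ _ hp (norm_nonneg _) (by linarith) h
    have h2 : 0 ≤ 3 ^ q * (‖a - x‖ ^ (-p) * (‖a - b‖ + ‖a - x‖) ^ (-q)) := by positivity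
    have h3 := mul_le_mul_of_nonneg_left this (Real.rpow_nonneg (norm_nonneg (b - x)) (-q))
    linarith

/-- The composition of two Riesz kernels of `ℝ³` is bounded by a Riesz kernel. -/
lemma exists_integral_rpow_mul_rpow_le {p q : ℝ} (hp0 : 0 ≤ p) (hq0 : 0 ≤ q) (hp : p < 3)
    (hq : q < 3) (hpq : 3 < p + q) :
    ∃ C : ℝ, 0 ≤ C ∧ ∀ a b : E3, a ≠ b →
      Integrable (fun x : E3 => ‖a - x‖ ^ (-p) * ‖b - x‖ ^ (-q)) ∧
      ∫ x : E3, ‖a - x‖ ^ (-p) * ‖b - x‖ ^ (-q) ≤ C * ‖a - b‖ ^ (3 - p - q) := by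
  obtain ⟨C₁, hC₁, h₁⟩ := exists_integral_rpow_mul_add_rpow hp hq0 hpq
  obtain ⟨C₂, hC₂, h₂⟩ := exists_integral_rpow_mul_add_rpow hq hp0 (by linarith)
  refine ⟨3 ^ q * C₁ + 3 ^ p * C₂, by positivity, fun a b hab => ?_⟩
  have hD : 0 < ‖a - b‖ := norm_pos_iff.2 (sub_ne_zero.2 hab)
  obtain ⟨i₁, e₁⟩ := h₁ _ hD a
  obtain ⟨i₂, e₂⟩ := h₂ _ hD b
  have hdom := (i₁.const_mul (3 ^ q)).add (i₂.const_mul (3 ^ p))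
  have hint : Integrable (fun x : E3 => ‖a - x‖ ^ (-p) * ‖b - x‖ ^ (-q)) := by
    refine hdom.mono' (by fun_prop) (.of_forall fun x => ?_)
    rw [Real.norm_of_nonneg (by positivity)]
    exact rpow_mul_rpow_le_add hp0 hq0 hab x
  refine ⟨hint, ?_⟩
  refine (integral_mono hint hdom fun x => rpow_mul_rpow_le_add hp0 hq0 hab x).trans ?_
  simp only [Pi.add_apply]
  rw [integral_add (i₁.const_mul _) (i₂.const_mul _), integral_const_mul, integral_const_mul,
    e₁, e₂, show 3 - q - p = 3 - p - q by ring]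
  exact le_of_eq (by ring)

/-- The bound `(|z| + ε)⁻²` for the kernel at scale `ε`. -/
def reg (ε : ℝ) (z : E3) : ℝ := ((‖z‖ + ε) ^ 2)⁻¹

lemma reg_nonneg (ε : ℝ) (z : E3) : 0 ≤ reg ε z := by unfold reg; positivity

lemma continuous_reg {ε : ℝ} (hε : 0 < ε) : Continuous (reg ε) := by
  unfold reg
  exact Continuous.inv₀ (by fun_prop) (fun z => by positivity)

lemma reg_le_rpow {ε : ℝ} (hε : 0 < ε) {z : E3} (hz : z ≠ 0) : reg ε z ≤ ‖z‖ ^ (-2 : ℝ) := by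
  have : 0 < ‖z‖ := norm_pos_iff.2 hz
  rw [Real.rpow_neg (norm_nonneg _), Real.rpow_two, reg]
  gcongr
  linarith

lemma integrable_reg_mul_reg {ε : ℝ} (hε : 0 < ε) (a b : E3) :
    Integrable (fun x => reg ε (a - x) * reg ε (b - x)) := by
  obtain ⟨C, hC, h⟩ := exists_integral_rpow_mul_add_rpow (p := 0) (q := 4) (by norm_num)
    (by norm_num) (by norm_num)
  have hc := continuous_reg hε
  refine ((h ε hε a).1.add (h ε hε b).1).mono' (by fun_prop) (.of_forall fun x => ?_)
  rw [Real.norm_of_nonneg (mul_nonneg (reg_nonneg _ _) (reg_nonneg _ _))]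
  have e : ∀ z : E3, ‖z‖ ^ (-0 : ℝ) * (ε + ‖z‖) ^ (-4 : ℝ) = reg ε z ^ 2 := by
    intro z
    rw [neg_zero, Real.rpow_zero, one_mul, reg, Real.rpow_neg (by positivity),
      show (4 : ℝ) = (4 : ℕ) by norm_num, Real.rpow_natCast, inv_pow, ← pow_mul, add_comm]
  simp only [Pi.add_apply]
  rw [e, e]
  nlinarith [sq_nonneg (reg ε (a - x) - reg ε (b - x)), sq_nonneg (reg ε (a - x)),
    sq_nonneg (reg ε (b - x))]

/-- The composition of two regularised kernels decays like the inverse distance, regularised at the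
same scale: at distances below `ε` this is the bound of an `L²` norm, above `ε` the composition of
two Riesz kernels. -/
lemma exists_integral_reg_mul_reg_le :
    ∃ C : ℝ, 0 ≤ C ∧ ∀ ε : ℝ, 0 < ε → ∀ a b : E3,
      ∫ x, reg ε (a - x) * reg ε (b - x) ≤ C / (‖a - b‖ + ε) := by
  obtain ⟨C₁, hC₁, h₁⟩ := exists_integral_rpow_mul_add_rpow (p := 0) (q := 4) (by norm_num)
    (by norm_num) (by norm_num)
  obtain ⟨C₂, hC₂, h₂⟩ := exists_integral_rpow_mul_rpow_le (p := 2) (q := 2) (by norm_num)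
    (by norm_num) (by norm_num) (by norm_num) (by norm_num)
  refine ⟨4 * C₁ + 2 * C₂, by positivity, fun ε hε a b => ?_⟩
  rcases le_total ‖a - b‖ ε with hD | hD
  · have e : ∀ z : E3, ‖z‖ ^ (-0 : ℝ) * (ε + ‖z‖) ^ (-4 : ℝ) = reg ε z ^ 2 := by
      intro z
      rw [neg_zero, Real.rpow_zero, one_mul, reg, Real.rpow_neg (by positivity),
        show (4 : ℝ) = (4 : ℕ) by norm_num, Real.rpow_natCast, inv_pow, ← pow_mul, add_comm]
    have hm := integral_mono (integrable_reg_mul_reg hε a b)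
      ((h₁ ε hε a).1.add (h₁ ε hε b).1) (fun x => by
        simp only [Pi.add_apply]
        rw [e, e]
        nlinarith [sq_nonneg (reg ε (a - x) - reg ε (b - x)), sq_nonneg (reg ε (a - x)),
          sq_nonneg (reg ε (b - x))])
    refine hm.trans ?_
    simp only [Pi.add_apply]
    rw [integral_add (h₁ ε hε a).1 (h₁ ε hε b).1, (h₁ ε hε a).2, (h₁ ε hε b).2,
      show (3 - 0 - 4 : ℝ) = -1 by norm_num, Real.rpow_neg_one, le_div_iff₀ (by positivity)]
    have : (‖a - b‖ + ε) * ε⁻¹ ≤ 2 := by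
      rw [← div_eq_mul_inv, div_le_iff₀ hε]; linarith
    nlinarith
  · have hab : a ≠ b := by
      rintro rfl; simp at hD; linarith
    have hD0 : 0 < ‖a - b‖ := norm_pos_iff.2 (sub_ne_zero.2 hab)
    have hm := integral_mono_ae (integrable_reg_mul_reg hε a b) (h₂ a b hab).1 (by
      have hnull : ∀ᵐ x : E3, x ≠ a ∧ x ≠ b := by
        have h1 : ∀ c : E3, ∀ᵐ x : E3, x ≠ c := fun c => by simp [ae_iff]
        exact (h1 a).and (h1 b)
      filter_upwards [hnull] with x hx
      exact mul_le_mul (reg_le_rpow hε (sub_ne_zero.2 hx.1.symm))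
        (reg_le_rpow hε (sub_ne_zero.2 hx.2.symm)) (reg_nonneg _ _) (by positivity))
    refine hm.trans ((h₂ a b hab).2.trans ?_)
    rw [show (3 - 2 - 2 : ℝ) = -1 by norm_num, Real.rpow_neg_one, le_div_iff₀ (by positivity)]
    have : (‖a - b‖ + ε) * ‖a - b‖⁻¹ ≤ 2 := by
      rw [← div_eq_mul_inv, div_le_iff₀ hD0]; linarith
    nlinarith

/-- The error of freezing a `1/2`-Hölder coefficient at `a`. -/
lemma exists_integral_rpow_half_reg_mul_reg_le :
    ∃ C : ℝ, 0 ≤ C ∧ ∀ ε : ℝ, 0 < ε → ∀ a b : E3, a ≠ b →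
      Integrable (fun x => ‖a - x‖ ^ (1 / 2 : ℝ) * (reg ε (a - x) * reg ε (b - x))) ∧
      ∫ x, ‖a - x‖ ^ (1 / 2 : ℝ) * (reg ε (a - x) * reg ε (b - x)) ≤
        C * ‖a - b‖ ^ (-(1 / 2) : ℝ) := by
  obtain ⟨C₂, hC₂, h₂⟩ := exists_integral_rpow_mul_rpow_le (p := 3 / 2) (q := 2) (by norm_num)
    (by norm_num) (by norm_num) (by norm_num) (by norm_num)
  refine ⟨C₂, hC₂, fun ε hε a b hab => ?_⟩
  have hc := continuous_reg hε
  have hle : ∀ᵐ x : E3, ‖a - x‖ ^ (1 / 2 : ℝ) * (reg ε (a - x) * reg ε (b - x)) ≤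
      ‖a - x‖ ^ (-(3 / 2) : ℝ) * ‖b - x‖ ^ (-2 : ℝ) := by
    have hnull : ∀ᵐ x : E3, x ≠ a ∧ x ≠ b := by
      have h1 : ∀ c : E3, ∀ᵐ x : E3, x ≠ c := fun c => by simp [ae_iff]
      exact (h1 a).and (h1 b)
    filter_upwards [hnull] with x hx
    have hp : 0 < ‖a - x‖ := norm_pos_iff.2 (sub_ne_zero.2 hx.1.symm)
    rw [← mul_assoc]
    refine mul_le_mul ?_ (reg_le_rpow hε (sub_ne_zero.2 hx.2.symm)) (reg_nonneg _ _)
      (by positivity)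
    calc ‖a - x‖ ^ (1 / 2 : ℝ) * reg ε (a - x) ≤ ‖a - x‖ ^ (1 / 2 : ℝ) * ‖a - x‖ ^ (-2 : ℝ) := by
          gcongr; exact reg_le_rpow hε (sub_ne_zero.2 hx.1.symm)
      _ = _ := by rw [← Real.rpow_add hp]; norm_num
  have hi : Integrable (fun x => ‖a - x‖ ^ (1 / 2 : ℝ) * (reg ε (a - x) * reg ε (b - x))) := by
    refine (h₂ a b hab).1.mono' (by
      have : Continuous fun x : E3 => ‖a - x‖ ^ (1 / 2 : ℝ) :=
        (by fun_prop : Continuous fun x : E3 => ‖a - x‖).rpow_const (fun x => Or.inr (by norm_num))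
      fun_prop) ?_
    filter_upwards [hle] with x hx
    rwa [Real.norm_of_nonneg (mul_nonneg (by positivity)
      (mul_nonneg (reg_nonneg _ _) (reg_nonneg _ _)))]
  refine ⟨hi, (integral_mono_ae hi (h₂ a b hab).1 hle).trans ((h₂ a b hab).2.trans_eq ?_)⟩
  norm_num

end

end VortexFilament

namespace VortexFilament

noncomputable section

/-! ### A one-dimensional double integral -/

/-- The profile `(1 + z²)^(-3/2)`. -/
def profile (z : ℝ) : ℝ := (√(1 + z ^ 2) ^ 3)⁻¹

/-- The primitive `z / √(1 + z²)` of `profile`. -/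
def profilePrim (z : ℝ) : ℝ := z / √(1 + z ^ 2)

lemma profile_nonneg (z : ℝ) : 0 ≤ profile z := by unfold profile; positivity

lemma continuous_profile : Continuous profile := by
  unfold profile
  exact Continuous.inv₀ (by fun_prop) (fun z => by positivity)

lemma hasDerivAt_profilePrim (z : ℝ) : HasDerivAt profilePrim (profile z) z := by
  have h1 : HasDerivAt (fun z : ℝ => 1 + z ^ 2) (2 * z) z := by
    simpa using (hasDerivAt_pow 2 z).const_add 1
  have hpos : 0 < 1 + z ^ 2 := by positivity
  have h2 := (hasDerivAt_id z).div (h1.sqrt hpos.ne') (by positivity)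
  refine HasDerivAt.congr_deriv (f := profilePrim) h2 ?_
  have hs : √(1 + z ^ 2) ^ 2 = 1 + z ^ 2 := Real.sq_sqrt hpos.le
  have hs0 : √(1 + z ^ 2) ≠ 0 := by positivity
  simp only [profile, id]
  field_simp
  rw [hs]; ring

lemma profilePrim_sq (z : ℝ) : profilePrim z ^ 2 = 1 - (1 + z ^ 2)⁻¹ := by
  have hpos : 0 < 1 + z ^ 2 := by positivity
  rw [profilePrim, div_pow, Real.sq_sqrt hpos.le]
  field_simp
  ring

lemma profilePrim_le_one (z : ℝ) : profilePrim z ≤ 1 := by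
  refine (abs_le_of_sq_le_sq' (b := 1) ?_ zero_le_one).2
  rw [profilePrim_sq]
  have : 0 ≤ (1 + z ^ 2)⁻¹ := by positivity
  linarith

open Filter Topology in
lemma tendsto_profilePrim_atTop : Tendsto profilePrim atTop (𝓝 1) := by
  have h1 : Tendsto (fun z : ℝ => √(1 - (1 + z ^ 2)⁻¹)) atTop (𝓝 √(1 - 0)) := by
    refine (tendsto_const_nhds.sub (tendsto_inv_atTop_zero.comp ?_)).sqrt
    exact tendsto_atTop_add_const_left _ _ (tendsto_pow_atTop two_ne_zero)
  rw [sub_zero, Real.sqrt_one] at h1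
  refine h1.congr' ?_
  filter_upwards [eventually_ge_atTop 0] with z hz
  rw [← profilePrim_sq, Real.sqrt_sq]
  unfold profilePrim; positivity

open Filter Topology in
lemma tendsto_profilePrim_atBot : Tendsto profilePrim atBot (𝓝 (-1)) := by
  have h := (tendsto_profilePrim_atTop.comp tendsto_neg_atBot_atTop).neg
  refine h.congr fun z => ?_
  simp [profilePrim, neg_div]

lemma integrable_profile : Integrable profile := by
  refine integrable_inv_one_add_sq.mono' continuous_profile.aestronglyMeasurable
    (.of_forall fun z => ?_)
  rw [Real.norm_of_nonneg (profile_nonneg z), profile]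
  have hpos : 0 < 1 + z ^ 2 := by positivity
  have hs : √(1 + z ^ 2) ^ 2 = 1 + z ^ 2 := Real.sq_sqrt hpos.le
  have h1 : 1 ≤ √(1 + z ^ 2) := Real.one_le_sqrt.2 (by nlinarith)
  gcongr
  nlinarith

open Set

lemma lintegral_Ioi_profile (a : ℝ) :
    ∫⁻ z in Ioi a, ENNReal.ofReal (profile z) = ENNReal.ofReal (1 - profilePrim a) := by
  rw [← ofReal_integral_eq_lintegral_ofReal integrable_profile.integrableOn
    (.of_forall profile_nonneg), integral_Ioi_of_hasDerivAt_of_nonneg'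
    (fun x _ => hasDerivAt_profilePrim x) (fun x _ => profile_nonneg x) tendsto_profilePrim_atTop]

/-- The integrand is the derivative of `P - P² / 2`, where `P` is the primitive of `profile`. -/
lemma lintegral_profile_mul :
    ∫⁻ z, ENNReal.ofReal (profile z) * ENNReal.ofReal (1 - profilePrim z) = 2 := by
  have hi : Integrable (fun z => profile z * (1 - profilePrim z)) := by
    refine (integrable_profile.const_mul 2).mono' ?_ (.of_forall fun z => ?_)
    · have : Continuous profilePrim :=
        continuous_iff_continuousAt.2 fun z => (hasDerivAt_profilePrim z).continuousAt
      have := continuous_profile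
      fun_prop
    · have h1 := profilePrim_le_one z
      have h2 : -1 ≤ profilePrim z := by
        have := profilePrim_le_one (-z)
        simp only [profilePrim, neg_sq, neg_div] at this ⊢
        linarith
      rw [Real.norm_of_nonneg (mul_nonneg (profile_nonneg z) (by linarith))]
      nlinarith [profile_nonneg z]
  have hd : ∀ z, HasDerivAt (fun z => profilePrim z - profilePrim z ^ 2 / 2)
      (profile z * (1 - profilePrim z)) z := by
    intro z
    have h := hasDerivAt_profilePrim z
    refine HasDerivAt.congr_deriv (h.sub ((h.pow 2).div_const 2)) ?_
    simp; ring
  have hI := integral_of_hasDerivAt_of_tendsto hd hi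
    (tendsto_profilePrim_atBot.sub ((tendsto_profilePrim_atBot.pow 2).div_const 2))
    (tendsto_profilePrim_atTop.sub ((tendsto_profilePrim_atTop.pow 2).div_const 2))
  have hnn : ∀ z, 0 ≤ profile z * (1 - profilePrim z) := fun z =>
    mul_nonneg (profile_nonneg z) (by linarith [profilePrim_le_one z])
  simp_rw [← ENNReal.ofReal_mul (profile_nonneg _)]
  rw [← ofReal_integral_eq_lintegral_ofReal hi (.of_forall hnn), hI]
  norm_num

lemma lintegral_comp_mul_left {c : ℝ} (hc : 0 < c) (f : ℝ → ENNReal) :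
    ∫⁻ x, f x = ENNReal.ofReal c * ∫⁻ x, f (c * x) := by
  have h := Real.smul_map_volume_mul_left hc.ne'
  conv_lhs => rw [← h]
  have he : MeasurableEmbedding (fun x : ℝ => c * x) :=
    (Homeomorph.mulLeft₀ c hc.ne').measurableEmbedding
  rw [lintegral_smul_measure, abs_of_pos hc, he.lintegral_map, smul_eq_mul]

lemma lintegral_profile_profile :
    ∫⁻ y in Ioi (0 : ℝ), ∫⁻ z, ENNReal.ofReal (profile z) * ENNReal.ofReal (profile (z + y)) =
      2 := by
  have hc := continuous_profile
  rw [lintegral_lintegral_swap (by fun_prop)]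
  have : ∀ z, ∫⁻ y in Ioi (0 : ℝ), ENNReal.ofReal (profile z) * ENNReal.ofReal (profile (z + y)) =
      ENNReal.ofReal (profile z) * ENNReal.ofReal (1 - profilePrim z) := by
    intro z
    rw [lintegral_const_mul _ (by fun_prop), ← lintegral_Ioi_profile]
    congr 1
    have hp := (measurePreserving_add_left (volume : Measure ℝ) z).setLIntegral_comp_preimage_emb
      (measurableEmbedding_addLeft z) (fun w => ENNReal.ofReal (profile w)) (Ioi z)
    rw [← hp]
    congr 2
    ext y; simp
  simp_rw [this]
  exact lintegral_profile_mul

/-- The change of variables `r ↦ 1 / r` on the half-line. -/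
lemma lintegral_Ioi_inv (f : ℝ → ENNReal) :
    ∫⁻ r in Ioi (0 : ℝ), ENNReal.ofReal ((r ^ 2)⁻¹) * f r⁻¹ = ∫⁻ y in Ioi (0 : ℝ), f y := by
  have himg : (fun r : ℝ => r⁻¹) '' Ioi 0 = Ioi 0 := by
    rw [image_inv_eq_inv]; ext; simp
  have h := lintegral_image_eq_lintegral_abs_deriv_mul (s := Ioi (0 : ℝ)) (f := fun r => r⁻¹)
    (f' := fun r => -(r ^ 2)⁻¹) measurableSet_Ioi
    (fun r hr => (hasDerivAt_inv (ne_of_gt hr)).hasDerivWithinAt)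
    (inv_injective.injOn) f
  rw [himg] at h
  rw [h]
  refine setLIntegral_congr_fun measurableSet_Ioi fun r _ => ?_
  simp only [abs_neg]
  rw [abs_of_nonneg (by positivity)]

end

end VortexFilament

namespace VortexFilament

noncomputable section

/-! ### The correlation of the kernel with itself -/

open Set

lemma lintegral_E3 {f : E3 → ENNReal} (hf : Measurable f) :
    ∫⁻ y, f y = ∫⁻ z : ℝ, ∫⁻ p : ℝ × ℝ, f !₂[p.1, p.2, z] := by
  have h1 := (PiLp.volume_preserving_toLp (Fin 3)).lintegral_comp_emb
    (MeasurableEquiv.toLp 2 (Fin 3 → ℝ)).measurableEmbedding f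
  rw [← h1, ← (volume_preserving_piFinSuccAbove (fun _ : Fin 3 => ℝ) 2).symm.lintegral_comp_emb
    (MeasurableEquiv.measurableEmbedding _), Measure.volume_eq_prod, lintegral_prod]
  · refine lintegral_congr fun z => ?_
    rw [← (volume_preserving_finTwoArrow ℝ).symm.lintegral_comp_emb
      (MeasurableEquiv.measurableEmbedding _)]
    refine lintegral_congr fun p => ?_
    congr 1
    ext i
    fin_cases i <;> rfl
  · refine Measurable.aemeasurable ?_
    refine hf.comp ((MeasurableEquiv.toLp 2 (Fin 3 → ℝ)).measurable.comp ?_)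
    exact (MeasurableEquiv.piFinSuccAbove (fun _ : Fin 3 => ℝ) 2).symm.measurable

/-- Integration of a radial function of the plane in polar coordinates. -/
lemma lintegral_radial_plane {g : ℝ → ENNReal} (hg : Measurable g) :
    ∫⁻ p : ℝ × ℝ, g (p.1 ^ 2 + p.2 ^ 2) =
      ENNReal.ofReal (2 * Real.pi) * ∫⁻ r in Ioi (0 : ℝ), ENNReal.ofReal r * g (r ^ 2) := by
  rw [← lintegral_comp_polarCoord_symm]
  have : ∀ p : ℝ × ℝ, ENNReal.ofReal p.1 • g ((polarCoord.symm p).1 ^ 2 + (polarCoord.symm p).2 ^ 2)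
      = ENNReal.ofReal p.1 * g (p.1 ^ 2) * 1 := by
    intro p
    simp only [polarCoord_symm_apply, smul_eq_mul, mul_one]
    congr 2
    rw [mul_pow, mul_pow, ← mul_add, Real.cos_sq_add_sin_sq, mul_one]
  simp_rw [this]
  rw [polarCoord_target, Measure.volume_eq_prod, ← Measure.prod_restrict, lintegral_prod_mul
    (f := fun r => ENNReal.ofReal r * g (r ^ 2)) (g := fun _ => 1) (by fun_prop) (by fun_prop)]
  simp only [lintegral_const, Measure.restrict_apply, MeasurableSet.univ, univ_inter,
    Real.volume_Ioo, one_mul]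
  rw [mul_comm]
  congr 2
  ring

lemma sqrt_scale {r : ℝ} (hr : 0 < r) (w : ℝ) :
    √(r ^ 2 + (r * w) ^ 2) = r * √(1 + w ^ 2) := by
  rw [show r ^ 2 + (r * w) ^ 2 = r ^ 2 * (1 + w ^ 2) by ring, Real.sqrt_mul (by positivity),
    Real.sqrt_sq hr.le]

lemma norm_eq_sqrt (a : E3) : ‖a‖ = √(a 0 ^ 2 + a 1 ^ 2 + a 2 ^ 2) := by
  rw [← norm_sq_eq_sum, Real.sqrt_sq (norm_nonneg a)]

/-- In cylindrical coordinates `(r, θ, z)`, scaling `z` by `r` and inverting `r` removes the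
distance from the axis, and the integral becomes a product. -/
lemma lintegral_axial_correlation :
    ∫⁻ y : E3, ENNReal.ofReal ((y 0 ^ 2 + y 1 ^ 2) *
      ((‖EuclideanSpace.single 2 (1 : ℝ) + y‖ ^ 3)⁻¹ * (‖y‖ ^ 3)⁻¹)) =
      ENNReal.ofReal (4 * Real.pi) := by
  set G : ℝ → ℝ → ENNReal := fun z s =>
    ENNReal.ofReal (s * ((√(s + (1 + z) ^ 2) ^ 3)⁻¹ * (√(s + z ^ 2) ^ 3)⁻¹)) with hG
  have hGm : Measurable (fun x : ℝ × ℝ => G x.1 x.2) := by simp only [hG]; fun_prop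
  rw [lintegral_E3 (by fun_prop)]
  have h1 : ∀ z : ℝ, ∫⁻ p : ℝ × ℝ, ENNReal.ofReal (((!₂[p.1, p.2, z] : E3) 0 ^ 2 +
      (!₂[p.1, p.2, z] : E3) 1 ^ 2) *
      ((‖EuclideanSpace.single 2 (1 : ℝ) + (!₂[p.1, p.2, z] : E3)‖ ^ 3)⁻¹ *
        (‖(!₂[p.1, p.2, z] : E3)‖ ^ 3)⁻¹)) =
      ENNReal.ofReal (2 * Real.pi) * ∫⁻ r in Ioi (0 : ℝ), ENNReal.ofReal r * G z (r ^ 2) := by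
    intro z
    rw [← lintegral_radial_plane (g := G z) (by fun_prop)]
    refine lintegral_congr fun p => ?_
    simp only [hG]
    rw [norm_eq_sqrt, norm_eq_sqrt]
    simp
  simp_rw [h1]
  rw [lintegral_const_mul _ (by fun_prop), lintegral_lintegral_swap (by fun_prop)]
  have h2 : ∀ r ∈ Ioi (0 : ℝ), ∫⁻ z, ENNReal.ofReal r * G z (r ^ 2) =
      ENNReal.ofReal ((r ^ 2)⁻¹) *
        ∫⁻ z, ENNReal.ofReal (profile z) * ENNReal.ofReal (profile (z + r⁻¹)) := by
    intro r hr
    have hr : 0 < r := hr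
    have hc := continuous_profile
    rw [lintegral_comp_mul_left hr, ← lintegral_const_mul _ (by fun_prop),
      ← lintegral_const_mul _ (by fun_prop)]
    refine lintegral_congr fun z => ?_
    simp only [hG]
    rw [← ENNReal.ofReal_mul (by positivity), ← ENNReal.ofReal_mul (by positivity),
      ← ENNReal.ofReal_mul (profile_nonneg _), ← ENNReal.ofReal_mul (by positivity),
      sqrt_scale hr, show 1 + r * z = r * (z + r⁻¹) by field_simp; ring, sqrt_scale hr]
    congr 1
    simp only [profile]
    field_simp
  rw [setLIntegral_congr_fun measurableSet_Ioi h2,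
    lintegral_Ioi_inv (fun y => ∫⁻ z, ENNReal.ofReal (profile z) * ENNReal.ofReal (profile (z + y))),
    lintegral_profile_profile, show (4 * Real.pi) = 2 * Real.pi * 2 by ring,
    ENNReal.ofReal_mul (p := 2 * Real.pi) (by positivity)]
  simp

/-- The kernel `y / |y|³`, that is `4π` times the Biot–Savart kernel. -/
def kern (y : E3) : E3 := (‖y‖ ^ 3)⁻¹ • y

lemma measurable_kern : Measurable kern := by unfold kern; fun_prop

lemma norm_kern (y : E3) : ‖kern y‖ = ‖y‖ ^ (-2 : ℝ) := by
  rw [kern, norm_smul, norm_inv, norm_pow, norm_norm, Real.rpow_neg (norm_nonneg y), Real.rpow_two]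
  rcases eq_or_ne y 0 with rfl | hy
  · simp
  · have := norm_pos_iff.2 hy
    field_simp

lemma kern_smul {c : ℝ} (hc : 0 < c) (y : E3) : kern (c • y) = (c ^ 2)⁻¹ • kern y := by
  rw [kern, kern, norm_smul, Real.norm_of_nonneg hc.le, smul_smul, smul_smul]
  congr 1
  field_simp

lemma kern_isometry (L : E3 ≃ₗᵢ[ℝ] E3) (y : E3) : kern (L y) = L (kern y) := by
  rw [kern, kern, L.norm_map, map_smul]

/-- The correlation `∫ ⟨p, k(d + y)⟩ ⟨q, k(y)⟩ dy` of the kernel with itself. -/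
def correlation (d p q : E3) : ℝ := ∫ y, inner ℝ p (kern (d + y)) * inner ℝ q (kern y)

lemma abs_inner_kern_mul_le (d p q y : E3) : |inner ℝ p (kern (d + y)) * inner ℝ q (kern y)| ≤
    ‖p‖ * ‖q‖ * (‖-d - y‖ ^ (-2 : ℝ) * ‖0 - y‖ ^ (-2 : ℝ)) := by
  have e1 : ‖-d - y‖ = ‖d + y‖ := by rw [← norm_neg]; congr 1; abel
  have e2 : ‖0 - y‖ = ‖y‖ := by simp
  rw [e1, e2, ← norm_kern, ← norm_kern, abs_mul]
  calc |inner ℝ p (kern (d + y))| * |inner ℝ q (kern y)|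
      ≤ (‖p‖ * ‖kern (d + y)‖) * (‖q‖ * ‖kern y‖) :=
        mul_le_mul (abs_real_inner_le_norm _ _) (abs_real_inner_le_norm _ _) (abs_nonneg _)
          (by positivity)
    _ = _ := by ring

lemma integrable_correlation {d : E3} (hd : d ≠ 0) (p q : E3) :
    Integrable (fun y => inner ℝ p (kern (d + y)) * inner ℝ q (kern y)) := by
  obtain ⟨C, -, h⟩ := exists_integral_rpow_mul_rpow_le (p := 2) (q := 2) (by norm_num)
    (by norm_num) (by norm_num) (by norm_num) (by norm_num)
  have hm := measurable_kern
  refine ((h (-d) 0 (by simpa using hd)).1.const_mul (‖p‖ * ‖q‖)).mono' (by fun_prop)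
    (.of_forall fun y => ?_)
  exact abs_inner_kern_mul_le d p q y

lemma correlation_isometry (L : E3 ≃ₗᵢ[ℝ] E3) (d p q : E3) :
    correlation (L d) (L p) (L q) = correlation d p q := by
  unfold correlation
  rw [← L.measurePreserving.integral_comp L.toHomeomorph.measurableEmbedding]
  refine integral_congr_ae (.of_forall fun y => ?_)
  simp only
  rw [← map_add, kern_isometry, kern_isometry, L.inner_map_map, L.inner_map_map]

lemma correlation_smul {c : ℝ} (hc : 0 < c) (d p q : E3) :
    correlation (c • d) p q = c⁻¹ * correlation d p q := by
  unfold correlation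
  have h := Measure.integral_comp_smul (volume : Measure E3)
    (fun y => inner ℝ p (kern (c • d + y)) * inner ℝ q (kern y)) c
  rw [finrank_E3, abs_of_nonneg (by positivity), smul_eq_mul] at h
  have h2 : ∫ y, inner ℝ p (kern (c • d + c • y)) * inner ℝ q (kern (c • y)) =
      (c ^ 4)⁻¹ * ∫ y, inner ℝ p (kern (d + y)) * inner ℝ q (kern y) := by
    rw [← integral_const_mul]
    refine integral_congr_ae (.of_forall fun y => ?_)
    simp only
    rw [← smul_add, kern_smul hc, kern_smul hc, inner_smul_right, inner_smul_right]
    field_simp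
  rw [h2] at h
  field_simp at h
  field_simp
  linarith

lemma correlation_add_left {d : E3} (hd : d ≠ 0) (p p' q : E3) :
    correlation d (p + p') q = correlation d p q + correlation d p' q := by
  unfold correlation
  rw [← integral_add (integrable_correlation hd _ _) (integrable_correlation hd _ _)]
  simp only [inner_add_left, add_mul]

lemma correlation_add_right {d : E3} (hd : d ≠ 0) (p q q' : E3) :
    correlation d p (q + q') = correlation d p q + correlation d p q' := by
  unfold correlation
  rw [← integral_add (integrable_correlation hd _ _) (integrable_correlation hd _ _)]
  simp only [inner_add_left, mul_add]

lemma correlation_smul_left (c : ℝ) (d p q : E3) :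
    correlation d (c • p) q = c * correlation d p q := by
  unfold correlation
  rw [← integral_const_mul]
  simp only [inner_smul_left, conj_trivial, mul_assoc]

lemma correlation_smul_right (c : ℝ) (d p q : E3) :
    correlation d p (c • q) = c * correlation d p q := by
  unfold correlation
  rw [← integral_const_mul]
  simp only [inner_smul_left, conj_trivial]
  congr 1; ext y; ring

/-- The `i`-th standard basis vector. -/
def bvec (i : Fin 3) : E3 := EuclideanSpace.single i 1

@[simp] lemma bvec_apply (i j : Fin 3) : bvec i j = if j = i then 1 else 0 := by
  simp [bvec]

lemma norm_bvec (i : Fin 3) : ‖bvec i‖ = 1 := by simp [bvec]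

lemma bvec_ne_zero (i : Fin 3) : bvec i ≠ 0 := by
  rw [← norm_pos_iff, norm_bvec]; norm_num

lemma sum_smul_bvec (p : E3) : p = p 0 • bvec 0 + p 1 • bvec 1 + p 2 • bvec 2 := by
  apply ext3 <;> simp

lemma inner_bvec (i : Fin 3) (p : E3) : inner ℝ (bvec i) p = p i := by
  simp [bvec, EuclideanSpace.inner_single_left]

/-- The reflection exchanging `v` and `w`, when these have the same length. -/
lemma exists_isometry_swap {v w : E3} (h : ‖v‖ = ‖w‖) :
    ∃ L : E3 ≃ₗᵢ[ℝ] E3, L v = w ∧ L w = v ∧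
      ∀ u, inner ℝ v u = (0 : ℝ) → inner ℝ w u = (0 : ℝ) → L u = u := by
  refine ⟨(ℝ ∙ (v - w))ᗮ.reflection, Submodule.reflection_sub h, ?_, fun u hv hw => ?_⟩
  · have h1 : (v - w) = -(w - v) := by abel
    have h2 : (ℝ ∙ (v - w)) = ℝ ∙ (w - v) := by
      rw [h1, ← neg_one_smul ℝ (w - v)]
      exact Submodule.span_singleton_smul_eq (isUnit_one.neg) _
    simp only [h2]
    exact Submodule.reflection_sub h.symm
  · rw [Submodule.reflection_eq_self_iff, Submodule.mem_orthogonal_singleton_iff_inner_right,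
      inner_sub_left, hv, hw, sub_zero]

lemma inner_bvec_bvec_ne {i j : Fin 3} (h : i ≠ j) : inner ℝ (bvec i) (bvec j) = (0 : ℝ) := by
  simp [inner_bvec, h]

/-- Reflections show that the correlation along an axis is diagonal. -/
lemma correlation_bvec_ne {i j : Fin 3} (h : i ≠ j) (hi : i ≠ 2) :
    correlation (bvec 2) (bvec i) (bvec j) = 0 ∧ correlation (bvec 2) (bvec j) (bvec i) = 0 := by
  -- The reflection that changes the sign of `bvec i` alone.
  obtain ⟨L, h1, -, h3⟩ := exists_isometry_swap (v := bvec i) (w := -bvec i) (by simp)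
  have hL : ∀ k, i ≠ k → L (bvec k) = bvec k := fun k hk =>
    h3 _ (inner_bvec_bvec_ne hk) (by simp [inner_bvec_bvec_ne hk])
  have a := correlation_isometry L (bvec 2) (bvec i) (bvec j)
  have b := correlation_isometry L (bvec 2) (bvec j) (bvec i)
  rw [hL 2 hi, hL j h, h1, ← neg_one_smul ℝ (bvec i)] at a b
  rw [correlation_smul_left] at a
  rw [correlation_smul_right] at b
  constructor <;> linarith

lemma correlation_bvec_zero_eq_one : correlation (bvec 2) (bvec 0) (bvec 0) =
    correlation (bvec 2) (bvec 1) (bvec 1) := by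
  obtain ⟨L, h1, -, h3⟩ := exists_isometry_swap (v := bvec 0) (w := bvec 1) (by simp [norm_bvec])
  have a := correlation_isometry L (bvec 2) (bvec 0) (bvec 0)
  rw [h1, h3 (bvec 2) (inner_bvec_bvec_ne (by decide)) (inner_bvec_bvec_ne (by decide))] at a
  exact a.symm

/-- By symmetry this is half of the integral of the axial density, where the angle and the distance
from the axis can be integrated out. -/
lemma correlation_bvec_zero : correlation (bvec 2) (bvec 0) (bvec 0) = 2 * Real.pi := by
  have hsum : correlation (bvec 2) (bvec 0) (bvec 0) + correlation (bvec 2) (bvec 1) (bvec 1) =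
      4 * Real.pi := by
    unfold correlation
    rw [← integral_add (integrable_correlation (bvec_ne_zero 2) _ _)
      (integrable_correlation (bvec_ne_zero 2) _ _)]
    have : ∀ y : E3, inner ℝ (bvec 0) (kern (bvec 2 + y)) * inner ℝ (bvec 0) (kern y) +
        inner ℝ (bvec 1) (kern (bvec 2 + y)) * inner ℝ (bvec 1) (kern y) =
        (y 0 ^ 2 + y 1 ^ 2) *
          ((‖EuclideanSpace.single 2 (1 : ℝ) + y‖ ^ 3)⁻¹ * (‖y‖ ^ 3)⁻¹) := by
      intro y
      simp only [inner_bvec, kern, PiLp.smul_apply, PiLp.add_apply, bvec_apply, smul_eq_mul]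
      have e0 : ((0 : Fin 3) = 2) = False := by decide
      have e1 : ((1 : Fin 3) = 2) = False := by decide
      simp only [bvec, e0, e1, if_false]
      ring
    simp_rw [this]
    rw [integral_eq_lintegral_of_nonneg_ae (.of_forall fun y => by positivity) (by fun_prop),
      lintegral_axial_correlation, ENNReal.toReal_ofReal (by positivity)]
  rw [← correlation_bvec_zero_eq_one] at hsum
  linarith

/-- The correlation of the kernel with itself. By rotational symmetry and homogeneity it is
determined by its transversal and its longitudinal coefficient. Only the transversal one, `2π`,
has to be known: the longitudinal coefficient drops out when `p` and `q` are cross products with a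
vector parallel to `d`. -/
lemma exists_correlation_eq : ∃ β : ℝ, ∀ d : E3, d ≠ 0 → ∀ p q : E3, correlation d p q =
    ‖d‖⁻¹ * (2 * Real.pi * inner ℝ p q +
      β * (inner ℝ p (‖d‖⁻¹ • d) * inner ℝ q (‖d‖⁻¹ • d))) := by
  refine ⟨correlation (bvec 2) (bvec 2) (bvec 2) - 2 * Real.pi, fun d hd p q => ?_⟩
  have hd0 : 0 < ‖d‖ := norm_pos_iff.2 hd
  have key : ∀ p q : E3, correlation (bvec 2) p q = 2 * Real.pi * inner ℝ p q +
      (correlation (bvec 2) (bvec 2) (bvec 2) - 2 * Real.pi) *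
        (inner ℝ p (bvec 2) * inner ℝ q (bvec 2)) := by
    intro p q
    have h01 := correlation_bvec_ne (i := 0) (j := 1) (by decide) (by decide)
    have h02 := correlation_bvec_ne (i := 0) (j := 2) (by decide) (by decide)
    have h12 := correlation_bvec_ne (i := 1) (j := 2) (by decide) (by decide)
    have h2 := bvec_ne_zero 2
    conv_lhs => rw [sum_smul_bvec p, sum_smul_bvec q]
    simp only [correlation_add_left h2, correlation_add_right h2, correlation_smul_left,
      correlation_smul_right, h01.1, h01.2, h02.1, h02.2, h12.1, h12.2,
      ← correlation_bvec_zero_eq_one, correlation_bvec_zero]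
    have e : ∀ p : E3, inner ℝ p (bvec 2) = p 2 := fun p => by rw [real_inner_comm, inner_bvec]
    rw [e, e, inner_eq_sum]
    ring
  obtain ⟨L, h1, -, -⟩ := exists_isometry_swap (v := bvec 2) (w := ‖d‖⁻¹ • d) (by
    rw [norm_bvec, norm_smul, norm_inv, norm_norm]; field_simp)
  have e : d = ‖d‖ • (L (bvec 2)) := by rw [h1, smul_smul]; field_simp; simp
  have hLp : ∀ p, L (L.symm p) = p := fun p => L.apply_symm_apply p
  conv_lhs => rw [e, ← hLp p, ← hLp q]
  rw [correlation_smul hd0, correlation_isometry, key, ← L.inner_map_map, hLp, hLp,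
    ← L.inner_map_map (L.symm p) (bvec 2), ← L.inner_map_map (L.symm q) (bvec 2), hLp, hLp, h1]

end

end VortexFilament

namespace VortexFilament

noncomputable section

/-! ### The mollified kernel -/

variable {ρ : E3 → ℝ} {ε : ℝ}

lemma IsRadialMollifier.eq_zero_of_one_lt (hρ : IsRadialMollifier ρ) {x : E3} (hx : 1 < ‖x‖) :
    ρ x = 0 := by
  by_contra h
  have := hρ.supported (subset_tsupport ρ h)
  simp at this
  linarith

lemma IsRadialMollifier.hasCompactSupport (hρ : IsRadialMollifier ρ) : HasCompactSupport ρ :=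
  (isCompact_closedBall 0 1).of_isClosed_subset (isClosed_tsupport ρ) hρ.supported

lemma IsRadialMollifier.exists_bound (hρ : IsRadialMollifier ρ) : ∃ M : ℝ, 0 ≤ M ∧ ∀ x, ρ x ≤ M := by
  obtain ⟨M, hM⟩ := hρ.hasCompactSupport.exists_bound_of_continuous hρ.smooth.continuous
  exact ⟨M, (norm_nonneg _).trans (hM 0), fun x => (le_abs_self _).trans (hM x)⟩

lemma rescale_nonneg (hρ : IsRadialMollifier ρ) (hε : 0 < ε) (x : E3) : 0 ≤ rescale ρ ε x :=
  mul_nonneg (by positivity) (hρ.nonneg _)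

lemma rescale_contDiff (hρ : IsRadialMollifier ρ) (ε : ℝ) : ContDiff ℝ ∞ (rescale ρ ε) := by
  unfold rescale
  exact contDiff_const.mul (hρ.smooth.comp (contDiff_const_smul _))

lemma rescale_eq_zero (hρ : IsRadialMollifier ρ) (hε : 0 < ε) {x : E3} (hx : ε < ‖x‖) :
    rescale ρ ε x = 0 := by
  rw [rescale, hρ.eq_zero_of_one_lt, mul_zero]
  rw [norm_smul, Real.norm_of_nonneg (by positivity), inv_mul_eq_div, one_lt_div hε]
  exact hx

lemma rescale_hasCompactSupport (hρ : IsRadialMollifier ρ) (hε : 0 < ε) :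
    HasCompactSupport (rescale ρ ε) := by
  refine HasCompactSupport.intro (isCompact_closedBall 0 ε) fun x hx => rescale_eq_zero hρ hε ?_
  simpa using hx

lemma integrable_rescale (hρ : IsRadialMollifier ρ) (hε : 0 < ε) : Integrable (rescale ρ ε) :=
  (rescale_contDiff hρ ε).continuous.integrable_of_hasCompactSupport
    (rescale_hasCompactSupport hρ hε)

lemma integral_rescale (hρ : IsRadialMollifier ρ) (hε : 0 < ε) : ∫ x, rescale ρ ε x = 1 := by
  unfold rescale
  rw [integral_const_mul, Measure.integral_comp_smul, finrank_E3, hρ.integral_eq_one,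
    abs_of_nonneg (by positivity), smul_eq_mul]
  field_simp

/-- The probability measure with density `ρ^ε`. -/
def mollMeasure (ρ : E3 → ℝ) (ε : ℝ) : Measure E3 :=
  volume.withDensity fun u => ENNReal.ofReal (rescale ρ ε u)

lemma measurable_rescale (hρ : IsRadialMollifier ρ) (ε : ℝ) : Measurable (rescale ρ ε) :=
  (rescale_contDiff hρ ε).continuous.measurable

lemma isProbabilityMeasure_mollMeasure (hρ : IsRadialMollifier ρ) (hε : 0 < ε) :
    IsProbabilityMeasure (mollMeasure ρ ε) := by
  constructor
  rw [mollMeasure, withDensity_apply _ MeasurableSet.univ, setLIntegral_univ,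
    ← ofReal_integral_eq_lintegral_ofReal (integrable_rescale hρ hε)
      (.of_forall (rescale_nonneg hρ hε)), integral_rescale hρ hε, ENNReal.ofReal_one]

lemma integral_mollMeasure {F : Type*} [NormedAddCommGroup F] [NormedSpace ℝ F]
    (hρ : IsRadialMollifier ρ) (hε : 0 < ε) (f : E3 → F) :
    ∫ u, f u ∂(mollMeasure ρ ε) = ∫ u, rescale ρ ε u • f u := by
  rw [mollMeasure, integral_withDensity_eq_integral_toReal_smul
    (measurable_rescale hρ ε).ennreal_ofReal (by simp)]
  simp_rw [ENNReal.toReal_ofReal (rescale_nonneg hρ hε _)]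

lemma integrable_mollMeasure {F : Type*} [NormedAddCommGroup F] [NormedSpace ℝ F]
    (hρ : IsRadialMollifier ρ) (hε : 0 < ε) {f : E3 → F} :
    Integrable f (mollMeasure ρ ε) ↔ Integrable (fun u => rescale ρ ε u • f u) := by
  rw [mollMeasure, integrable_withDensity_iff_integrable_smul'
    (measurable_rescale hρ ε).ennreal_ofReal (by simp)]
  simp_rw [ENNReal.toReal_ofReal (rescale_nonneg hρ hε _)]

lemma ae_mollMeasure (hρ : IsRadialMollifier ρ) (hε : 0 < ε) :
    ∀ᵐ u ∂(mollMeasure ρ ε), ‖u‖ ≤ ε := by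
  rw [mollMeasure, ae_withDensity_iff (measurable_rescale hρ ε).ennreal_ofReal]
  refine .of_forall fun u hu => ?_
  by_contra h
  exact hu (by rw [rescale_eq_zero hρ hε (not_le.1 h), ENNReal.ofReal_zero])

lemma integrable_mollMeasure_of_continuous {F : Type*} [NormedAddCommGroup F] [NormedSpace ℝ F]
    (hρ : IsRadialMollifier ρ) (hε : 0 < ε) {f : E3 → F} (hf : Continuous f) :
    Integrable f (mollMeasure ρ ε) := by
  rw [integrable_mollMeasure hρ hε]
  exact ((rescale_contDiff hρ ε).continuous.smul hf).integrable_of_hasCompactSupport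
    (rescale_hasCompactSupport hρ hε).smul_right

lemma rescale_le {M : ℝ} (hM : ∀ x, ρ x ≤ M) (hε : 0 < ε) (x : E3) :
    rescale ρ ε x ≤ (ε ^ 3)⁻¹ * M := by
  unfold rescale
  gcongr
  exact hM _

/-- Mollification regularises the singularity of the kernel at scale `ε`. -/
lemma exists_mollified_rpow_le (hρ : IsRadialMollifier ρ) :
    ∃ C : ℝ, 0 ≤ C ∧ ∀ ε : ℝ, 0 < ε → ∀ z : E3,
      Integrable (fun u => ‖z + u‖ ^ (-2 : ℝ)) (mollMeasure ρ ε) ∧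
      ∫ u, ‖z + u‖ ^ (-2 : ℝ) ∂(mollMeasure ρ ε) ≤ C * reg ε z := by
  obtain ⟨M, hM0, hM⟩ := hρ.exists_bound
  obtain ⟨C, hC, h⟩ := exists_integral_rpow_mul_add_rpow (p := 2) (q := 2) (by norm_num)
    (by norm_num) (by norm_num)
  refine ⟨9 + 144 * M * C, by positivity, fun ε hε z => ?_⟩
  obtain ⟨hi, he⟩ := h ε hε (-z)
  have en : ∀ u, ‖-z - u‖ = ‖z + u‖ := fun u => by rw [← norm_neg]; congr 1; abel
  simp_rw [en] at hi he
  have hm := measurable_rescale hρ ε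
  have hle : ∀ R : ℝ, 0 < R → ‖z‖ + 2 * ε ≤ R → ∀ u, rescale ρ ε u • ‖z + u‖ ^ (-2 : ℝ) ≤
      ((ε ^ 3)⁻¹ * M * R ^ 2) * (‖z + u‖ ^ (-2 : ℝ) * (ε + ‖z + u‖) ^ (-2 : ℝ)) := by
    intro R hR hR' u
    rw [smul_eq_mul]
    rcases lt_or_ge ε ‖u‖ with hu | hu
    · rw [rescale_eq_zero hρ hε hu, zero_mul]; positivity
    have h1 : ε + ‖z + u‖ ≤ R := by linarith [norm_add_le z u]
    have h2 : 1 ≤ R ^ 2 * (ε + ‖z + u‖) ^ (-2 : ℝ) := by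
      rw [Real.rpow_neg (by positivity), Real.rpow_two, ← div_eq_mul_inv,
        one_le_div (by positivity)]
      gcongr
    calc rescale ρ ε u * ‖z + u‖ ^ (-2 : ℝ) ≤ ((ε ^ 3)⁻¹ * M) * ‖z + u‖ ^ (-2 : ℝ) := by
          gcongr; exact rescale_le hM hε u
      _ ≤ ((ε ^ 3)⁻¹ * M) * ‖z + u‖ ^ (-2 : ℝ) * (R ^ 2 * (ε + ‖z + u‖) ^ (-2 : ℝ)) :=
          le_mul_of_one_le_right (by positivity) h2
      _ = _ := by ring
  have hint : Integrable (fun u => rescale ρ ε u • ‖z + u‖ ^ (-2 : ℝ)) := by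
    refine (hi.const_mul ((ε ^ 3)⁻¹ * M * (‖z‖ + 2 * ε) ^ 2)).mono' (by fun_prop)
      (.of_forall fun u => ?_)
    rw [Real.norm_of_nonneg (smul_nonneg (rescale_nonneg hρ hε u) (by positivity))]
    exact hle _ (by positivity) le_rfl u
  refine ⟨(integrable_mollMeasure hρ hε).2 hint, ?_⟩
  have hr := reg_nonneg ε z
  have hMC : 0 ≤ M * C := by positivity
  rcases le_total (2 * ε) ‖z‖ with hz | hz
  · have := isProbabilityMeasure_mollMeasure hρ hε
    have hb : ∀ᵐ u ∂(mollMeasure ρ ε), ‖z + u‖ ^ (-2 : ℝ) ≤ 9 * reg ε z := by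
      filter_upwards [ae_mollMeasure hρ hε] with u hu
      have h1 : (‖z‖ + ε) / 3 ≤ ‖z + u‖ := by
        have := norm_sub_le (z + u) u
        rw [add_sub_cancel_right] at this
        linarith
      calc ‖z + u‖ ^ (-2 : ℝ) ≤ ((‖z‖ + ε) / 3) ^ (-2 : ℝ) :=
            Real.rpow_le_rpow_of_nonpos (by positivity) h1 (by norm_num)
        _ = 9 * reg ε z := by
            rw [Real.rpow_neg (by positivity), Real.rpow_two, reg]; field_simp; norm_num
    have := integral_mono_ae ((integrable_mollMeasure hρ hε).2 hint) (integrable_const _) hb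
    rw [integral_const, probReal_univ, one_smul] at this
    nlinarith
  · rw [integral_mollMeasure hρ hε]
    refine (integral_mono hint (hi.const_mul _) (hle (4 * ε) (by positivity) (by linarith))).trans ?_
    rw [integral_const_mul, he]
    have h1 : (ε ^ 2)⁻¹ ≤ 9 * reg ε z := by
      rw [reg, ← div_eq_mul_inv, ← one_div, div_le_div_iff₀ (by positivity) (by positivity)]
      nlinarith [norm_nonneg z]
    have h2 : (ε ^ 3)⁻¹ * M * (4 * ε) ^ 2 * (C * ε ^ (3 - 2 - 2 : ℝ)) =
        16 * (M * C) * (ε ^ 2)⁻¹ := by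
      rw [show (3 - 2 - 2 : ℝ) = -1 by norm_num, Real.rpow_neg_one]
      field_simp
      ring
    rw [h2]
    nlinarith

/-- The mollified kernel `ρ^ε * k` (for the even function `ρ^ε`). -/
def kernE (ρ : E3 → ℝ) (ε : ℝ) (z : E3) : E3 := ∫ u, kern (z + u) ∂(mollMeasure ρ ε)

lemma integrable_kern (hρ : IsRadialMollifier ρ) (hε : 0 < ε) (z : E3) :
    Integrable (fun u => kern (z + u)) (mollMeasure ρ ε) := by
  obtain ⟨C, -, h⟩ := exists_mollified_rpow_le hρ
  have hm := measurable_kern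
  refine (h ε hε z).1.mono' (hm.comp (measurable_const_add z)).aestronglyMeasurable (.of_forall fun u => ?_)
  rw [norm_kern]

lemma exists_norm_kernE_le (hρ : IsRadialMollifier ρ) :
    ∃ C : ℝ, 0 ≤ C ∧ ∀ ε : ℝ, 0 < ε → ∀ z : E3, ‖kernE ρ ε z‖ ≤ C * reg ε z := by
  obtain ⟨C, hC, h⟩ := exists_mollified_rpow_le hρ
  refine ⟨C, hC, fun ε hε z => (norm_integral_le_integral_norm _).trans ?_⟩
  simp_rw [norm_kern]
  exact (h ε hε z).2

lemma measurable_kernE (hρ : IsRadialMollifier ρ) (hε : 0 < ε) : Measurable (kernE ρ ε) := by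
  have := isProbabilityMeasure_mollMeasure hρ hε
  have hm := measurable_kern
  have h : StronglyMeasurable (fun p : E3 × E3 => kern (p.1 + p.2)) :=
    Measurable.stronglyMeasurable (by fun_prop)
  exact h.integral_prod_right.measurable

lemma inner_kernE (hρ : IsRadialMollifier ρ) (hε : 0 < ε) (p z : E3) :
    inner ℝ p (kernE ρ ε z) = ∫ u, inner ℝ p (kern (z + u)) ∂(mollMeasure ρ ε) := by
  rw [kernE, integral_inner (integrable_kern hρ hε z)]

end

end VortexFilament

namespace VortexFilament

noncomputable section

/-! ### The interaction of two line elements -/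

variable {ρ : E3 → ℝ} {ε : ℝ}

lemma integral_inner_kern_mul_eq_correlation (a b p q : E3) :
    ∫ x, inner ℝ p (kern (a - x)) * inner ℝ q (kern (b - x)) = correlation (a - b) p q := by
  rw [correlation, ← integral_sub_left_eq_self _ volume b]
  refine integral_congr_ae (.of_forall fun y => ?_)
  simp only
  congr 3
  · abel_nf
  · abel_nf

lemma exists_inner_kern_mul_bound : ∃ C : ℝ, 0 ≤ C ∧ ∀ a b : E3, a ≠ b → ∀ p q : E3,
    Integrable (fun x => inner ℝ p (kern (a - x)) * inner ℝ q (kern (b - x))) ∧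
    ∫ x, ‖inner ℝ p (kern (a - x)) * inner ℝ q (kern (b - x))‖ ≤
      ‖p‖ * ‖q‖ * (C * ‖a - b‖⁻¹) := by
  obtain ⟨C, hC, h⟩ := exists_integral_rpow_mul_rpow_le (p := 2) (q := 2) (by norm_num)
    (by norm_num) (by norm_num) (by norm_num) (by norm_num)
  refine ⟨C, hC, fun a b hab p q => ?_⟩
  obtain ⟨h1, h2⟩ := h a b hab
  have hm := measurable_kern
  have hle : ∀ x, ‖inner ℝ p (kern (a - x)) * inner ℝ q (kern (b - x))‖ ≤
      ‖p‖ * ‖q‖ * (‖a - x‖ ^ (-2 : ℝ) * ‖b - x‖ ^ (-2 : ℝ)) := by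
    intro x
    rw [norm_mul, ← norm_kern, ← norm_kern]
    calc ‖inner ℝ p (kern (a - x))‖ * ‖inner ℝ q (kern (b - x))‖
        ≤ (‖p‖ * ‖kern (a - x)‖) * (‖q‖ * ‖kern (b - x)‖) :=
          mul_le_mul (norm_inner_le_norm _ _) (norm_inner_le_norm _ _) (norm_nonneg _)
            (by positivity)
      _ = _ := by ring
  have hi : Integrable (fun x => inner ℝ p (kern (a - x)) * inner ℝ q (kern (b - x))) :=
    (h1.const_mul (‖p‖ * ‖q‖)).mono' (by fun_prop) (.of_forall hle)
  refine ⟨hi, (integral_mono hi.norm (h1.const_mul _) hle).trans ?_⟩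
  rw [integral_const_mul]
  rw [show (3 - 2 - 2 : ℝ) = -1 by norm_num, Real.rpow_neg_one] at h2
  gcongr

lemma ae_le_norm_add_sub_add (hρ : IsRadialMollifier ρ) (hε : 0 < ε) (a b : E3) :
    ∀ᵐ z : E3 × E3 ∂((mollMeasure ρ ε).prod (mollMeasure ρ ε)),
      ‖(a + z.1 - (b + z.2)) - (a - b)‖ ≤ 2 * ε := by
  have := isProbabilityMeasure_mollMeasure hρ hε
  have h1 := (Measure.quasiMeasurePreserving_fst (μ := mollMeasure ρ ε)
    (ν := mollMeasure ρ ε)).ae (ae_mollMeasure hρ hε)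
  have h2 := (Measure.quasiMeasurePreserving_snd (μ := mollMeasure ρ ε)
    (ν := mollMeasure ρ ε)).ae (ae_mollMeasure hρ hε)
  filter_upwards [h1, h2] with z hz1 hz2
  have h3 : (a + z.1 - (b + z.2)) - (a - b) = z.1 - z.2 := by abel
  rw [h3]
  linarith [norm_sub_le z.1 z.2]

lemma integrable_inner_kern_mul_prod (hρ : IsRadialMollifier ρ) (hε : 0 < ε) {a b : E3}
    (hab : 3 * ε ≤ ‖a - b‖) (p q : E3) :
    Integrable (fun y : E3 × (E3 × E3) =>
      inner ℝ p (kern (a + y.2.1 - y.1)) * inner ℝ q (kern (b + y.2.2 - y.1)))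
      (volume.prod ((mollMeasure ρ ε).prod (mollMeasure ρ ε))) := by
  have := isProbabilityMeasure_mollMeasure hρ hε
  obtain ⟨C, hC, hb⟩ := exists_inner_kern_mul_bound
  have hm := measurable_kern
  have hfm : AEStronglyMeasurable (fun y : E3 × (E3 × E3) =>
      inner ℝ p (kern (a + y.2.1 - y.1)) * inner ℝ q (kern (b + y.2.2 - y.1)))
      (volume.prod ((mollMeasure ρ ε).prod (mollMeasure ρ ε))) := by
    have h1 : Measurable fun y : E3 × (E3 × E3) => kern (a + y.2.1 - y.1) := hm.comp (by fun_prop)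
    have h2 : Measurable fun y : E3 × (E3 × E3) => kern (b + y.2.2 - y.1) := hm.comp (by fun_prop)
    exact ((measurable_const.inner h1).mul (measurable_const.inner h2)).aestronglyMeasurable
  have hae : ∀ᵐ z : E3 × E3 ∂((mollMeasure ρ ε).prod (mollMeasure ρ ε)),
      ε ≤ ‖a + z.1 - (b + z.2)‖ := by
    filter_upwards [ae_le_norm_add_sub_add hρ hε a b] with z hz
    have := norm_sub_norm_le (a - b) (a + z.1 - (b + z.2))
    rw [norm_sub_rev (a - b)] at this
    linarith
  have hne : ∀ z : E3 × E3, ε ≤ ‖a + z.1 - (b + z.2)‖ → a + z.1 ≠ b + z.2 := by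
    intro z hz h
    rw [h, sub_self, norm_zero] at hz
    linarith
  rw [integrable_prod_iff' hfm]
  refine ⟨?_, ?_⟩
  · filter_upwards [hae] with z hz
    exact (hb _ _ (hne z hz) p q).1
  · refine Integrable.mono' (g := fun _ => ‖p‖ * ‖q‖ * (C * ε⁻¹)) (integrable_const _)
      hfm.norm.prod_swap.integral_prod_right' ?_
    filter_upwards [hae] with z hz
    rw [Real.norm_of_nonneg (integral_nonneg fun x => norm_nonneg _)]
    refine (hb _ _ (hne z hz) p q).2.trans ?_
    gcongr

/-- The correlation of the mollified kernel is the average of correlations of the kernel. -/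
lemma integral_inner_kernE_mul (hρ : IsRadialMollifier ρ) (hε : 0 < ε) {a b : E3}
    (hab : 3 * ε ≤ ‖a - b‖) (p q : E3) :
    Integrable (fun z : E3 × E3 => correlation (a + z.1 - (b + z.2)) p q)
      ((mollMeasure ρ ε).prod (mollMeasure ρ ε)) ∧
    ∫ x, inner ℝ p (kernE ρ ε (a - x)) * inner ℝ q (kernE ρ ε (b - x)) =
      ∫ z : E3 × E3, correlation (a + z.1 - (b + z.2)) p q
        ∂((mollMeasure ρ ε).prod (mollMeasure ρ ε)) := by
  have := isProbabilityMeasure_mollMeasure hρ hε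
  have hfi := integrable_inner_kern_mul_prod hρ hε hab p q
  have hcorr : ∀ z : E3 × E3, ∫ x, inner ℝ p (kern (a + z.1 - x)) * inner ℝ q (kern (b + z.2 - x))
      = correlation (a + z.1 - (b + z.2)) p q := fun z =>
    integral_inner_kern_mul_eq_correlation _ _ p q
  simp_rw [← hcorr]
  refine ⟨hfi.integral_prod_right, ?_⟩
  rw [← integral_integral_swap hfi]
  refine integral_congr_ae (.of_forall fun x => ?_)
  simp only
  rw [inner_kernE hρ hε, inner_kernE hρ hε, ← integral_prod_mul]
  refine integral_congr_ae (.of_forall fun z => ?_)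
  simp only
  rw [add_sub_right_comm, add_sub_right_comm]

/-- The correlation of the fields of two line elements `τ` and `σ` on a nearly straight line: `d`
is the difference of their positions, close to `c • τ`, where `c` is a signed distance along the
line. The longitudinal part of the correlation is small because `cross τ p` is orthogonal to `τ`.
-/
lemma exists_abs_correlation_sub_le : ∃ C : ℝ, 0 ≤ C ∧ ∀ (τ σ d p q : E3) (c δ : ℝ), ‖τ‖ = 1 →
    ‖σ‖ ≤ 1 → ‖p‖ = 1 → ‖q‖ = 1 → 0 < |c| → ‖d - c • τ‖ ≤ δ → δ ≤ 3 / 4 * |c| →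
    abs (correlation d (cross τ p) (cross σ q) -
      2 * Real.pi * inner ℝ (cross τ p) (cross τ q) / |c|) ≤ C * (δ / |c| ^ 2 + ‖τ - σ‖ / |c|) := by
  obtain ⟨β, hβ⟩ := exists_correlation_eq
  refine ⟨8 * Real.pi + 16 * |β|, by positivity, fun τ σ d p q c δ hτ hσ hp hq hc hd hδ => ?_⟩
  have hcτ : ‖c • τ‖ = |c| := by rw [norm_smul, hτ, mul_one, Real.norm_eq_abs]
  have hdn : abs (‖d‖ - |c|) ≤ δ := by
    rw [← hcτ]; exact (abs_norm_sub_norm_le _ _).trans hd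
  have hd4 : |c| / 4 ≤ ‖d‖ := by linarith [(abs_le.1 hdn).1]
  have hd0 : 0 < ‖d‖ := by linarith
  have hδ0 : 0 ≤ δ := (norm_nonneg _).trans hd
  have hinv : ‖d‖⁻¹ ≤ 4 / |c| := by
    rw [inv_le_comm₀ hd0 (by positivity)]; simpa using hd4
  have hτp : ‖cross τ p‖ ≤ 1 := by
    refine (norm_cross_le _ _).trans ?_
    rw [hτ, hp, one_mul]
  have hτq : ‖cross τ q‖ ≤ 1 := by
    refine (norm_cross_le _ _).trans ?_
    rw [hτ, hq, one_mul]
  have hσq : ‖cross σ q‖ ≤ 1 := by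
    refine (norm_cross_le _ _).trans ?_
    rw [hq, mul_one]; exact hσ
  set n : E3 := ‖d‖⁻¹ • d with hn
  have hn1 : ‖n‖ = 1 := by rw [hn, norm_smul, norm_inv, norm_norm]; field_simp
  have e : correlation d (cross τ p) (cross σ q) -
      2 * Real.pi * inner ℝ (cross τ p) (cross τ q) / |c| =
      2 * Real.pi * (‖d‖⁻¹ * inner ℝ (cross τ p) (cross (σ - τ) q)) +
      2 * Real.pi * (inner ℝ (cross τ p) (cross τ q) * (‖d‖⁻¹ - |c|⁻¹)) +
      β * (‖d‖⁻¹ * inner ℝ (cross τ p) n * inner ℝ (cross σ q) n) := by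
    rw [hβ d (norm_pos_iff.1 hd0), cross_sub_left, inner_sub_right]
    ring
  have t1 : |‖d‖⁻¹ * inner ℝ (cross τ p) (cross (σ - τ) q)| ≤ 4 / |c| * ‖τ - σ‖ := by
    rw [abs_mul, abs_of_nonneg (by positivity : 0 ≤ ‖d‖⁻¹)]
    have : |inner ℝ (cross τ p) (cross (σ - τ) q)| ≤ ‖τ - σ‖ := by
      refine (abs_real_inner_le_norm _ _).trans ?_
      have h2 := norm_cross_le (σ - τ) q
      rw [hq, mul_one, norm_sub_rev] at h2
      calc _ ≤ 1 * ‖τ - σ‖ := mul_le_mul hτp h2 (norm_nonneg _) zero_le_one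
        _ = _ := one_mul _
    gcongr
  have t2 : |inner ℝ (cross τ p) (cross τ q) * (‖d‖⁻¹ - |c|⁻¹)| ≤ 4 * (δ / |c| ^ 2) := by
    rw [abs_mul]
    have h1 : |inner ℝ (cross τ p) (cross τ q)| ≤ 1 := by
      refine (abs_real_inner_le_norm _ _).trans ?_
      exact mul_le_one₀ hτp (norm_nonneg _) hτq
    have h2 : |‖d‖⁻¹ - |c|⁻¹| ≤ 4 * (δ / |c| ^ 2) := by
      rw [inv_sub_inv hd0.ne' hc.ne', abs_div, abs_of_pos (mul_pos hd0 hc), abs_sub_comm,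
        div_le_iff₀ (by positivity)]
      have : 4 * (δ / |c| ^ 2) * (|c| / 4 * |c|) = δ := by field_simp
      calc _ ≤ δ := hdn
        _ = 4 * (δ / |c| ^ 2) * (|c| / 4 * |c|) := this.symm
        _ ≤ _ := by gcongr
    calc _ ≤ 1 * (4 * (δ / |c| ^ 2)) := mul_le_mul h1 h2 (abs_nonneg _) zero_le_one
      _ = _ := one_mul _
  have t3 : |‖d‖⁻¹ * inner ℝ (cross τ p) n * inner ℝ (cross σ q) n| ≤ 16 * (δ / |c| ^ 2) := by
    have h1 : |inner ℝ (cross τ p) n| ≤ 4 / |c| * δ := by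
      have e1 : inner ℝ (cross τ p) n = ‖d‖⁻¹ * inner ℝ (cross τ p) (d - c • τ) := by
        have : inner ℝ (cross τ p) τ = (0 : ℝ) := by
          simp only [inner_eq_sum, cross_apply_zero, cross_apply_one, cross_apply_two]; ring
        rw [hn, inner_smul_right, inner_sub_right, inner_smul_right, this, mul_zero, sub_zero]
      rw [e1, abs_mul, abs_of_nonneg (by positivity : 0 ≤ ‖d‖⁻¹)]
      have : |inner ℝ (cross τ p) (d - c • τ)| ≤ δ := by
        refine (abs_real_inner_le_norm _ _).trans ?_
        calc _ ≤ 1 * δ := mul_le_mul hτp hd (norm_nonneg _) zero_le_one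
          _ = _ := one_mul _
      gcongr
    have h2 : |inner ℝ (cross σ q) n| ≤ 1 := by
      refine (abs_real_inner_le_norm _ _).trans ?_
      rw [hn1, mul_one]; exact hσq
    rw [abs_mul, abs_mul, abs_of_nonneg (by positivity : 0 ≤ ‖d‖⁻¹)]
    calc ‖d‖⁻¹ * |inner ℝ (cross τ p) n| * |inner ℝ (cross σ q) n|
        ≤ 4 / |c| * (4 / |c| * δ) * 1 := by gcongr
      _ = _ := by field_simp; ring
  rw [e]
  have hpi := Real.pi_pos
  have hA : 0 ≤ δ / |c| ^ 2 := by positivity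
  have hB : 0 ≤ ‖τ - σ‖ / |c| := by positivity
  calc _ ≤ |2 * Real.pi * (‖d‖⁻¹ * inner ℝ (cross τ p) (cross (σ - τ) q))| +
        |2 * Real.pi * (inner ℝ (cross τ p) (cross τ q) * (‖d‖⁻¹ - |c|⁻¹))| +
        |β * (‖d‖⁻¹ * inner ℝ (cross τ p) n * inner ℝ (cross σ q) n)| := abs_add_three _ _ _
    _ ≤ 2 * Real.pi * (4 / |c| * ‖τ - σ‖) + 2 * Real.pi * (4 * (δ / |c| ^ 2)) +
        |β| * (16 * (δ / |c| ^ 2)) := by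
      rw [abs_mul (2 * Real.pi), abs_mul (2 * Real.pi), abs_mul β,
        abs_of_pos (by positivity : 0 < 2 * Real.pi)]
      gcongr
    _ ≤ _ := by
      have e2 : 4 / |c| * ‖τ - σ‖ = 4 * (‖τ - σ‖ / |c|) := by ring
      rw [e2]
      nlinarith [mul_nonneg (abs_nonneg β) hB, mul_nonneg (abs_nonneg β) hA]

/-- The interaction `∫ φ : (k^ε(a - x) × τ) ⊗ (k^ε(b - x) × σ) dx` of a line element `τ` at `a`
with a line element `σ` at `b`. -/
def interaction (ρ : E3 → ℝ) (ε : ℝ) (φ : E3 → M3) (a b τ σ : E3) : ℝ :=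
  ∫ x, ddot (φ x) (tensor (cross (kernE ρ ε (a - x)) τ) (cross (kernE ρ ε (b - x)) σ))

lemma measurable_ddot_tensor {α : Type*} [MeasurableSpace α] {A : α → M3} {f g : α → E3}
    (hA : Measurable A) (hf : Measurable f) (hg : Measurable g) :
    Measurable fun x => ddot (A x) (tensor (f x) (g x)) := by
  simp_rw [ddot_eq_inner, ← tensorL_apply]
  refine hA.inner ?_
  exact (tensorL.continuous₂.measurable).comp (hf.prodMk hg)

lemma measurable_cross {α : Type*} [MeasurableSpace α] {f g : α → E3}
    (hf : Measurable f) (hg : Measurable g) : Measurable fun x => cross (f x) (g x) := by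
  simp_rw [← crossL_apply]
  exact (crossL.continuous₂.measurable).comp (hf.prodMk hg)

lemma exists_abs_ddot_tensor_le (hρ : IsRadialMollifier ρ) : ∃ C : ℝ, 0 ≤ C ∧
    ∀ ε : ℝ, 0 < ε → ∀ (A : M3) (a b τ σ x : E3), ‖τ‖ ≤ 1 → ‖σ‖ ≤ 1 →
    |ddot A (tensor (cross (kernE ρ ε (a - x)) τ) (cross (kernE ρ ε (b - x)) σ))| ≤
      C * ‖A‖ * (reg ε (a - x) * reg ε (b - x)) := by
  obtain ⟨C, hC, h⟩ := exists_norm_kernE_le hρ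
  refine ⟨C * C, by positivity, fun ε hε A a b τ σ x hτ hσ => ?_⟩
  refine (abs_ddot_le _ _).trans ?_
  rw [norm_tensor]
  have aux : ∀ a τ : E3, ‖τ‖ ≤ 1 → ‖cross (kernE ρ ε (a - x)) τ‖ ≤ C * reg ε (a - x) := by
    intro a τ hτ
    refine (norm_cross_le _ _).trans ?_
    have := mul_le_mul (h ε hε (a - x)) hτ (norm_nonneg _)
      (mul_nonneg hC (reg_nonneg _ _))
    simpa using this
  calc ‖A‖ * (‖cross (kernE ρ ε (a - x)) τ‖ * ‖cross (kernE ρ ε (b - x)) σ‖)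
      ≤ ‖A‖ * ((C * reg ε (a - x)) * (C * reg ε (b - x))) := by
        gcongr
        · exact mul_nonneg hC (reg_nonneg _ _)
        · exact aux a τ hτ
        · exact aux b σ hσ
    _ = _ := by ring

lemma integrable_interaction (hρ : IsRadialMollifier ρ) (hε : 0 < ε) {φ : E3 → M3} {W : ℝ}
    (hφ : Measurable φ) (hW : ∀ x, ‖φ x‖ ≤ W) {τ σ : E3} (hτ : ‖τ‖ ≤ 1) (hσ : ‖σ‖ ≤ 1)
    (a b : E3) :
    Integrable fun x => ddot (φ x)
      (tensor (cross (kernE ρ ε (a - x)) τ) (cross (kernE ρ ε (b - x)) σ)) := by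
  obtain ⟨C, hC, h⟩ := exists_abs_ddot_tensor_le hρ
  have hk := measurable_kernE hρ hε
  refine ((integrable_reg_mul_reg hε a b).const_mul (C * W)).mono' ?_ (.of_forall fun x => ?_)
  · refine (measurable_ddot_tensor hφ (measurable_cross ?_ measurable_const)
      (measurable_cross ?_ measurable_const)).aestronglyMeasurable
    · exact hk.comp (measurable_const.sub measurable_id)
    · exact hk.comp (measurable_const.sub measurable_id)
  · refine (h ε hε (φ x) a b τ σ x hτ hσ).trans ?_
    have := hW x
    have := mul_nonneg (reg_nonneg ε (a - x)) (reg_nonneg ε (b - x))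
    gcongr

/-- The bound that holds for every pair of line elements, however close they are in space. -/
lemma exists_abs_interaction_le (hρ : IsRadialMollifier ρ) : ∃ C : ℝ, 0 ≤ C ∧
    ∀ ε : ℝ, 0 < ε → ∀ (φ : E3 → M3) (W : ℝ), Measurable φ → (∀ x, ‖φ x‖ ≤ W) →
    ∀ a b τ σ : E3, ‖τ‖ ≤ 1 → ‖σ‖ ≤ 1 →
    |interaction ρ ε φ a b τ σ| ≤ C * W / (‖a - b‖ + ε) := by
  obtain ⟨C, hC, h⟩ := exists_abs_ddot_tensor_le hρ
  obtain ⟨C', hC', h'⟩ := exists_integral_reg_mul_reg_le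
  refine ⟨C * C', by positivity, fun ε hε φ W hφ hW a b τ σ hτ hσ => ?_⟩
  have hW0 : 0 ≤ W := (norm_nonneg _).trans (hW 0)
  have hi := integrable_interaction hρ hε hφ hW hτ hσ a b
  calc |interaction ρ ε φ a b τ σ| ≤ ∫ x, |ddot (φ x)
        (tensor (cross (kernE ρ ε (a - x)) τ) (cross (kernE ρ ε (b - x)) σ))| :=
        abs_integral_le_integral_abs
    _ ≤ ∫ x, C * W * (reg ε (a - x) * reg ε (b - x)) := by
        refine integral_mono hi.abs ((integrable_reg_mul_reg hε a b).const_mul (C * W)) fun x => ?_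
        refine (h ε hε (φ x) a b τ σ x hτ hσ).trans ?_
        have := hW x
        have := mul_nonneg (reg_nonneg ε (a - x)) (reg_nonneg ε (b - x))
        gcongr
    _ ≤ C * W * (C' / (‖a - b‖ + ε)) := by
        rw [integral_const_mul]; gcongr; exact h' ε hε a b
    _ = _ := by ring

lemma ddot_sub_left (A B D : M3) : ddot (A - B) D = ddot A D - ddot B D := by
  simp only [ddot_eq_inner, inner_sub_left]

/-- Freezing the coefficient at one of the two points. -/
lemma exists_abs_interaction_sub_const_le (hρ : IsRadialMollifier ρ) : ∃ C : ℝ, 0 ≤ C ∧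
    ∀ ε : ℝ, 0 < ε → ∀ (φ : E3 → M3) (W : ℝ), Measurable φ → (∀ x, ‖φ x‖ ≤ W) →
    (∀ x y, ‖φ x - φ y‖ ≤ 2 * W * ‖y - x‖ ^ (1 / 2 : ℝ)) →
    ∀ a b τ σ : E3, a ≠ b → ‖τ‖ ≤ 1 → ‖σ‖ ≤ 1 →
    |interaction ρ ε φ a b τ σ - interaction ρ ε (fun _ => φ a) a b τ σ| ≤
      C * W * ‖a - b‖ ^ (-(1 / 2) : ℝ) := by
  obtain ⟨C, hC, h⟩ := exists_abs_ddot_tensor_le hρ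
  obtain ⟨C', hC', h'⟩ := exists_integral_rpow_half_reg_mul_reg_le
  refine ⟨C * 2 * C', by positivity, fun ε hε φ W hφ hW hH a b τ σ hab hτ hσ => ?_⟩
  have hW0 : 0 ≤ W := (norm_nonneg _).trans (hW 0)
  have hi := integrable_interaction hρ hε hφ hW hτ hσ a b
  have hi' := integrable_interaction hρ hε (φ := fun _ => φ a) measurable_const (fun _ => hW a)
    hτ hσ a b
  obtain ⟨j1, j2⟩ := h' ε hε a b hab
  unfold interaction
  rw [← integral_sub hi hi']
  refine abs_integral_le_integral_abs.trans ?_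
  refine (integral_mono (hi.sub hi').abs (j1.const_mul (C * (2 * W))) fun x => ?_).trans ?_
  · simp only [Pi.sub_apply]
    rw [← ddot_sub_left]
    refine (h ε hε _ a b τ σ x hτ hσ).trans ?_
    have h1 := hH x a
    have h2 := mul_nonneg (reg_nonneg ε (a - x)) (reg_nonneg ε (b - x))
    calc C * ‖φ x - φ a‖ * (reg ε (a - x) * reg ε (b - x))
        ≤ C * (2 * W * ‖a - x‖ ^ (1 / 2 : ℝ)) * (reg ε (a - x) * reg ε (b - x)) := by gcongr
      _ = _ := by ring
  · rw [integral_const_mul]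
    calc _ ≤ C * (2 * W) * (C' * ‖a - b‖ ^ (-(1 / 2) : ℝ)) := by gcongr
      _ = _ := by ring

lemma abs_entry_le_norm (A : M3) (p : Fin 3 × Fin 3) : |A p| ≤ ‖A‖ := by
  simpa using PiLp.norm_apply_le A p

/-- The matrix `I - τ ⊗ τ` is the Gram matrix of the vectors `τ × eᵢ`. -/
lemma ddot_idMatrix_sub_tensor (A : M3) {τ : E3} (hτ : ‖τ‖ = 1) :
    ddot A (idMatrix - tensor τ τ) = ∑ i : Fin 3, ∑ j : Fin 3,
      A (i, j) * inner ℝ (cross τ (bvec i)) (cross τ (bvec j)) := by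
  simp only [ddot, PiLp.sub_apply, tensor_apply, idMatrix]
  refine Finset.sum_congr rfl fun i _ => Finset.sum_congr rfl fun j _ => ?_
  rw [inner_cross_cross, hτ, inner_bvec, inner_bvec, inner_bvec, bvec_apply]
  simp

lemma abs_sum_sum_mul_le {A : M3} {X : Fin 3 → Fin 3 → ℝ} {B : ℝ} (hX : ∀ i j, |X i j| ≤ B) :
    |∑ i : Fin 3, ∑ j : Fin 3, A (i, j) * X i j| ≤ 9 * ‖A‖ * B := by
  have h : ∀ i j, |A (i, j) * X i j| ≤ ‖A‖ * B := fun i j => by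
    rw [abs_mul]
    exact mul_le_mul (abs_entry_le_norm A _) (hX i j) (abs_nonneg _) (norm_nonneg _)
  calc _ ≤ ∑ i : Fin 3, ∑ j : Fin 3, |A (i, j) * X i j| := by
        refine (Finset.abs_sum_le_sum_abs _ _).trans (Finset.sum_le_sum fun i _ => ?_)
        exact Finset.abs_sum_le_sum_abs _ _
    _ ≤ ∑ i : Fin 3, ∑ j : Fin 3, ‖A‖ * B :=
        Finset.sum_le_sum fun i _ => Finset.sum_le_sum fun j _ => h i j
    _ = _ := by simp; ring

/-- The interaction of two line elements on a nearly straight line, for a constant coefficient. The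
mollification displaces the two points by `2 * ε` at most, which is harmless when their distance
exceeds a large multiple of `ε`. -/
lemma exists_abs_interaction_const_sub_le (hρ : IsRadialMollifier ρ) : ∃ C : ℝ, 0 ≤ C ∧
    ∀ ε : ℝ, 0 < ε → ∀ (A : M3) (a b τ σ : E3) (c δ : ℝ), ‖τ‖ = 1 → ‖σ‖ ≤ 1 →
    16 * ε ≤ |c| → ‖(a - b) - c • τ‖ ≤ δ → δ ≤ |c| / 2 →
    abs (interaction ρ ε (fun _ => A) a b τ σ -
      2 * Real.pi * ddot A (idMatrix - tensor τ τ) / |c|) ≤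
      C * ‖A‖ * ((δ + 2 * ε) / |c| ^ 2 + ‖τ - σ‖ / |c|) := by
  obtain ⟨C, hC, h⟩ := exists_abs_correlation_sub_le
  refine ⟨9 * C, by positivity, fun ε hε A a b τ σ c δ hτ hσ hc hd hδ => ?_⟩
  have := isProbabilityMeasure_mollMeasure hρ hε
  have hc0 : 0 < |c| := by linarith
  have hcτ : ‖c • τ‖ = |c| := by rw [norm_smul, hτ, mul_one, Real.norm_eq_abs]
  have hab : 3 * ε ≤ ‖a - b‖ := by
    have h1 := norm_sub_norm_le (c • τ) (c • τ - (a - b))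
    rw [sub_sub_cancel, norm_sub_rev (c • τ), hcτ] at h1
    linarith
  have hkm := measurable_kernE hρ hε
  set X : Fin 3 → Fin 3 → ℝ := fun i j =>
    ∫ x, inner ℝ (cross τ (bvec i)) (kernE ρ ε (a - x)) *
      inner ℝ (cross σ (bvec j)) (kernE ρ ε (b - x)) with hX
  have hint : interaction ρ ε (fun _ => A) a b τ σ = ∑ i : Fin 3, ∑ j : Fin 3, A (i, j) * X i j := by
    unfold interaction
    have hi : ∀ i j, Integrable fun x => inner ℝ (cross τ (bvec i)) (kernE ρ ε (a - x)) *
      inner ℝ (cross σ (bvec j)) (kernE ρ ε (b - x)) := by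
      intro i j
      have := integrable_interaction hρ hε (φ := fun _ => tensor (bvec i) (bvec j))
        (measurable_const) (fun _ => le_rfl) hτ.le hσ a b
      refine this.congr (.of_forall fun x => ?_)
      simp only
      rw [← inner_cross_right, ← inner_cross_right, inner_bvec, inner_bvec]
      simp only [ddot, tensor_apply, bvec_apply]
      rw [Finset.sum_eq_single i, Finset.sum_eq_single j]
      · simp
      · intro k _ hk; simp [hk]
      · simp
      · intro k _ hk; simp [hk]
      · simp
    have hsum : ∀ x, ddot A (tensor (cross (kernE ρ ε (a - x)) τ) (cross (kernE ρ ε (b - x)) σ)) =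
        ∑ i : Fin 3, ∑ j : Fin 3, A (i, j) * (inner ℝ (cross τ (bvec i)) (kernE ρ ε (a - x)) *
          inner ℝ (cross σ (bvec j)) (kernE ρ ε (b - x))) := by
      intro x
      simp_rw [ddot_tensor_eq_sum, ← inner_cross_right]
      rfl
    simp_rw [hsum]
    rw [integral_finsetSum _ fun i _ => integrable_finsetSum _ fun j _ => (hi i j).const_mul _]
    refine Finset.sum_congr rfl fun i _ => ?_
    rw [integral_finsetSum _ fun j _ => (hi i j).const_mul _]
    exact Finset.sum_congr rfl fun j _ => integral_const_mul _ _
  have hXb : ∀ i j, abs (X i j - 2 * Real.pi *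
      inner ℝ (cross τ (bvec i)) (cross τ (bvec j)) / |c|) ≤
      C * ((δ + 2 * ε) / |c| ^ 2 + ‖τ - σ‖ / |c|) := by
    intro i j
    obtain ⟨j1, j2⟩ := integral_inner_kernE_mul hρ hε hab (cross τ (bvec i)) (cross σ (bvec j))
    rw [hX]
    simp only
    rw [j2]
    have e : ∫ z : E3 × E3, correlation (a + z.1 - (b + z.2)) (cross τ (bvec i)) (cross σ (bvec j))
        ∂((mollMeasure ρ ε).prod (mollMeasure ρ ε)) - 2 * Real.pi *
          inner ℝ (cross τ (bvec i)) (cross τ (bvec j)) / |c| =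
        ∫ z : E3 × E3, (correlation (a + z.1 - (b + z.2)) (cross τ (bvec i)) (cross σ (bvec j)) -
          2 * Real.pi * inner ℝ (cross τ (bvec i)) (cross τ (bvec j)) / |c|)
        ∂((mollMeasure ρ ε).prod (mollMeasure ρ ε)) := by
      rw [integral_sub j1 (integrable_const _), integral_const, probReal_univ, one_smul]
    rw [e, ← Real.norm_eq_abs]
    have hb : ∀ᵐ z : E3 × E3 ∂((mollMeasure ρ ε).prod (mollMeasure ρ ε)),
        ‖correlation (a + z.1 - (b + z.2)) (cross τ (bvec i)) (cross σ (bvec j)) -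
          2 * Real.pi * inner ℝ (cross τ (bvec i)) (cross τ (bvec j)) / |c|‖ ≤
        C * ((δ + 2 * ε) / |c| ^ 2 + ‖τ - σ‖ / |c|) := by
      filter_upwards [ae_le_norm_add_sub_add hρ hε a b] with z hz
      refine h τ σ _ _ _ c (δ + 2 * ε) hτ hσ (norm_bvec i) (norm_bvec j) hc0 ?_ (by linarith)
      have := norm_add_le ((a + z.1 - (b + z.2)) - (a - b)) ((a - b) - c • τ)
      rw [sub_add_sub_cancel] at this
      linarith
    have := norm_integral_le_of_norm_le_const hb
    simpa using this
  have e : interaction ρ ε (fun _ => A) a b τ σ -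
      2 * Real.pi * ddot A (idMatrix - tensor τ τ) / |c| =
      ∑ i : Fin 3, ∑ j : Fin 3, A (i, j) * (X i j - 2 * Real.pi *
        inner ℝ (cross τ (bvec i)) (cross τ (bvec j)) / |c|) := by
    rw [hint, ddot_idMatrix_sub_tensor A hτ]
    simp only [mul_sub, Finset.sum_sub_distrib, Finset.mul_sum, Finset.sum_div]
    congr 1
    refine Finset.sum_congr rfl fun i _ => Finset.sum_congr rfl fun j _ => ?_
    ring
  rw [e]
  refine (abs_sum_sum_mul_le hXb).trans (le_of_eq ?_)
  ring

end

end VortexFilament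

namespace VortexFilament

noncomputable section

/-! ### Geometry of the curve -/

open Set

variable {γ : ℝ → E3}

lemma norm_coe_unitAddCircle_le (h : ℝ) : ‖(h : UnitAddCircle)‖ ≤ 1 / 2 := by
  simpa using AddCircle.norm_le_half_period (p := 1) (x := (h : UnitAddCircle)) one_ne_zero

lemma norm_coe_unitAddCircle_eq {h : ℝ} (hh : |h| ≤ 1 / 2) : ‖(h : UnitAddCircle)‖ = |h| := by
  rw [AddCircle.norm_coe_eq_abs_iff 1 one_ne_zero]
  simpa using hh

lemma IsArclengthLoop.norm_deriv_le (hγ : IsArclengthLoop γ) (s : ℝ) : ‖deriv γ s‖ ≤ 1 := by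
  simpa using norm_deriv_le_of_lipschitz (x₀ := s) hγ.lipschitz

lemma IsArclengthLoop.measurable_deriv (_ : IsArclengthLoop γ) : Measurable (deriv γ) :=
  _root_.measurable_deriv γ

lemma IsArclengthLoop.continuous (hγ : IsArclengthLoop γ) : Continuous γ := hγ.lipschitz.continuous

lemma differentiableAt_of_norm_deriv {s : ℝ} (hs : ‖deriv γ s‖ = 1) : DifferentiableAt ℝ γ s := by
  refine differentiableAt_of_deriv_ne_zero fun h => ?_
  rw [h, norm_zero] at hs
  exact zero_ne_one hs

lemma IsArclengthLoop.ae_differentiableAt (hγ : IsArclengthLoop γ) :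
    ∀ᵐ s : ℝ, DifferentiableAt ℝ γ s := by
  filter_upwards [hγ.speed] with s hs
  exact differentiableAt_of_norm_deriv hs

lemma IsArclengthLoop.deriv_periodic (hγ : IsArclengthLoop γ) :
    Function.Periodic (deriv γ) 1 := by
  intro s
  rw [← deriv_comp_add_const]
  congr 1
  ext1 t
  exact hγ.periodic t

lemma IsArclengthLoop.intervalIntegrable_deriv (hγ : IsArclengthLoop γ) (a b : ℝ) :
    IntervalIntegrable (deriv γ) volume a b := by
  refine (intervalIntegrable_const (c := (1 : ℝ))).mono_fun
    hγ.measurable_deriv.aestronglyMeasurable (.of_forall fun s => ?_)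
  simpa using hγ.norm_deriv_le s

lemma integral_deriv_of_lipschitz {f : ℝ → ℝ} {K : NNReal} (hf : LipschitzWith K f) (a b : ℝ) :
    ∫ s in a..b, deriv f s = f b - f a :=
  (hf.lipschitzOnWith.absolutelyContinuousOnInterval).integral_deriv_eq_sub

/-- The fundamental theorem of calculus for a Lipschitz curve. -/
lemma IsArclengthLoop.integral_deriv (hγ : IsArclengthLoop γ) (a b : ℝ) :
    ∫ s in a..b, deriv γ s = γ b - γ a := by
  refine ext_inner_left ℝ fun p => ?_
  have hl : LipschitzWith (‖innerSL ℝ p‖₊ * 1) fun s => inner ℝ p (γ s) :=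
    (innerSL ℝ p).lipschitz.comp hγ.lipschitz
  rw [inner_sub_right, ← integral_deriv_of_lipschitz hl a b]
  have h1 := (innerSL ℝ p).intervalIntegral_comp_comm (hγ.intervalIntegrable_deriv a b)
  simp only [innerSL_apply_apply] at h1
  rw [← h1]
  refine intervalIntegral.integral_congr_ae ?_
  filter_upwards [hγ.ae_differentiableAt] with s hs _
  have h2 := ((innerSL ℝ p).hasFDerivAt (x := γ s)).comp_hasDerivAt s hs.hasDerivAt
  exact h2.deriv.symm

/-- Within the security radius the curve stays close to its tangent line, by integration of the
bound on the variation of the tangent. -/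
lemma IsSecure.norm_sub_sub_le (hγ : IsArclengthLoop γ) {s r : ℝ} (hr : 0 < r)
    (hs : IsSecure γ s r) {h : ℝ} (h1 : |h| ≤ 1 / 2) (h2 : |h| ≤ r) :
    ‖γ (s + h) - γ s - h • deriv γ s‖ ≤ h ^ 2 / (2 * r) := by
  have e : γ (s + h) - γ s - h • deriv γ s = ∫ u in (0 : ℝ)..h, (deriv γ (s + u) - deriv γ s) := by
    have hi : IntervalIntegrable (fun u => deriv γ (s + u)) volume 0 h := by
      simpa using (hγ.intervalIntegrable_deriv (s + 0) (s + h)).comp_add_left s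
    rw [intervalIntegral.integral_sub hi (by simp), intervalIntegral.integral_comp_add_left,
      hγ.integral_deriv]
    simp
  have hae : ∀ᵐ u : ℝ, DifferentiableAt ℝ γ (s + u) :=
    (quasiMeasurePreserving_add_left volume s).ae hγ.ae_differentiableAt
  have hb : ∀ᵐ u : ℝ, u ∈ uIoc 0 h → ‖deriv γ (s + u) - deriv γ s‖ ≤ |u| / r := by
    filter_upwards [hae] with u hu hmem
    have hle : |u| ≤ |h| := by
      have := abs_sub_left_of_mem_uIcc (uIoc_subset_uIcc hmem)
      simpa using this
    have hn := norm_coe_unitAddCircle_eq (hle.trans h1)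
    have := hs.2 u (by rw [hn]; exact hle.trans h2) hu
    rwa [hn] at this
  rw [e]
  have key : ‖∫ u in (0 : ℝ)..h, (deriv γ (s + u) - deriv γ s)‖ ≤ |∫ u in (0 : ℝ)..h, |u| / r| := by
    refine intervalIntegral.norm_integral_le_abs_of_norm_le ?_ ?_
    · exact (ae_restrict_iff' measurableSet_uIoc).2 hb
    · exact (by fun_prop : Continuous fun u : ℝ => |u| / r).intervalIntegrable _ _
  refine key.trans (le_of_eq ?_)
  rcases le_total 0 h with h0 | h0
  · have : ∫ u in (0 : ℝ)..h, |u| / r = ∫ u in (0 : ℝ)..h, u / r := by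
      refine intervalIntegral.integral_congr fun u hu => ?_
      rw [uIcc_of_le h0] at hu
      simp only [abs_of_nonneg hu.1]
    rw [this, intervalIntegral.integral_div, integral_id, abs_of_nonneg
      (by rw [zero_pow two_ne_zero, sub_zero]; positivity)]
    field_simp
    ring
  · have : ∫ u in (0 : ℝ)..h, |u| / r = ∫ u in (0 : ℝ)..h, -u / r := by
      refine intervalIntegral.integral_congr fun u hu => ?_
      rw [uIcc_of_ge h0] at hu
      simp only [abs_of_nonpos hu.2]
    rw [this, intervalIntegral.integral_div, intervalIntegral.integral_neg, integral_id,
      abs_of_nonpos]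
    · field_simp
      ring
    · refine div_nonpos_of_nonpos_of_nonneg ?_ hr.le
      nlinarith [sq_nonneg h]

/-- A parameter `c` of length `|t - s|` modulo one with `γ t = γ (s - c)`. -/
lemma exists_shift (hγ : IsArclengthLoop γ) (s t : ℝ) : ∃ c : ℝ,
    |c| = ‖((t - s : ℝ) : UnitAddCircle)‖ ∧ γ t = γ (s - c) ∧ deriv γ t = deriv γ (s - c) := by
  refine ⟨-((t - s) - round (t - s)), ?_, ?_, ?_⟩
  · rw [abs_neg, UnitAddCircle.norm_eq]
  · have := hγ.periodic.int_mul (-round (t - s)) t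
    rw [← this]
    congr 1
    push_cast
    ring
  · have := hγ.deriv_periodic.int_mul (-round (t - s)) t
    rw [← this]
    congr 1
    push_cast
    ring

/-- If `t` is within the security radius `r` of `s`, then `γ s - γ t` is the tangent at `s` times a
signed distance `c`, up to `|c| ^ 2 / (2 * r)`, and the two tangents differ by at most `|c| / r`. -/
lemma IsSecure.near (hγ : IsArclengthLoop γ) {s t r : ℝ} (hr : 0 < r) (hs : IsSecure γ s r)
    (ht : ‖deriv γ t‖ = 1) (hst : ‖((t - s : ℝ) : UnitAddCircle)‖ ≤ r) : ∃ c : ℝ,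
    |c| = ‖((t - s : ℝ) : UnitAddCircle)‖ ∧
    ‖(γ s - γ t) - c • deriv γ s‖ ≤ |c| ^ 2 / (2 * r) ∧ ‖deriv γ s - deriv γ t‖ ≤ |c| / r := by
  obtain ⟨c, h1, h2, h3⟩ := exists_shift hγ s t
  have hc2 : |c| ≤ 1 / 2 := h1 ▸ norm_coe_unitAddCircle_le _
  have hd : DifferentiableAt ℝ γ (s + -c) := by
    refine differentiableAt_of_norm_deriv ?_
    rw [← sub_eq_add_neg, ← h3, ht]
  refine ⟨c, h1, ?_, ?_⟩
  · have := hs.norm_sub_sub_le hγ hr (h := -c) (by rwa [abs_neg]) (by rw [abs_neg, h1]; exact hst)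
    rw [← sub_eq_add_neg, ← h2, neg_sq, ← sq_abs] at this
    have e : (γ s - γ t) - c • deriv γ s = -(γ t - γ s - -c • deriv γ s) := by
      rw [neg_smul]; abel
    rwa [e, norm_neg]
  · have hn : ‖((-c : ℝ) : UnitAddCircle)‖ = |c| := by
      rw [norm_coe_unitAddCircle_eq (by rwa [abs_neg]), abs_neg]
    have := hs.2 (-c) (by rw [hn, h1]; exact hst) hd
    rw [hn, ← sub_eq_add_neg, ← h3] at this
    rwa [norm_sub_rev]

/-- Within the security radius, the distance in space is comparable to the distance along the
curve. -/
lemma IsSecure.near_dist (hγ : IsArclengthLoop γ) {s t r : ℝ} (hr : 0 < r) (hs : IsSecure γ s r)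
    (hs1 : ‖deriv γ s‖ = 1) (ht : ‖deriv γ t‖ = 1)
    (hst : ‖((t - s : ℝ) : UnitAddCircle)‖ ≤ r) :
    ‖((t - s : ℝ) : UnitAddCircle)‖ / 2 ≤ ‖γ s - γ t‖ := by
  obtain ⟨c, h1, h2, -⟩ := hs.near hγ hr ht hst
  rw [← h1] at hst ⊢
  have h3 : |c| ^ 2 / (2 * r) ≤ |c| / 2 := by
    rw [div_le_div_iff₀ (by positivity) (by positivity)]
    nlinarith [abs_nonneg c]
  have h4 := norm_sub_norm_le (c • deriv γ s) (c • deriv γ s - (γ s - γ t))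
  rw [sub_sub_cancel, norm_sub_rev (c • deriv γ s), norm_smul, hs1, mul_one, Real.norm_eq_abs] at h4
  linarith

lemma IsSecure.far_dist (hγ : IsArclengthLoop γ) {s t r : ℝ} (hs : IsSecure γ s r)
    (hst : r ≤ ‖((t - s : ℝ) : UnitAddCircle)‖) : r / 2 ≤ ‖γ s - γ t‖ := by
  obtain ⟨c, h1, h2, -⟩ := exists_shift hγ s t
  have hc2 : |c| ≤ 1 / 2 := h1 ▸ norm_coe_unitAddCircle_le _
  have hn : ‖((-c : ℝ) : UnitAddCircle)‖ = |c| := by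
    rw [norm_coe_unitAddCircle_eq (by rwa [abs_neg]), abs_neg]
  have := hs.1 (-c) (by rw [hn, h1]; exact hst)
  rwa [← sub_eq_add_neg, ← h2, norm_sub_rev] at this

/-- A closed curve of length one turns back, so its security radius is at most `1/2`. -/
lemma IsSecure.le_half (hγ : IsArclengthLoop γ) {s r : ℝ} (hs : IsSecure γ s r)
    (hs1 : ‖deriv γ s‖ = 1) : r ≤ 1 / 2 := by
  by_contra! hr
  have hr0 : 0 < r := by linarith
  have a := hs.norm_sub_sub_le hγ hr0 (h := 1 / 2) (by norm_num [abs_of_pos])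
    (by rw [abs_of_pos] <;> linarith)
  have b := hs.norm_sub_sub_le hγ hr0 (h := -(1 / 2)) (by norm_num [abs_of_pos])
    (by rw [abs_neg, abs_of_pos] <;> linarith)
  -- The two half curves end at the same point, but start in opposite directions.
  have e : γ (s + 1 / 2) = γ (s + -(1 / 2)) := by
    rw [← hγ.periodic (s + -(1 / 2))]; congr 1; ring
  have h1 := norm_sub_le (γ (s + -(1 / 2)) - γ s - (-(1 / 2) : ℝ) • deriv γ s)
    (γ (s + 1 / 2) - γ s - (1 / 2 : ℝ) • deriv γ s)
  have h2 : (γ (s + -(1 / 2)) - γ s - (-(1 / 2) : ℝ) • deriv γ s) -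
    (γ (s + 1 / 2) - γ s - (1 / 2 : ℝ) • deriv γ s) = deriv γ s := by
    rw [e]; module
  rw [h2, hs1] at h1
  have h3 : (1 / 2 : ℝ) ^ 2 / (2 * r) ≤ 1 / 4 := by
    rw [div_le_div_iff₀ (by positivity) (by positivity)]; nlinarith
  rw [neg_sq] at b
  linarith

lemma two_le_kappaStar (hγ : IsArclengthLoop γ) {s : ℝ} (hs1 : ‖deriv γ s‖ = 1) :
    2 ≤ kappaStar γ s := by
  have h : securityRadius γ s ≤ ENNReal.ofReal (1 / 2) := by
    refine iSup₂_le fun r hr => ENNReal.ofReal_le_ofReal ?_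
    exact hr.2.2.le_half hγ hs1
  rw [kappaStar, ENNReal.le_inv_iff_le_inv]
  refine h.trans (le_of_eq ?_)
  rw [one_div, ENNReal.ofReal_inv_of_pos (by norm_num)]
  simp

lemma exists_isSecure_of_kappaStar_lt {s σ : ℝ} (hσ : 0 < σ)
    (h : kappaStar γ s < ENNReal.ofReal σ) :
    ∃ r : ℝ, 0 < r ∧ 1 / r ≤ σ ∧ IsSecure γ s r := by
  rw [kappaStar, ENNReal.inv_lt_iff_inv_lt, ← ENNReal.ofReal_inv_of_pos hσ, securityRadius] at h
  simp only [lt_iSup_iff] at h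
  obtain ⟨r, ⟨h0, -, hs⟩, hr⟩ := h
  refine ⟨r, h0, ?_, hs⟩
  rw [ENNReal.ofReal_lt_ofReal_iff h0] at hr
  rw [one_div]
  exact inv_le_of_inv_le₀ hσ hr.le

lemma volume_kappaStar_le {σ : ℝ} (hσ : 0 < σ) :
    volume {s : ℝ | s ∈ Ioc (0 : ℝ) 1 ∧ ENNReal.ofReal σ ≤ kappaStar γ s} ≤
      kappaNorm γ * ENNReal.ofReal σ⁻¹ := by
  have h : ENNReal.ofReal σ *
      volume {s : ℝ | s ∈ Ioc (0 : ℝ) 1 ∧ ENNReal.ofReal σ ≤ kappaStar γ s} ≤ kappaNorm γ :=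
    le_iSup₂_of_le (f := fun (σ : ℝ) (_ : 0 < σ) => ENNReal.ofReal σ *
      volume {s : ℝ | s ∈ Ioc (0 : ℝ) 1 ∧ ENNReal.ofReal σ ≤ kappaStar γ s}) σ hσ le_rfl
  rw [ENNReal.ofReal_inv_of_pos hσ, ← div_eq_mul_inv, ENNReal.le_div_iff_mul_le (by simp [hσ]) (by simp), mul_comm]
  exact h

/-- The lower bound that allows error terms of order one to be absorbed. -/
lemma two_le_kappaNorm (hγ : IsArclengthLoop γ) : 2 ≤ kappaNorm γ := by
  have h := volume_kappaStar_le (γ := γ) (σ := 2) (by norm_num)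
  have h1 : volume {s : ℝ | s ∈ Ioc (0 : ℝ) 1 ∧ ENNReal.ofReal 2 ≤ kappaStar γ s} = 1 := by
    have : {s : ℝ | s ∈ Ioc (0 : ℝ) 1 ∧ ENNReal.ofReal 2 ≤ kappaStar γ s} =ᵐ[volume]
        Ioc (0 : ℝ) 1 := by
      filter_upwards [hγ.speed] with s hs
      have := two_le_kappaStar hγ hs
      apply propext
      change (s ∈ Ioc (0 : ℝ) 1 ∧ _) ↔ s ∈ Ioc (0 : ℝ) 1
      simp [this]
    rw [measure_congr this]
    simp
  rw [h1, ENNReal.ofReal_inv_of_pos (by norm_num)] at h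
  rw [← div_eq_mul_inv, ENNReal.le_div_iff_mul_le (by simp) (by simp)] at h
  simpa using h

end

end VortexFilament

namespace VortexFilament

noncomputable section

/-! ### Consequences of the weak bound on `κ*` -/

open Set

variable {γ : ℝ → E3}

lemma volume_norm_coe_sub_le {s : ℝ} (hs : s ∈ Ioc (0 : ℝ) 1) (δ : ℝ) :
    volume {t : ℝ | t ∈ Ioc (0 : ℝ) 1 ∧ ‖((t - s : ℝ) : UnitAddCircle)‖ ≤ δ} ≤
      ENNReal.ofReal (6 * δ) := by
  have hsub : {t : ℝ | t ∈ Ioc (0 : ℝ) 1 ∧ ‖((t - s : ℝ) : UnitAddCircle)‖ ≤ δ} ⊆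
      (Icc (s - 1 - δ) (s - 1 + δ) ∪ Icc (s - δ) (s + δ)) ∪ Icc (s + 1 - δ) (s + 1 + δ) := by
    rintro t ⟨ht, hd⟩
    rw [UnitAddCircle.norm_eq, abs_le] at hd
    have h1 := abs_le.1 (abs_sub_round (t - s))
    have h2 : ((round (t - s) : ℤ) : ℝ) < 2 := by linarith [hs.1, ht.2]
    have h3 : (-2 : ℝ) < ((round (t - s) : ℤ) : ℝ) := by linarith [hs.2, ht.1]
    have h2' : round (t - s) < 2 := by exact_mod_cast h2
    have h3' : -2 < round (t - s) := by exact_mod_cast h3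
    have h4 : round (t - s) = -1 ∨ round (t - s) = 0 ∨ round (t - s) = 1 := by omega
    rcases h4 with h | h | h <;> rw [h] at hd <;> push_cast at hd
    · exact Or.inl (Or.inl ⟨by linarith, by linarith⟩)
    · exact Or.inl (Or.inr ⟨by linarith, by linarith⟩)
    · exact Or.inr ⟨by linarith, by linarith⟩
  refine (measure_mono hsub).trans ((measure_union_le _ _).trans
    ((add_le_add_left (measure_union_le _ _) _).trans ?_))
  rw [Real.volume_Icc, Real.volume_Icc, Real.volume_Icc]
  rcases le_or_gt 0 δ with h | h
  · rw [← ENNReal.ofReal_add (by linarith) (by linarith),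
      ← ENNReal.ofReal_add (by linarith) (by linarith)]
    exact ENNReal.ofReal_le_ofReal (by linarith)
  · rw [ENNReal.ofReal_of_nonpos (by linarith), ENNReal.ofReal_of_nonpos (by linarith),
      ENNReal.ofReal_of_nonpos (by linarith)]
    simp

/-- The curve spends a time of order `R` in a ball of radius `R`: either all its points there have
a security radius of order `R` at most, or one of them has a large one and controls the others. -/
lemma volume_mem_closedBall_le (hγ : IsArclengthLoop γ) (x : E3) {R : ℝ} (hR : 0 < R) :
    volume {s : ℝ | s ∈ Ioc (0 : ℝ) 1 ∧ ‖γ s - x‖ ≤ R} ≤ kappaNorm γ * ENNReal.ofReal (24 * R) := by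
  -- For a point `s` with security radius above `5 * R`, every other point in the ball is within the
  -- security radius, and the distance along the curve is at most twice the distance in space.
  by_cases hall : ∀ s, s ∈ Ioc (0 : ℝ) 1 → ‖γ s - x‖ ≤ R → ‖deriv γ s‖ = 1 →
      ENNReal.ofReal (5 * R)⁻¹ ≤ kappaStar γ s
  · have hle : volume {s : ℝ | s ∈ Ioc (0 : ℝ) 1 ∧ ‖γ s - x‖ ≤ R} ≤
        volume {s : ℝ | s ∈ Ioc (0 : ℝ) 1 ∧ ENNReal.ofReal (5 * R)⁻¹ ≤ kappaStar γ s} := by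
      refine measure_mono_ae ?_
      filter_upwards [hγ.speed] with s hs h
      exact ⟨h.1, hall s h.1 h.2 hs⟩
    refine hle.trans ((volume_kappaStar_le (by positivity)).trans ?_)
    rw [inv_inv]
    gcongr
    norm_num
  · push Not at hall
    obtain ⟨s, hs, hsx, hs1, hk⟩ := hall
    obtain ⟨r, hr, hrR, hsec⟩ := exists_isSecure_of_kappaStar_lt (by positivity) hk
    rw [one_div, inv_le_inv₀ hr (by positivity)] at hrR
    have hle : volume {s : ℝ | s ∈ Ioc (0 : ℝ) 1 ∧ ‖γ s - x‖ ≤ R} ≤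
        volume {t : ℝ | t ∈ Ioc (0 : ℝ) 1 ∧ ‖((t - s : ℝ) : UnitAddCircle)‖ ≤ 4 * R} := by
      refine measure_mono_ae ?_
      filter_upwards [hγ.speed] with t ht h
      refine ⟨h.1, ?_⟩
      have hst : ‖γ s - γ t‖ ≤ 2 * R := by
        have := norm_sub_le (γ s - x) (γ t - x)
        rw [sub_sub_sub_cancel_right] at this
        linarith [h.2]
      rcases le_total r ‖((t - s : ℝ) : UnitAddCircle)‖ with hd | hd
      · have := hsec.far_dist hγ hd
        linarith
      · have := hsec.near_dist hγ hr hs1 ht hd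
        linarith
    refine hle.trans ((volume_norm_coe_sub_le hs _).trans ?_)
    rw [show 6 * (4 * R) = 24 * R by ring]
    exact le_mul_of_one_le_left zero_le
      (le_trans (by norm_num) (two_le_kappaNorm hγ))

/-- Dyadic decomposition of a decaying function, with the scale `ε` as the smallest one. -/
lemma ofReal_rpow_le_tsum {y ε p : ℝ} (hy : 0 ≤ y) (hε : 0 < ε) (hp : 0 ≤ p) :
    ENNReal.ofReal ((y + ε) ^ (-p)) ≤ ∑' k : ℕ, (Iic ((2 : ℝ) ^ k * ε)).indicator
      (fun _ => ENNReal.ofReal (2 ^ p * (2 ^ k * ε) ^ (-p))) y := by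
  have hex : ∃ k : ℕ, y ≤ 2 ^ k * ε := by
    obtain ⟨k, hk⟩ := pow_unbounded_of_one_lt (y / ε) (one_lt_two)
    exact ⟨k, by rw [div_lt_iff₀ hε] at hk; exact hk.le⟩
  classical
  have hspec := Nat.find_spec hex
  refine le_trans ?_ (ENNReal.le_tsum (Nat.find hex))
  rw [indicator_of_mem (by exact hspec)]
  refine ENNReal.ofReal_le_ofReal ?_
  rcases hk : Nat.find hex with _ | k
  · calc (y + ε) ^ (-p) ≤ ε ^ (-p) :=
          Real.rpow_le_rpow_of_nonpos hε (by linarith) (by linarith)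
      _ ≤ 2 ^ p * ε ^ (-p) := le_mul_of_one_le_left (by positivity)
          (Real.one_le_rpow one_le_two hp)
      _ = _ := by simp
  · have hmin := Nat.find_min hex (m := k) (by omega)
    push Not at hmin
    have e : 2 ^ p * (2 ^ (k + 1) * ε) ^ (-p) = (2 ^ k * ε) ^ (-p) := by
      rw [show (2 : ℝ) ^ (k + 1) * ε = 2 * (2 ^ k * ε) by ring,
        Real.mul_rpow (by norm_num) (by positivity), ← mul_assoc, ← Real.rpow_add (by norm_num)]
      simp
    rw [e]
    exact Real.rpow_le_rpow_of_nonpos (by positivity) (by linarith) (by linarith)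

/-- The occupation bound turned into a bound for decaying kernels along the curve. -/
lemma exists_lintegral_curve_rpow_le {p : ℝ} (hp : 1 < p) : ∃ C : ℝ, 0 ≤ C ∧
    ∀ γ : ℝ → E3, IsArclengthLoop γ → ∀ ε : ℝ, 0 < ε → ∀ x : E3,
      ∫⁻ s in Ioc (0 : ℝ) 1, ENNReal.ofReal ((‖γ s - x‖ + ε) ^ (-p)) ≤
        kappaNorm γ * ENNReal.ofReal (C * ε ^ (1 - p)) := by
  have h0 : (0 : ℝ) ≤ 2 ^ (1 - p) := by positivity
  have h1 : (2 : ℝ) ^ (1 - p) < 1 := Real.rpow_lt_one_of_one_lt_of_neg one_lt_two (by linarith)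
  refine ⟨24 * 2 ^ p * (1 - 2 ^ (1 - p))⁻¹, ?_, fun γ hγ ε hε x => ?_⟩
  · have : (0 : ℝ) ≤ 1 - 2 ^ (1 - p) := by linarith
    positivity
  have hc := hγ.continuous
  have hmeas : ∀ k : ℕ, MeasurableSet {s : ℝ | ‖γ s - x‖ ≤ 2 ^ k * ε} := fun k =>
    (isClosed_le (by fun_prop) (by fun_prop)).measurableSet
  calc ∫⁻ s in Ioc (0 : ℝ) 1, ENNReal.ofReal ((‖γ s - x‖ + ε) ^ (-p))
      ≤ ∫⁻ s in Ioc (0 : ℝ) 1, ∑' k : ℕ, {s : ℝ | ‖γ s - x‖ ≤ 2 ^ k * ε}.indicator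
        (fun _ => ENNReal.ofReal (2 ^ p * (2 ^ k * ε) ^ (-p))) s := by
        refine lintegral_mono fun s => ?_
        exact ofReal_rpow_le_tsum (norm_nonneg _) hε (by linarith)
    _ = ∑' k : ℕ, ENNReal.ofReal (2 ^ p * (2 ^ k * ε) ^ (-p)) *
          volume {s : ℝ | s ∈ Ioc (0 : ℝ) 1 ∧ ‖γ s - x‖ ≤ 2 ^ k * ε} := by
        rw [lintegral_tsum fun k => (measurable_const.indicator (hmeas k)).aemeasurable]
        refine tsum_congr fun k => ?_
        rw [lintegral_indicator_const (hmeas k), Measure.restrict_apply (hmeas k)]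
        congr 2
        ext s
        exact and_comm
    _ ≤ ∑' k : ℕ, ENNReal.ofReal (2 ^ p * (2 ^ k * ε) ^ (-p)) *
          (kappaNorm γ * ENNReal.ofReal (24 * (2 ^ k * ε))) := by
        gcongr with k
        exact volume_mem_closedBall_le hγ x (by positivity)
    _ = ∑' k : ℕ, kappaNorm γ * ENNReal.ofReal
          ((24 * 2 ^ p * ε ^ (1 - p)) * (2 ^ (1 - p)) ^ k) := by
        refine tsum_congr fun k => ?_
        rw [mul_left_comm, ← ENNReal.ofReal_mul (by positivity)]
        congr 2
        have e1 : (2 ^ k * ε) ^ (-p) * (2 ^ k * ε) = (2 ^ k * ε) ^ (1 - p) := by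
          rw [show 1 - p = -p + 1 by ring, Real.rpow_add (by positivity), Real.rpow_one]
        have e2 : ((2 : ℝ) ^ k) ^ (1 - p) = (2 ^ (1 - p)) ^ k := by
          rw [← Real.rpow_natCast, ← Real.rpow_natCast, ← Real.rpow_mul (by norm_num),
            ← Real.rpow_mul (by norm_num), mul_comm]
        rw [← e2, mul_assoc (24 * 2 ^ p), mul_comm (ε ^ (1 - p)),
          ← Real.mul_rpow (by positivity) hε.le, ← e1]
        ring
    _ = kappaNorm γ * ENNReal.ofReal (24 * 2 ^ p * (1 - 2 ^ (1 - p))⁻¹ * ε ^ (1 - p)) := by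
        rw [ENNReal.tsum_mul_left, ← ENNReal.ofReal_tsum_of_nonneg (fun k => by positivity)
          ((summable_geometric_of_lt_one h0 h1).mul_left _), tsum_mul_left,
          tsum_geometric_of_lt_one h0 h1]
        congr 2
        ring

/-- A measurable hull of the set where `κ* ≥ 2 ^ k`. It has the same measure as that set, which is
not known to be measurable. -/
def levelHull (γ : ℝ → E3) (k : ℕ) : Set ℝ :=
  toMeasurable volume {s : ℝ | s ∈ Ioc (0 : ℝ) 1 ∧ ENNReal.ofReal (2 ^ k) ≤ kappaStar γ s}

lemma measurableSet_levelHull (γ : ℝ → E3) (k : ℕ) : MeasurableSet (levelHull γ k) :=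
  measurableSet_toMeasurable _ _

lemma volume_levelHull_le (γ : ℝ → E3) (k : ℕ) :
    volume (levelHull γ k) ≤ kappaNorm γ * ENNReal.ofReal (2 ^ k)⁻¹ := by
  rw [levelHull, measure_toMeasurable]
  exact volume_kappaStar_le (by positivity)

/-- A measurable dyadic substitute for `min (κ* s) (κ* t)`: the sum of the `2 ^ k` over those `k`
for which both points lie in the hull of the set where `κ* ≥ 2 ^ k`. -/
def pairKappa (γ : ℝ → E3) (s t : ℝ) : ENNReal :=
  ∑' k : ℕ, (levelHull γ k).indicator (fun _ => ENNReal.ofReal (2 ^ k)) s *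
    (levelHull γ k).indicator (fun _ => 1) t

lemma measurable_pairKappa (γ : ℝ → E3) : Measurable fun p : ℝ × ℝ => pairKappa γ p.1 p.2 := by
  refine Measurable.tsum fun k => ?_
  exact ((measurable_const.indicator (measurableSet_levelHull γ k)).comp measurable_fst).mul
    ((measurable_const.indicator (measurableSet_levelHull γ k)).comp measurable_snd)

/-- The minimum of two independent copies of a weak-`L¹` function is integrable: both copies exceed
`2 ^ k` with probability of order `4⁻ᵏ`, and `∑ₖ 2ᵏ 4⁻ᵏ = 2`. -/
lemma lintegral_pairKappa_le (γ : ℝ → E3) :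
    ∫⁻ p : ℝ × ℝ, pairKappa γ p.1 p.2
      ∂((volume.restrict (Ioc (0 : ℝ) 1)).prod (volume.restrict (Ioc (0 : ℝ) 1))) ≤
      2 * kappaNorm γ ^ 2 := by
  unfold pairKappa
  have hm : ∀ k, Measurable ((levelHull γ k).indicator (fun _ => ENNReal.ofReal (2 ^ k))) :=
    fun k => measurable_const.indicator (measurableSet_levelHull γ k)
  have hm' : ∀ k, Measurable ((levelHull γ k).indicator (fun _ => (1 : ENNReal))) :=
    fun k => measurable_const.indicator (measurableSet_levelHull γ k)
  have hmm : ∀ k, Measurable fun p : ℝ × ℝ =>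
      (levelHull γ k).indicator (fun _ => ENNReal.ofReal (2 ^ k)) p.1 *
        (levelHull γ k).indicator (fun _ => (1 : ENNReal)) p.2 := fun k =>
    ((hm k).comp measurable_fst).mul ((hm' k).comp measurable_snd)
  rw [lintegral_tsum fun k => (hmm k).aemeasurable]
  have hk : ∀ k : ℕ, ∫⁻ p : ℝ × ℝ, (levelHull γ k).indicator (fun _ => ENNReal.ofReal (2 ^ k)) p.1 *
      (levelHull γ k).indicator (fun _ => 1) p.2
      ∂((volume.restrict (Ioc (0 : ℝ) 1)).prod (volume.restrict (Ioc (0 : ℝ) 1))) ≤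
      kappaNorm γ ^ 2 * ENNReal.ofReal ((1 / 2) ^ k) := by
    intro k
    rw [lintegral_prod_mul (hm k).aemeasurable (hm' k).aemeasurable,
      lintegral_indicator_const (measurableSet_levelHull γ k),
      lintegral_indicator_const (measurableSet_levelHull γ k), one_mul]
    have hv : (volume.restrict (Ioc (0 : ℝ) 1)) (levelHull γ k) ≤
        kappaNorm γ * ENNReal.ofReal (2 ^ k)⁻¹ :=
      (Measure.restrict_apply_le _ _).trans (volume_levelHull_le γ k)
    calc _ ≤ ENNReal.ofReal (2 ^ k) * (kappaNorm γ * ENNReal.ofReal (2 ^ k)⁻¹) *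
          (kappaNorm γ * ENNReal.ofReal (2 ^ k)⁻¹) := by gcongr
      _ = kappaNorm γ ^ 2 * (ENNReal.ofReal (2 ^ k) * ENNReal.ofReal (2 ^ k)⁻¹ *
          ENNReal.ofReal (2 ^ k)⁻¹) := by ring
      _ = _ := by
        rw [← ENNReal.ofReal_mul (by positivity), ← ENNReal.ofReal_mul (by positivity)]
        congr 2
        field_simp
        rw [← mul_pow]; norm_num
  refine (ENNReal.tsum_le_tsum hk).trans ?_
  rw [ENNReal.tsum_mul_left, ← ENNReal.ofReal_tsum_of_nonneg (fun k => by positivity)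
    summable_geometric_two, tsum_geometric_two, mul_comm]
  simp

/-- One of two points has a security radius bounded below in terms of `pairKappa`. -/
lemma exists_isSecure_or {s t : ℝ} (hs : s ∈ Ioc (0 : ℝ) 1) (ht : t ∈ Ioc (0 : ℝ) 1)
    (hκ : kappaStar γ s < ⊤) :
    ∃ r : ℝ, 0 < r ∧ ENNReal.ofReal (1 / r) ≤ 1 + 2 * pairKappa γ s t ∧
      (IsSecure γ s r ∨ IsSecure γ t r) := by
  classical
  have hex : ∃ k : ℕ, kappaStar γ s < ENNReal.ofReal (2 ^ k) ∨
      kappaStar γ t < ENNReal.ofReal (2 ^ k) := by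
    obtain ⟨k, hk⟩ := pow_unbounded_of_one_lt (kappaStar γ s).toReal one_lt_two
    refine ⟨k, Or.inl ?_⟩
    rw [← ENNReal.ofReal_toReal hκ.ne]
    exact (ENNReal.ofReal_lt_ofReal_iff (by positivity)).2 hk
  have main : ∃ r : ℝ, 0 < r ∧ 1 / r ≤ 2 ^ (Nat.find hex) ∧ (IsSecure γ s r ∨ IsSecure γ t r) := by
    rcases Nat.find_spec hex with h | h
    · obtain ⟨r, h1, h2, h3⟩ := exists_isSecure_of_kappaStar_lt (by positivity) h
      exact ⟨r, h1, h2, Or.inl h3⟩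
    · obtain ⟨r, h1, h2, h3⟩ := exists_isSecure_of_kappaStar_lt (by positivity) h
      exact ⟨r, h1, h2, Or.inr h3⟩
  obtain ⟨r, h1, h2, h3⟩ := main
  refine ⟨r, h1, ?_, h3⟩
  refine (ENNReal.ofReal_le_ofReal h2).trans ?_
  -- By minimality of the exponent, both points belong to the preceding level.
  rcases hk : Nat.find hex with _ | k
  · simp
  · have hmin := Nat.find_min hex (m := k) (by omega)
    push Not at hmin
    refine le_trans ?_ (le_add_of_nonneg_left zero_le_one)
    rw [pow_succ, mul_comm, ENNReal.ofReal_mul (by norm_num), ENNReal.ofReal_ofNat]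
    gcongr
    refine le_trans ?_ (ENNReal.le_tsum k)
    have hs' : s ∈ levelHull γ k := subset_toMeasurable _ _ (show _ ∧ _ from ⟨hs, hmin.1⟩)
    have ht' : t ∈ levelHull γ k := subset_toMeasurable _ _ (show _ ∧ _ from ⟨ht, hmin.2⟩)
    rw [indicator_of_mem hs', indicator_of_mem ht', mul_one]

lemma ae_kappaStar_lt_top (hK : kappaNorm γ < ⊤) :
    ∀ᵐ s ∂(volume.restrict (Ioc (0 : ℝ) 1)), kappaStar γ s < ⊤ := by
  rw [ae_restrict_iff' measurableSet_Ioc, ae_iff]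
  have h : ∀ n : ℕ, volume {s | ¬(s ∈ Ioc (0 : ℝ) 1 → kappaStar γ s < ⊤)} ≤
      kappaNorm γ * ENNReal.ofReal ((n : ℝ) + 1)⁻¹ := by
    intro n
    refine (measure_mono fun s hs => ?_).trans (volume_kappaStar_le (by positivity))
    simp only [mem_ofPred_eq, Classical.not_imp, not_lt, top_le_iff] at hs
    exact ⟨hs.1, by rw [hs.2]; exact le_top⟩
  have h1 : Filter.Tendsto (fun n : ℕ => ((n : ℝ) + 1)⁻¹) Filter.atTop (nhds 0) := by
    simpa using tendsto_one_div_add_atTop_nhds_zero_nat (𝕜 := ℝ)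
  have h2 := ENNReal.Tendsto.const_mul (a := kappaNorm γ) (ENNReal.tendsto_ofReal h1)
    (Or.inr hK.ne)
  rw [ENNReal.ofReal_zero, mul_zero] at h2
  exact le_antisymm (ge_of_tendsto' h2 h) zero_le

end

end VortexFilament

namespace VortexFilament

noncomputable section

/-! ### The prototype field as a superposition of line elements -/

open Set

variable {γ : ℝ → E3} {ρ : E3 → ℝ} {ε : ℝ}

lemma abs_rescale_le {M : ℝ} (hρ : IsRadialMollifier ρ) (hM : ∀ x, ρ x ≤ M) (hε : 0 < ε) (x : E3) :
    |rescale ρ ε x| ≤ (ε ^ 3)⁻¹ * M := by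
  rw [abs_of_nonneg (rescale_nonneg hρ hε x)]
  exact rescale_le hM hε x

/-- Absolute integrability of the Biot–Savart integrand, jointly in the point of space and the
parameter of the curve: this justifies the exchange of the mollification and the integral over the
curve. -/
lemma integrable_biotSavart_prod (hρ : IsRadialMollifier ρ) (hε : 0 < ε)
    (hγ : IsArclengthLoop γ) (x : E3) :
    Integrable (fun p : E3 × ℝ =>
      rescale ρ ε (p.1 - γ p.2) • cross (kern (p.1 - x)) (deriv γ p.2))
      (volume.prod (volume.restrict (Ioc (0 : ℝ) 1))) := by
  obtain ⟨M, hM0, hM⟩ := hρ.exists_bound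
  obtain ⟨C, -, hC⟩ := exists_integral_rpow_mul_add_rpow (p := 2) (q := 2) (by norm_num)
    (by norm_num) (by norm_num)
  obtain ⟨hi, -⟩ := hC 1 one_pos x
  set R : ℝ := ε + 1 + ‖γ 0 - x‖ with hR
  have hRpos : 0 < R := by positivity
  have hmeas : Measurable (fun p : E3 × ℝ =>
      rescale ρ ε (p.1 - γ p.2) • cross (kern (p.1 - x)) (deriv γ p.2)) := by
    have h1 := hγ.continuous.measurable
    have h2 := measurable_rescale hρ ε
    refine Measurable.smul (h2.comp (by fun_prop)) (measurable_cross ?_ ?_)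
    · exact measurable_kern.comp (by fun_prop)
    · exact hγ.measurable_deriv.comp measurable_snd
  have hdom : Integrable (fun p : E3 × ℝ => ((ε ^ 3)⁻¹ * M * (1 + R) ^ 2) *
      (‖x - p.1‖ ^ (-2 : ℝ) * (1 + ‖x - p.1‖) ^ (-2 : ℝ)))
      (volume.prod (volume.restrict (Ioc (0 : ℝ) 1))) :=
    (hi.comp_fst _).const_mul _
  refine hdom.mono' hmeas.aestronglyMeasurable ?_
  have hae : ∀ᵐ p : E3 × ℝ ∂(volume.prod (volume.restrict (Ioc (0 : ℝ) 1))),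
      p.2 ∈ Ioc (0 : ℝ) 1 :=
    Measure.quasiMeasurePreserving_snd.ae (ae_restrict_mem measurableSet_Ioc)
  filter_upwards [hae] with p hp
  rw [norm_smul, Real.norm_eq_abs]
  have hpos : 0 ≤ ((ε ^ 3)⁻¹ * M * (1 + R) ^ 2) *
      (‖x - p.1‖ ^ (-2 : ℝ) * (1 + ‖x - p.1‖) ^ (-2 : ℝ)) := by positivity
  rcases lt_or_ge ε ‖p.1 - γ p.2‖ with hfar | hnear
  · rw [rescale_eq_zero hρ hε hfar, abs_zero, zero_mul]
    exact hpos
  have hxp : ‖x - p.1‖ ≤ R := by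
    have h1 : ‖γ p.2 - γ 0‖ ≤ 1 := by
      have := hγ.lipschitz.norm_sub_le p.2 0
      rw [NNReal.coe_one, one_mul, sub_zero, Real.norm_eq_abs, abs_of_pos hp.1] at this
      exact this.trans hp.2
    have h2 : x - p.1 = -((p.1 - γ p.2) + (γ p.2 - γ 0) + (γ 0 - x)) := by abel
    rw [h2, norm_neg]
    refine (norm_add_le _ _).trans ?_
    have := norm_add_le (p.1 - γ p.2) (γ p.2 - γ 0)
    linarith
  have h2 : 1 ≤ (1 + R) ^ 2 * (1 + ‖x - p.1‖) ^ (-2 : ℝ) := by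
    rw [Real.rpow_neg (by positivity), Real.rpow_two, ← div_eq_mul_inv, one_le_div (by positivity)]
    gcongr
  have h3 : ‖cross (kern (p.1 - x)) (deriv γ p.2)‖ ≤ ‖x - p.1‖ ^ (-2 : ℝ) := by
    refine (norm_cross_le _ _).trans ?_
    rw [norm_kern, norm_sub_rev]
    exact mul_le_of_le_one_right (by positivity) (hγ.norm_deriv_le _)
  calc |rescale ρ ε (p.1 - γ p.2)| * ‖cross (kern (p.1 - x)) (deriv γ p.2)‖
      ≤ ((ε ^ 3)⁻¹ * M) * ‖x - p.1‖ ^ (-2 : ℝ) :=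
        mul_le_mul (abs_rescale_le hρ hM hε _) h3 (norm_nonneg _) (by positivity)
    _ ≤ ((ε ^ 3)⁻¹ * M) * ‖x - p.1‖ ^ (-2 : ℝ) * ((1 + R) ^ 2 * (1 + ‖x - p.1‖) ^ (-2 : ℝ)) :=
        le_mul_of_one_le_right (by positivity) h2
    _ = _ := by ring

lemma integrableOn_mollified (hρ : IsRadialMollifier ρ) (ε : ℝ) (hγ : IsArclengthLoop γ) (y : E3) :
    IntegrableOn (fun s => rescale ρ ε (y - γ s) • deriv γ s) (Ioc (0 : ℝ) 1) := by
  have h1 : IntegrableOn (deriv γ) (Ioc (0 : ℝ) 1) := (hγ.intervalIntegrable_deriv 0 1).1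
  obtain ⟨M, hM⟩ := isCompact_Icc.exists_bound_of_continuousOn (s := Icc (0 : ℝ) 1)
    (f := fun s => rescale ρ ε (y - γ s)) (by
      have := hγ.continuous
      have := (rescale_contDiff hρ ε).continuous
      fun_prop)
  refine (h1.norm.const_mul M).mono' ?_ ?_
  · have := hγ.continuous.measurable
    have h2 : Measurable fun s => rescale ρ ε (y - γ s) :=
      (measurable_rescale hρ ε).comp (by fun_prop)
    exact (h2.smul hγ.measurable_deriv).aestronglyMeasurable
  · filter_upwards [ae_restrict_mem measurableSet_Ioc] with s hs
    rw [norm_smul]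
    gcongr
    exact hM s (Ioc_subset_Icc_self hs)

/-- The field is the superposition of the fields of the line elements of the curve, with the
mollified kernel. -/
lemma prototypeField_eq (hρ : IsRadialMollifier ρ) (hε : 0 < ε) (hγ : IsArclengthLoop γ) (x : E3) :
    prototypeField ρ ε γ x =
      (1 / (4 * Real.pi)) • ∫ s in Ioc (0 : ℝ) 1, cross (kernE ρ ε (γ s - x)) (deriv γ s) := by
  unfold prototypeField biotSavart
  congr 1
  have h1 : ∀ y, cross ((‖y - x‖ ^ 3)⁻¹ • (y - x)) (mollifiedCurve ρ ε γ y) =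
      ∫ s in Ioc (0 : ℝ) 1, rescale ρ ε (y - γ s) • cross (kern (y - x)) (deriv γ s) := by
    intro y
    rw [mollifiedCurve, intervalIntegral.integral_of_le zero_le_one]
    have := (crossL (kern (y - x))).integral_comp_comm (integrableOn_mollified hρ ε hγ y)
    simp only [crossL_apply] at this
    rw [kern] at this ⊢
    rw [← this]
    simp only [cross_smul_right]
  simp_rw [h1]
  rw [integral_integral_swap (integrable_biotSavart_prod hρ hε hγ x)]
  refine integral_congr_ae (.of_forall fun s => ?_)
  simp only
  have h2 : ∀ y, rescale ρ ε (y - γ s) • cross (kern (y - x)) (deriv γ s) =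
      (crossL.flip (deriv γ s)) (rescale ρ ε (y - γ s) • kern (y - x)) := by
    intro y
    simp
  simp_rw [h2]
  rw [← integral_add_right_eq_self _ (γ s)]
  simp only [add_sub_cancel_right]
  have h3 : ∀ y, y + γ s - x = (γ s - x) + y := fun y => by abel
  simp_rw [h3]
  rw [ContinuousLinearMap.integral_comp_comm _
    ((integrable_mollMeasure hρ hε).1 (integrable_kern hρ hε _)), ← integral_mollMeasure hρ hε]
  rfl

lemma measurable_cross_kernE (hρ : IsRadialMollifier ρ) (hε : 0 < ε) (hγ : IsArclengthLoop γ) :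
    Measurable fun p : E3 × ℝ => cross (kernE ρ ε (γ p.2 - p.1)) (deriv γ p.2) := by
  have h1 := hγ.continuous.measurable
  exact measurable_cross ((measurable_kernE hρ hε).comp (by fun_prop))
    (hγ.measurable_deriv.comp measurable_snd)

lemma measurable_prototypeField (hρ : IsRadialMollifier ρ) (hε : 0 < ε) (hγ : IsArclengthLoop γ) :
    Measurable (prototypeField ρ ε γ) := by
  have : prototypeField ρ ε γ = fun x =>
      (1 / (4 * Real.pi)) • ∫ s in Ioc (0 : ℝ) 1, cross (kernE ρ ε (γ s - x)) (deriv γ s) :=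
    funext fun x => prototypeField_eq hρ hε hγ x
  rw [this]
  have h : StronglyMeasurable (Function.uncurry fun (x : E3) (s : ℝ) =>
      cross (kernE ρ ε (γ s - x)) (deriv γ s)) :=
    (measurable_cross_kernE hρ hε hγ).stronglyMeasurable
  exact (h.integral_prod_right (ν := volume.restrict (Ioc (0 : ℝ) 1))).measurable.const_smul
    (1 / (4 * Real.pi))

lemma exists_norm_cross_kernE_le (hρ : IsRadialMollifier ρ) : ∃ C : ℝ, 0 ≤ C ∧
    ∀ γ : ℝ → E3, IsArclengthLoop γ → ∀ ε : ℝ, 0 < ε → ∀ (x : E3) (s : ℝ),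
      ‖cross (kernE ρ ε (γ s - x)) (deriv γ s)‖ ≤ C * reg ε (γ s - x) := by
  obtain ⟨C, hC, h⟩ := exists_norm_kernE_le hρ
  refine ⟨C, hC, fun γ hγ ε hε x s => (norm_cross_le _ _).trans ?_⟩
  calc _ ≤ (C * reg ε (γ s - x)) * 1 :=
        mul_le_mul (h ε hε _) (hγ.norm_deriv_le s) (norm_nonneg _)
          (mul_nonneg hC (reg_nonneg _ _))
    _ = _ := mul_one _

lemma exists_enorm_prototypeField_le (hρ : IsRadialMollifier ρ) : ∃ C : ℝ, 0 ≤ C ∧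
    ∀ γ : ℝ → E3, IsArclengthLoop γ → ∀ ε : ℝ, 0 < ε → ∀ x : E3,
      ‖prototypeField ρ ε γ x‖ₑ ≤
        ENNReal.ofReal C * ∫⁻ s in Ioc (0 : ℝ) 1, ENNReal.ofReal (reg ε (γ s - x)) := by
  obtain ⟨C, hC, h⟩ := exists_norm_cross_kernE_le hρ
  refine ⟨1 / (4 * Real.pi) * C, by positivity, fun γ hγ ε hε x => ?_⟩
  rw [prototypeField_eq hρ hε hγ, enorm_smul, ENNReal.ofReal_mul (by positivity), mul_assoc]
  refine mul_le_mul' ?_ ?_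
  · rw [Real.enorm_of_nonneg (by positivity)]
  · have hm : Measurable fun s => ENNReal.ofReal (reg ε (γ s - x)) := by
      have := continuous_reg hε
      have := hγ.continuous
      exact (by fun_prop : Continuous fun s => reg ε (γ s - x)).measurable.ennreal_ofReal
    rw [← lintegral_const_mul _ hm]
    refine (enorm_integral_le_lintegral_enorm _).trans (lintegral_mono fun s => ?_)
    rw [← ENNReal.ofReal_mul hC, ← ofReal_norm]
    exact ENNReal.ofReal_le_ofReal (h γ hγ ε hε x s)

lemma reg_eq_rpow (hε : 0 < ε) (z : E3) : reg ε z = (‖z‖ + ε) ^ (-2 : ℝ) := by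
  rw [reg, Real.rpow_neg (by positivity), Real.rpow_two]

/-! ### The bounds in `L^q` for `q > 2` -/

lemma exists_eLpNorm_top_le (hρ : IsRadialMollifier ρ) : ∃ C : ℝ, 0 ≤ C ∧
    ∀ γ : ℝ → E3, IsArclengthLoop γ → ∀ ε : ℝ, 0 < ε →
      eLpNorm (prototypeField ρ ε γ) ⊤ volume ≤ ENNReal.ofReal (C * ε ^ (-1 : ℝ)) * kappaNorm γ := by
  obtain ⟨C, hC, h⟩ := exists_enorm_prototypeField_le hρ
  obtain ⟨C', hC', h'⟩ := exists_lintegral_curve_rpow_le (p := 2) (by norm_num)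
  refine ⟨C * C', by positivity, fun γ hγ ε hε => ?_⟩
  rw [eLpNorm_exponent_top]
  refine essSup_le_of_ae_le _ (.of_forall fun x => (h γ hγ ε hε x).trans ?_)
  simp_rw [reg_eq_rpow hε]
  calc _ ≤ ENNReal.ofReal C * (kappaNorm γ * ENNReal.ofReal (C' * ε ^ (1 - 2 : ℝ))) := by
        gcongr; exact h' γ hγ ε hε x
    _ = ENNReal.ofReal C * ENNReal.ofReal (C' * ε ^ (1 - 2 : ℝ)) * kappaNorm γ := by ring
    _ = _ := by
        rw [← ENNReal.ofReal_mul hC, ← mul_assoc]; norm_num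

lemma lintegral_rpow_add_eq {p : ℝ} (hp : 3 < p) : ∃ C : ℝ, 0 ≤ C ∧ ∀ ε : ℝ, 0 < ε → ∀ a : E3,
    ∫⁻ x : E3, ENNReal.ofReal ((‖a - x‖ + ε) ^ (-p)) = ENNReal.ofReal (C * ε ^ (3 - p)) := by
  obtain ⟨C, hC, h⟩ := exists_integral_rpow_mul_add_rpow (p := 0) (q := p) (by norm_num)
    (by linarith) (by linarith)
  refine ⟨C, hC, fun ε hε a => ?_⟩
  obtain ⟨h1, h2⟩ := h ε hε a
  simp only [neg_zero, Real.rpow_zero, one_mul, sub_zero, add_comm ε] at h1 h2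
  rw [← h2, ofReal_integral_eq_lintegral_ofReal h1 (.of_forall fun x => by positivity)]

lemma measurable_ofReal_rpow_curve (hγ : IsArclengthLoop γ) (ε r : ℝ) : Measurable fun z : E3 × ℝ =>
    ENNReal.ofReal ((‖γ z.2 - z.1‖ + ε) ^ r) := by
  have := hγ.continuous.measurable
  fun_prop

/-- Hölder's inequality along the curve, with the kernel split as `-2 = -b - c`. -/
lemma lintegral_reg_le_holder (hγ : IsArclengthLoop γ) (hε : 0 < ε) {p q b c : ℝ}
    (hpq : p.HolderConjugate q) (hbc : b + c = 2) (x : E3) :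
    ∫⁻ s in Ioc (0 : ℝ) 1, ENNReal.ofReal (reg ε (γ s - x)) ≤
      (∫⁻ s in Ioc (0 : ℝ) 1, ENNReal.ofReal ((‖γ s - x‖ + ε) ^ (-(b * p)))) ^ (1 / p) *
      (∫⁻ s in Ioc (0 : ℝ) 1, ENNReal.ofReal ((‖γ s - x‖ + ε) ^ (-(c * q)))) ^ (1 / q) := by
  have hmeas' : ∀ r : ℝ, Measurable fun s : ℝ => ENNReal.ofReal ((‖γ s - x‖ + ε) ^ r) := by
    intro r
    have := hγ.continuous.measurable
    fun_prop
  have hH := ENNReal.lintegral_mul_le_Lp_mul_Lq (volume.restrict (Ioc (0 : ℝ) 1)) hpq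
    (hmeas' (-b)).aemeasurable (hmeas' (-c)).aemeasurable
  have e1 : ∀ s, ENNReal.ofReal (reg ε (γ s - x)) =
      ENNReal.ofReal ((‖γ s - x‖ + ε) ^ (-b)) * ENNReal.ofReal ((‖γ s - x‖ + ε) ^ (-c)) := by
    intro s
    rw [← ENNReal.ofReal_mul (by positivity), ← Real.rpow_add (by positivity), reg_eq_rpow hε,
      show -b + -c = -2 by linarith]
  have e2 : ∀ (r t : ℝ), 0 ≤ t → ∀ s, ENNReal.ofReal ((‖γ s - x‖ + ε) ^ (-r)) ^ t =
      ENNReal.ofReal ((‖γ s - x‖ + ε) ^ (-(r * t))) := by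
    intro r t ht s
    rw [ENNReal.ofReal_rpow_of_nonneg (by positivity) ht, ← Real.rpow_mul (by positivity),
      neg_mul]
  simp only [Pi.mul_apply, e2 b p hpq.pos.le, e2 c q hpq.symm.pos.le] at hH
  simp_rw [e1]
  exact hH

/-- The numerology of Hölder's inequality in the bound of the `L^q` norm. -/
lemma rpow_mul_rpow_eq {C C₁ C₂ p q b c : ℝ} (hC₁ : 0 ≤ C₁) (hC₂ : 0 ≤ C₂) (hε : 0 < ε)
    (hpq : p.HolderConjugate q) (hbc : b + c = 2) :
    C * (C₁ * ε ^ (1 - b * p)) ^ (1 / p) * (C₂ * ε ^ (3 - c * q)) ^ (1 / q) =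
      C * C₁ ^ (1 / p) * C₂ ^ (1 / q) * ε ^ (2 / q - 1) := by
  have hp0 := hpq.pos
  have hq0 := hpq.symm.pos
  have hexp : (1 - b * p) * (1 / p) + (3 - c * q) * (1 / q) = 2 / q - 1 := by
    have h5 : 1 / p = 1 - 1 / q := by
      have := hpq.inv_add_inv_eq_one
      simp only [one_div]; linarith
    have h6 : (1 - b * p) * (1 / p) = 1 / p - b := by field_simp
    have h7 : (3 - c * q) * (1 / q) = 3 / q - c := by field_simp
    rw [h6, h7, h5, show c = 2 - b by linarith]; ring
  rw [Real.mul_rpow hC₁ (by positivity), Real.mul_rpow hC₂ (by positivity),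
    ← Real.rpow_mul hε.le, ← Real.rpow_mul hε.le, ← hexp, Real.rpow_add hε]
  ring

/-- Hölder's inequality along the curve, followed by an integration in `x`. Part of the decay of the
kernel makes the integral along the curve converge, the rest the integral over space. -/
lemma exists_eLpNorm_le (hρ : IsRadialMollifier ρ) {q : ℝ} (hq : 2 < q) : ∃ C : ℝ, 0 ≤ C ∧
    ∀ γ : ℝ → E3, IsArclengthLoop γ → ∀ ε : ℝ, 0 < ε →
      eLpNorm (prototypeField ρ ε γ) (ENNReal.ofReal q) volume ≤
        ENNReal.ofReal (C * ε ^ (2 / q - 1)) * kappaNorm γ := by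
  have hq0 : 0 < q := by linarith
  obtain ⟨p, hpq⟩ : ∃ p : ℝ, p.HolderConjugate q :=
    ⟨_, (Real.HolderConjugate.conjExponent (p := q) (by linarith)).symm⟩
  have hp0 : 0 < p := hpq.pos
  -- The integral along the curve converges for `1 < b * p` and the one over space for `3 < c * q`;
  -- both can be had with `b + c = 2` because `2 < q`.
  obtain ⟨b, c, hbc, hbp, hcq⟩ : ∃ b c : ℝ, b + c = 2 ∧ 1 < b * p ∧ 3 < c * q := by
    refine ⟨3 / 2 - 2 / q, 1 / 2 + 2 / q, by ring, ?_, ?_⟩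
    · have h1 : p⁻¹ = 1 - q⁻¹ := by linarith [hpq.inv_add_inv_eq_one]
      have h2 : p⁻¹ < 3 / 2 - 2 / q := by
        have : q⁻¹ < 1 / 2 := by
          rw [inv_lt_comm₀ hq0 (by norm_num)]; norm_num; exact hq
        rw [h1, div_eq_mul_inv 2 q]; linarith
      rw [inv_lt_iff_one_lt_mul₀ hp0] at h2
      linarith
    · have : (1 / 2 + 2 / q) * q = q / 2 + 2 := by field_simp
      rw [this]; linarith
  obtain ⟨C, hC, h⟩ := exists_enorm_prototypeField_le hρ
  obtain ⟨C₁, hC₁, h₁⟩ := exists_lintegral_curve_rpow_le hbp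
  obtain ⟨C₂, hC₂, h₂⟩ := lintegral_rpow_add_eq hcq
  refine ⟨C * C₁ ^ (1 / p) * C₂ ^ (1 / q), by positivity, fun γ hγ ε hε => ?_⟩
  have hK : 1 ≤ kappaNorm γ := le_trans (by norm_num) (two_le_kappaNorm hγ)
  obtain ⟨B, hB⟩ : ∃ B : ENNReal,
      B = kappaNorm γ * ENNReal.ofReal ((C₁ * ε ^ (1 - b * p)) ^ (1 / p)) := ⟨_, rfl⟩
  have hA : ∀ x, (∫⁻ s in Ioc (0 : ℝ) 1, ENNReal.ofReal ((‖γ s - x‖ + ε) ^ (-(b * p)))) ^ (1 / p)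
      ≤ B := by
    intro x
    refine (ENNReal.rpow_le_rpow (h₁ γ hγ ε hε x) (by positivity)).trans ?_
    rw [ENNReal.mul_rpow_of_nonneg _ _ (by positivity),
      ENNReal.ofReal_rpow_of_nonneg (by positivity) (by positivity), hB]
    gcongr
    -- Since `1 ≤ kappaNorm γ`, its power `1 / p` is bounded by `kappaNorm γ` itself.
    conv_rhs => rw [← ENNReal.rpow_one (kappaNorm γ)]
    refine ENNReal.rpow_le_rpow_of_exponent_le hK ?_
    rw [one_div]
    exact inv_le_one_of_one_le₀ hpq.lt.le
  have hpt : ∀ x, ‖prototypeField ρ ε γ x‖ₑ ^ q ≤ (ENNReal.ofReal C * B) ^ q *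
      ∫⁻ s in Ioc (0 : ℝ) 1, ENNReal.ofReal ((‖γ s - x‖ + ε) ^ (-(c * q))) := by
    intro x
    have h4 : ‖prototypeField ρ ε γ x‖ₑ ≤ ENNReal.ofReal C * B *
        (∫⁻ s in Ioc (0 : ℝ) 1, ENNReal.ofReal ((‖γ s - x‖ + ε) ^ (-(c * q)))) ^ (1 / q) := by
      refine (h γ hγ ε hε x).trans ?_
      rw [mul_assoc]
      refine mul_le_mul_right ((lintegral_reg_le_holder hγ hε hpq hbc x).trans ?_) _
      exact mul_le_mul_left (hA x) _
    refine (ENNReal.rpow_le_rpow h4 hq0.le).trans (le_of_eq ?_)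
    rw [ENNReal.mul_rpow_of_nonneg _ _ hq0.le, ← ENNReal.rpow_mul, one_div,
      inv_mul_cancel₀ hq0.ne', ENNReal.rpow_one]
  have hint : ∫⁻ x, ‖prototypeField ρ ε γ x‖ₑ ^ q ≤ (ENNReal.ofReal C * B) ^ q *
      ENNReal.ofReal (C₂ * ε ^ (3 - c * q)) := by
    refine (lintegral_mono hpt).trans ?_
    have hm := measurable_ofReal_rpow_curve hγ ε (-(c * q))
    rw [lintegral_const_mul _ (Measurable.lintegral_prod_right hm),
      lintegral_lintegral_swap (f := fun x s => ENNReal.ofReal ((‖γ s - x‖ + ε) ^ (-(c * q))))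
        hm.aemeasurable]
    simp_rw [h₂ ε hε]
    simp
  rw [eLpNorm_eq_lintegral_rpow_enorm_toReal (by simpa using hq0) ENNReal.ofReal_ne_top,
    ENNReal.toReal_ofReal hq0.le]
  refine (ENNReal.rpow_le_rpow hint (by positivity)).trans (le_of_eq ?_)
  rw [ENNReal.mul_rpow_of_nonneg _ _ (by positivity), ← ENNReal.rpow_mul, mul_one_div,
    div_self hq0.ne', ENNReal.rpow_one,
    ENNReal.ofReal_rpow_of_nonneg (by positivity) (by positivity), hB,
    ← rpow_mul_rpow_eq hC₁ hC₂ hε hpq hbc, ENNReal.ofReal_mul (by positivity),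
    ENNReal.ofReal_mul hC]
  ring

lemma exists_memLp_and_eLpNorm_toReal_le (hρ : IsRadialMollifier ρ) {q : ENNReal} (hq : 2 < q) :
    ∃ C : ℝ, ∀ γ : ℝ → E3, IsArclengthLoop γ → kappaNorm γ < ⊤ → ∀ ε : ℝ, 0 < ε → ε < 1 / 2 →
      MemLp (prototypeField ρ ε γ) q volume ∧
      (eLpNorm (prototypeField ρ ε γ) q volume).toReal
        ≤ C * ε ^ ((2 / q).toReal - 1) * (kappaNorm γ).toReal := by
  have main : ∃ C : ℝ, 0 ≤ C ∧ ∀ γ : ℝ → E3, IsArclengthLoop γ → ∀ ε : ℝ, 0 < ε →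
      eLpNorm (prototypeField ρ ε γ) q volume ≤
        ENNReal.ofReal (C * ε ^ ((2 / q).toReal - 1)) * kappaNorm γ := by
    rcases eq_or_ne q ⊤ with rfl | hqt
    · obtain ⟨C, hC, h⟩ := exists_eLpNorm_top_le hρ
      refine ⟨C, hC, fun γ hγ ε hε => (h γ hγ ε hε).trans_eq ?_⟩
      simp
    · have hq2 : 2 < q.toReal := by
        have := (ENNReal.toReal_lt_toReal (by norm_num) hqt).2 hq
        simpa using this
      obtain ⟨C, hC, h⟩ := exists_eLpNorm_le hρ hq2
      refine ⟨C, hC, fun γ hγ ε hε => ?_⟩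
      have := h γ hγ ε hε
      rw [ENNReal.ofReal_toReal hqt] at this
      rwa [ENNReal.toReal_div, ENNReal.toReal_ofNat]
  obtain ⟨C, hC, h⟩ := main
  refine ⟨C, fun γ hγ hK ε hε _ => ?_⟩
  have hlt : ENNReal.ofReal (C * ε ^ ((2 / q).toReal - 1)) * kappaNorm γ < ⊤ :=
    ENNReal.mul_lt_top ENNReal.ofReal_lt_top hK
  refine ⟨⟨(measurable_prototypeField hρ hε hγ).aestronglyMeasurable,
    (h γ hγ ε hε).trans_lt hlt⟩, ?_⟩
  have := ENNReal.toReal_mono hlt.ne (h γ hγ ε hε)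
  rwa [ENNReal.toReal_mul, ENNReal.toReal_ofReal (by positivity)] at this

end

end VortexFilament

namespace VortexFilament

noncomputable section

/-! ### The interaction of two points of the curve -/

open Set

variable {γ : ℝ → E3} {ρ : E3 → ℝ} {ε : ℝ}

/-- The transpose of a matrix, as an isometry. -/
def transposeM : M3 ≃ₗᵢ[ℝ] M3 :=
  LinearIsometryEquiv.piLpCongrLeft 2 ℝ ℝ (Equiv.prodComm (Fin 3) (Fin 3))

@[simp] lemma transposeM_apply (A : M3) (i j : Fin 3) : transposeM A (i, j) = A (j, i) := rfl

lemma ddot_transposeM_tensor (A : M3) (a b : E3) :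
    ddot (transposeM A) (tensor a b) = ddot A (tensor b a) := by
  simp only [ddot, transposeM_apply, tensor_apply]
  rw [Finset.sum_comm]
  simp only [mul_comm (a _)]

lemma ddot_transposeM_idMatrix_sub (A : M3) (τ : E3) :
    ddot (transposeM A) (idMatrix - tensor τ τ) = ddot A (idMatrix - tensor τ τ) := by
  simp only [ddot, transposeM_apply, PiLp.sub_apply, tensor_apply, idMatrix]
  rw [Finset.sum_comm]
  refine Finset.sum_congr rfl fun i _ => Finset.sum_congr rfl fun j _ => ?_
  simp only [mul_comm (τ j), eq_comm (a := j)]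

lemma interaction_symm (φ : E3 → M3) (a b τ σ : E3) :
    interaction ρ ε φ a b τ σ = interaction ρ ε (fun x => transposeM (φ x)) b a σ τ := by
  unfold interaction
  simp_rw [ddot_transposeM_tensor]

/-- The limit density `φ : (I - τ ⊗ τ)` along the curve. -/
def normalTrace (φ : E3 → M3) (γ : ℝ → E3) (s : ℝ) : ℝ :=
  ddot (φ (γ s)) (idMatrix - tensor (deriv γ s) (deriv γ s))

lemma norm_idMatrix_sub_tensor_le {τ : E3} (hτ : ‖τ‖ ≤ 1) : ‖idMatrix - tensor τ τ‖ ≤ 3 := by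
  refine (norm_sub_le _ _).trans ?_
  have := norm_idMatrix
  rw [norm_tensor]
  nlinarith [norm_nonneg τ]

lemma abs_normalTrace_le (hγ : IsArclengthLoop γ) {φ : E3 → M3} {W : ℝ} (hW : ∀ x, ‖φ x‖ ≤ W)
    (s : ℝ) : |normalTrace φ γ s| ≤ 3 * W := by
  refine (abs_ddot_le _ _).trans ?_
  have h1 := norm_idMatrix_sub_tensor_le (hγ.norm_deriv_le s)
  have h2 := hW (γ s)
  nlinarith [norm_nonneg (φ (γ s)), norm_nonneg (idMatrix - tensor (deriv γ s) (deriv γ s))]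

/-- A chord is no longer than the shorter arc. -/
lemma norm_sub_le_norm_coe (hγ : IsArclengthLoop γ) (s t : ℝ) :
    ‖γ s - γ t‖ ≤ ‖((t - s : ℝ) : UnitAddCircle)‖ := by
  obtain ⟨c, h1, h2, -⟩ := exists_shift hγ s t
  rw [h2, ← h1]
  have := hγ.lipschitz.norm_sub_le s (s - c)
  simpa using this

/-- The error terms of the pairwise comparison, at distance `d` along the curve: the first one is
due to the mollification, the second to the oscillation of the coefficient, and the third to the
curvature, `r` being a security radius of one of the two points. -/
def pairError (ε d r : ℝ) : ℝ := ε / (d + ε) ^ 2 + d ^ (-(1 / 2) : ℝ) + 1 / r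

lemma pairError_nonneg {d r : ℝ} (hε : 0 < ε) (hd : 0 ≤ d) (hr : 0 < r) :
    0 ≤ pairError ε d r := by unfold pairError; positivity

lemma one_div_le_pairError {d r : ℝ} (hε : 0 < ε) (hd : 0 ≤ d) : 1 / r ≤ pairError ε d r := by
  have E1 : 0 ≤ ε / (d + ε) ^ 2 := by positivity
  have E2 : 0 ≤ d ^ (-(1 / 2) : ℝ) := by positivity
  unfold pairError; linarith

lemma rpow_le_pairError {d r : ℝ} (hε : 0 < ε) (hr : 0 < r) :
    d ^ (-(1 / 2) : ℝ) ≤ pairError ε d r := by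
  have E1 : 0 ≤ ε / (d + ε) ^ 2 := by positivity
  have E2 : 0 ≤ 1 / r := by positivity
  unfold pairError; linarith

lemma div_sq_le_pairError {d r : ℝ} (hd : 0 ≤ d) (hr : 0 < r) :
    ε / (d + ε) ^ 2 ≤ pairError ε d r := by
  have E1 : 0 ≤ d ^ (-(1 / 2) : ℝ) := by positivity
  have E2 : 0 ≤ 1 / r := by positivity
  unfold pairError; linarith

/-- At distances below `16 * ε` the mollification error is comparable to `1 / ε`; the constant is
`(16 + 1) ^ 2`. -/
lemma one_div_le_pairError_of_lt {d r : ℝ} (hε : 0 < ε) (hd : 0 ≤ d) (hr : 0 < r)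
    (h : d < 16 * ε) : 1 / ε ≤ 289 * pairError ε d r := by
  have k1 : 1 / ε ≤ 289 * (ε / (d + ε) ^ 2) := by
    rw [mul_div_assoc', div_le_div_iff₀ hε (by positivity)]
    nlinarith
  have := div_sq_le_pairError (ε := ε) hd hr
  linarith

lemma div_sq_le_of_le {d : ℝ} (hε : 0 < ε) (h : 16 * ε ≤ d) :
    ε / d ^ 2 ≤ 2 * (ε / (d + ε) ^ 2) := by
  have hd : 0 < d := by linarith
  have : (d + ε) ^ 2 ≤ 2 * d ^ 2 := by nlinarith
  rw [mul_div_assoc', div_le_div_iff₀ (by positivity) (by positivity)]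
  nlinarith

lemma div_mul_le_of_le {d : ℝ} (hε : 0 < ε) (h : 16 * ε ≤ d) :
    ε / (d * (d + ε)) ≤ 2 * (ε / (d + ε) ^ 2) := by
  have hd : 0 < d := by linarith
  have : (d + ε) ^ 2 ≤ 2 * (d * (d + ε)) := by nlinarith
  rw [mul_div_assoc', div_le_div_iff₀ (by positivity) (by positivity)]
  nlinarith

/-- The comparison of the interaction with its limit along a nearly straight arc. -/
lemma exists_abs_interaction_sub_le_of_near (hρ : IsRadialMollifier ρ) : ∃ C : ℝ, 0 ≤ C ∧
    ∀ ε : ℝ, 0 < ε → ∀ (φ : E3 → M3) (W : ℝ), Measurable φ →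
    (∀ x, ‖φ x‖ ≤ W) → (∀ x y, ‖φ x - φ y‖ ≤ 2 * W * ‖y - x‖ ^ (1 / 2 : ℝ)) →
    ∀ (a b τ σ : E3) (c d r : ℝ), ‖τ‖ = 1 → ‖σ‖ ≤ 1 → |c| = d → 0 < r → 16 * ε ≤ d → d ≤ r →
    d / 2 ≤ ‖a - b‖ → ‖(a - b) - c • τ‖ ≤ d ^ 2 / (2 * r) → ‖τ - σ‖ ≤ d / r →
    |interaction ρ ε φ a b τ σ - 2 * Real.pi * ddot (φ a) (idMatrix - tensor τ τ) / d| ≤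
      C * (W * pairError ε d r) := by
  obtain ⟨C₂, hC₂, h₂⟩ := exists_abs_interaction_sub_const_le hρ
  obtain ⟨C₃, hC₃, h₃⟩ := exists_abs_interaction_const_sub_le hρ
  refine ⟨2 * C₂ + 6 * C₃, by positivity, fun ε hε φ W hφ hW hH a b τ σ c d r hτ hσ hcd hr hfar
    hrd hdist hc1 hc2 => ?_⟩
  have hd : 0 < d := by linarith
  have hW0 : 0 ≤ W := (norm_nonneg _).trans (hW 0)
  have hab : a ≠ b := by
    intro h
    rw [h, sub_self, norm_zero] at hdist
    linarith
  have t1 := h₂ ε hε φ W hφ hW hH a b τ σ hab hτ.le hσ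
  have t2 := h₃ ε hε (φ a) a b τ σ c (d ^ 2 / (2 * r)) hτ hσ (by rw [hcd]; exact hfar) hc1 (by
    rw [div_le_div_iff₀ (by positivity) (by positivity), hcd]
    nlinarith)
  rw [hcd] at t2
  have u1 : ‖a - b‖ ^ (-(1 / 2) : ℝ) ≤ 2 * d ^ (-(1 / 2) : ℝ) := by
    calc _ ≤ (d / 2) ^ (-(1 / 2) : ℝ) :=
          Real.rpow_le_rpow_of_nonpos (by positivity) hdist (by norm_num)
      _ = d ^ (-(1 / 2) : ℝ) * 2 ^ (1 / 2 : ℝ) := by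
          rw [Real.div_rpow hd.le (by norm_num), Real.rpow_neg (by norm_num : (0 : ℝ) ≤ 2)]
          field_simp
      _ ≤ d ^ (-(1 / 2) : ℝ) * 2 ^ (1 : ℝ) := by
          have : (2 : ℝ) ^ (1 / 2 : ℝ) ≤ 2 ^ (1 : ℝ) :=
            Real.rpow_le_rpow_of_exponent_le (by norm_num) (by norm_num)
          gcongr
      _ = _ := by rw [Real.rpow_one]; ring
  have u3 := div_sq_le_of_le hε hfar
  have u2 : (d ^ 2 / (2 * r) + 2 * ε) / d ^ 2 + ‖τ - σ‖ / d ≤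
      4 * (ε / (d + ε) ^ 2) + 2 * (1 / r) := by
    have v1 : (d ^ 2 / (2 * r) + 2 * ε) / d ^ 2 = 1 / 2 * (1 / r) + 2 * (ε / d ^ 2) := by
      field_simp
    have v2 : ‖τ - σ‖ / d ≤ 1 / r := by
      rw [div_le_iff₀ hd]
      calc _ ≤ d / r := hc2
        _ = _ := by ring
    have v3 : 0 ≤ 1 / r := by positivity
    rw [v1]; linarith
  have p1 := one_div_le_pairError (r := r) hε hd.le
  have p2 := rpow_le_pairError (d := d) hε hr
  have p3 := div_sq_le_pairError (ε := ε) hd.le hr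
  have hP := pairError_nonneg hε hd.le hr
  have t1' : |interaction ρ ε φ a b τ σ - interaction ρ ε (fun _ => φ a) a b τ σ| ≤
      C₂ * W * (2 * pairError ε d r) := t1.trans
    (mul_le_mul_of_nonneg_left (by linarith) (by positivity))
  have t2' : |interaction ρ ε (fun _ => φ a) a b τ σ -
      2 * Real.pi * ddot (φ a) (idMatrix - tensor τ τ) / d| ≤
      C₃ * W * (6 * pairError ε d r) := by
    refine t2.trans (mul_le_mul ?_ (by linarith) (by positivity) (by positivity))
    exact mul_le_mul_of_nonneg_left (hW a) hC₃
  calc _ ≤ C₂ * W * (2 * pairError ε d r) + C₃ * W * (6 * pairError ε d r) :=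
        (abs_sub_le _ _ _).trans (add_le_add t1' t2')
    _ = _ := by ring

/-- The pairwise comparison, with a security radius `r` at the first point. Points at distance below
`16 * ε`, and points further than `r`, are covered by the crude bound of the interaction; the
remaining ones lie on a nearly straight arc. -/
lemma exists_abs_interaction_sub_le_left (hρ : IsRadialMollifier ρ) : ∃ C : ℝ, 0 ≤ C ∧
    ∀ γ : ℝ → E3, IsArclengthLoop γ → ∀ ε : ℝ, 0 < ε → ∀ (φ : E3 → M3) (W : ℝ), Measurable φ →
    (∀ x, ‖φ x‖ ≤ W) → (∀ x y, ‖φ x - φ y‖ ≤ 2 * W * ‖y - x‖ ^ (1 / 2 : ℝ)) →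
    ∀ s t r : ℝ, ‖deriv γ s‖ = 1 → ‖deriv γ t‖ = 1 → 0 < ‖((t - s : ℝ) : UnitAddCircle)‖ →
    0 < r → IsSecure γ s r →
    |interaction ρ ε φ (γ s) (γ t) (deriv γ s) (deriv γ t) -
      2 * Real.pi * normalTrace φ γ s / (‖((t - s : ℝ) : UnitAddCircle)‖ + ε)| ≤
      C * W * pairError ε ‖((t - s : ℝ) : UnitAddCircle)‖ r := by
  obtain ⟨C₁, hC₁, h₁⟩ := exists_abs_interaction_le hρ
  obtain ⟨C₂, hC₂, h₂⟩ := exists_abs_interaction_sub_le_of_near hρ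
  refine ⟨289 * (C₁ + 20) + C₂ + 40,
    by positivity, fun γ hγ ε hε φ W hφ hW hH s t r hs ht hd hr hsec => ?_⟩
  have hW0 : 0 ≤ W := (norm_nonneg _).trans (hW 0)
  have hpi : Real.pi ≤ 3.15 := Real.pi_lt_d2.le
  have hpi0 := Real.pi_pos
  have hF := h₁ ε hε φ W hφ hW (γ s) (γ t) (deriv γ s) (deriv γ t) hs.le ht.le
  have hf := abs_normalTrace_le hγ hW s
  have hfπ : |2 * Real.pi * normalTrace φ γ s| ≤ 20 * W := by
    rw [abs_mul, abs_of_pos (by positivity)]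
    nlinarith [abs_nonneg (normalTrace φ γ s)]
  have hnear := hsec.near hγ hr ht
  have hnear' := hsec.near_dist hγ hr hs ht
  have hfar' := hsec.far_dist hγ (t := t)
  have key := h₂ ε hε φ W hφ hW hH (γ s) (γ t) (deriv γ s) (deriv γ t)
  change ∀ c d r : ℝ, _ → _ → _ → _ → _ → _ → _ → _ → _ →
    |_ - 2 * Real.pi * normalTrace φ γ s / d| ≤ _ at key
  have hdt := norm_sub_le_norm_coe hγ s t
  generalize ‖((t - s : ℝ) : UnitAddCircle)‖ = d at *
  generalize interaction ρ ε φ (γ s) (γ t) (deriv γ s) (deriv γ t) = F at *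
  generalize 2 * Real.pi * normalTrace φ γ s = f at *
  have hP := pairError_nonneg hε hd.le hr
  have hWP : 0 ≤ W * pairError ε d r := mul_nonneg hW0 hP
  have hT : |f / (d + ε)| ≤ 20 * W / (d + ε) := by
    rw [abs_div, abs_of_pos (by positivity : 0 < d + ε)]
    gcongr
  suffices h : ∃ K, K ≤ 289 * (C₁ + 20) + C₂ + 40 ∧ |F - f / (d + ε)| ≤ K * (W * pairError ε d r) by
    obtain ⟨K, hK, h⟩ := h
    rw [mul_assoc]
    exact h.trans (mul_le_mul_of_nonneg_right hK hWP)
  -- Below `16 * ε`, both terms are of order `1 / ε`, that is, of the mollification error.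
  rcases lt_or_ge d (16 * ε) with hlt | hfar
  · refine ⟨289 * (C₁ + 20), by linarith, ?_⟩
    calc _ ≤ C₁ * W / (‖γ s - γ t‖ + ε) + 20 * W / (d + ε) :=
          (abs_sub _ _).trans (add_le_add hF hT)
      _ ≤ C₁ * W / ε + 20 * W / ε := by
          gcongr
          · linarith [norm_nonneg (γ s - γ t)]
          · linarith
      _ = (C₁ + 20) * W * (1 / ε) := by ring
      _ ≤ (C₁ + 20) * W * (289 * pairError ε d r) :=
          mul_le_mul_of_nonneg_left (one_div_le_pairError_of_lt hε hd.le hr hlt) (by positivity)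
      _ = _ := by ring
  -- Beyond the security radius, both terms are of order `1 / r`.
  rcases le_total r d with hrd | hrd
  · refine ⟨2 * C₁ + 20, by linarith, ?_⟩
    have hdist := hfar' hrd
    calc _ ≤ C₁ * W / (‖γ s - γ t‖ + ε) + 20 * W / (d + ε) :=
          (abs_sub _ _).trans (add_le_add hF hT)
      _ ≤ C₁ * W / (r / 2) + 20 * W / r := by
          gcongr
          · linarith
          · linarith
      _ = (2 * C₁ + 20) * W * (1 / r) := by field_simp
      _ ≤ (2 * C₁ + 20) * W * pairError ε d r :=
          mul_le_mul_of_nonneg_left (one_div_le_pairError hε hd.le) (by positivity)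
      _ = _ := by ring
  · refine ⟨C₂ + 40, by linarith, ?_⟩
    obtain ⟨c, hc, hc1, hc2⟩ := hnear hrd
    have t1 := key c d r hs ht.le hc hr hfar hrd (hnear' hrd) (by rw [hc] at hc1; exact hc1)
      (by rw [hc] at hc2; exact hc2)
    have t2 : |f / d - f / (d + ε)| ≤ 40 * (W * pairError ε d r) := by
      have e : f / d - f / (d + ε) = f * (ε / (d * (d + ε))) := by
        field_simp; ring
      have v := div_mul_le_of_le hε hfar
      have v2 := div_sq_le_pairError (ε := ε) hd.le hr
      rw [e, abs_mul, abs_of_nonneg (by positivity : 0 ≤ ε / (d * (d + ε)))]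
      calc _ ≤ 20 * W * (2 * pairError ε d r) :=
            mul_le_mul hfπ (by linarith) (by positivity) (by positivity)
        _ = _ := by ring
    calc _ ≤ _ := abs_sub_le _ (f / d) _
      _ ≤ _ := add_le_add t1 t2
      _ = _ := by ring

lemma abs_normalTrace_sub_le (hγ : IsArclengthLoop γ) {φ : E3 → M3} {W : ℝ}
    (hW : ∀ x, ‖φ x‖ ≤ W) (hH : ∀ x y, ‖φ x - φ y‖ ≤ 2 * W * ‖y - x‖ ^ (1 / 2 : ℝ)) (s t : ℝ) :
    |normalTrace φ γ s - normalTrace φ γ t| ≤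
      6 * W * ‖((t - s : ℝ) : UnitAddCircle)‖ ^ (1 / 2 : ℝ) +
        2 * W * ‖deriv γ s - deriv γ t‖ := by
  have e : normalTrace φ γ s - normalTrace φ γ t =
      ddot (φ (γ s) - φ (γ t)) (idMatrix - tensor (deriv γ s) (deriv γ s)) -
      ddot (φ (γ t)) (tensor (deriv γ s) (deriv γ s) - tensor (deriv γ t) (deriv γ t)) := by
    unfold normalTrace
    simp only [ddot_eq_inner, inner_sub_left, inner_sub_right]
    ring
  have hW0 : 0 ≤ W := (norm_nonneg _).trans (hW 0)
  rw [e]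
  refine (abs_sub _ _).trans (add_le_add ?_ ?_)
  · refine (abs_ddot_le _ _).trans ?_
    have h1 := norm_idMatrix_sub_tensor_le (hγ.norm_deriv_le s)
    have h2 : ‖φ (γ s) - φ (γ t)‖ ≤ 2 * W * ‖((t - s : ℝ) : UnitAddCircle)‖ ^ (1 / 2 : ℝ) := by
      refine (hH _ _).trans ?_
      have := norm_sub_le_norm_coe hγ s t
      rw [norm_sub_rev] at this
      gcongr
    calc _ ≤ 2 * W * ‖((t - s : ℝ) : UnitAddCircle)‖ ^ (1 / 2 : ℝ) * 3 := by gcongr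
      _ = _ := by ring
  · refine (abs_ddot_le _ _).trans ?_
    have h1 := norm_tensor_sub_tensor_le (hγ.norm_deriv_le s) (hγ.norm_deriv_le t)
    calc _ ≤ W * (2 * ‖deriv γ s - deriv γ t‖) := by gcongr; exact hW _
      _ = _ := by ring

/-- The pairwise comparison, with a security radius at either of the two points. If it is at the
second point, the roles of the points are exchanged, at the price of transposing the coefficient
and of moving the point at which the limit density is evaluated. -/
lemma exists_abs_interaction_sub_le (hρ : IsRadialMollifier ρ) : ∃ C : ℝ, 0 ≤ C ∧
    ∀ γ : ℝ → E3, IsArclengthLoop γ → ∀ ε : ℝ, 0 < ε → ∀ (φ : E3 → M3) (W : ℝ), Measurable φ →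
    (∀ x, ‖φ x‖ ≤ W) → (∀ x y, ‖φ x - φ y‖ ≤ 2 * W * ‖y - x‖ ^ (1 / 2 : ℝ)) →
    ∀ s t r : ℝ, ‖deriv γ s‖ = 1 → ‖deriv γ t‖ = 1 → 0 < ‖((t - s : ℝ) : UnitAddCircle)‖ →
    0 < r → (IsSecure γ s r ∨ IsSecure γ t r) →
    |interaction ρ ε φ (γ s) (γ t) (deriv γ s) (deriv γ t) -
      2 * Real.pi * normalTrace φ γ s / (‖((t - s : ℝ) : UnitAddCircle)‖ + ε)| ≤
      C * W * pairError ε ‖((t - s : ℝ) : UnitAddCircle)‖ r := by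
  obtain ⟨C, hC, h⟩ := exists_abs_interaction_sub_le_left hρ
  refine ⟨C + 80, by positivity, fun γ hγ ε hε φ W hφ hW hH s t r hs ht hd hr hsec => ?_⟩
  have hW0 : 0 ≤ W := (norm_nonneg _).trans (hW 0)
  have hP : 0 ≤ pairError ε ‖((t - s : ℝ) : UnitAddCircle)‖ r := by
    unfold pairError; positivity
  rcases hsec with hsec | hsec
  · refine (h γ hγ ε hε φ W hφ hW hH s t r hs ht hd hr hsec).trans ?_
    gcongr
    linarith
  · have hrev : ‖((s - t : ℝ) : UnitAddCircle)‖ = ‖((t - s : ℝ) : UnitAddCircle)‖ := by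
      rw [← norm_neg, ← AddCircle.coe_neg, neg_sub]
    have t1 := h γ hγ ε hε (fun x => transposeM (φ x)) W
      (transposeM.continuous.measurable.comp hφ)
      (fun x => by rw [transposeM.norm_map]; exact hW x)
      (fun x y => by rw [← map_sub, transposeM.norm_map]; exact hH x y) t s r ht hs
      (by rw [hrev]; exact hd) hr hsec
    rw [← interaction_symm, hrev] at t1
    have e : normalTrace (fun x => transposeM (φ x)) γ t = normalTrace φ γ t := by
      unfold normalTrace; rw [ddot_transposeM_idMatrix_sub]
    rw [e] at t1
    set d : ℝ := ‖((t - s : ℝ) : UnitAddCircle)‖ with hddef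
    have hdiff := abs_normalTrace_sub_le hγ hW hH s t
    rw [← hddef] at hdiff
    have t2 : |normalTrace φ γ s - normalTrace φ γ t| / d ≤
        8 * W * (d ^ (-(1 / 2) : ℝ) + 1 / r) := by
      have E2 : 0 ≤ d ^ (-(1 / 2) : ℝ) := by positivity
      rcases le_total r d with hrd | hrd
      · have b1 : |normalTrace φ γ s - normalTrace φ γ t| ≤ 6 * W := by
          refine (abs_sub _ _).trans ?_
          linarith [abs_normalTrace_le hγ hW s, abs_normalTrace_le hγ hW t]
        calc _ ≤ 6 * W / r := by gcongr
          _ = 6 * W * (0 + 1 / r) := by ring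
          _ ≤ _ := by gcongr; linarith
      · obtain ⟨c, hc, -, hc2⟩ := hsec.near hγ hr hs (by rw [hrev]; exact hrd)
        rw [hrev] at hc
        rw [hc, norm_sub_rev] at hc2
        have e1 : d ^ (1 / 2 : ℝ) = d * d ^ (-(1 / 2) : ℝ) := by
          rw [← Real.rpow_one_add' hd.le (by norm_num)]; norm_num
        rw [div_le_iff₀ hd]
        calc _ ≤ 6 * W * (d * d ^ (-(1 / 2) : ℝ)) + 2 * W * (d / r) := by
              rw [e1] at hdiff
              refine hdiff.trans ?_
              gcongr
          _ ≤ 8 * W * (d * d ^ (-(1 / 2) : ℝ)) + 8 * W * (d / r) := by gcongr <;> linarith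
          _ = _ := by ring
    have hpi : Real.pi ≤ 3.15 := Real.pi_lt_d2.le
    have hpi0 := Real.pi_pos
    have t3 : |2 * Real.pi * normalTrace φ γ t / (d + ε) -
        2 * Real.pi * normalTrace φ γ s / (d + ε)| ≤ 80 * W * (d ^ (-(1 / 2) : ℝ) + 1 / r) := by
      rw [← sub_div, ← mul_sub, abs_div, abs_mul, abs_sub_comm, abs_of_pos (by positivity),
        abs_of_pos (by positivity : 0 < d + ε)]
      calc _ ≤ 2 * Real.pi * |normalTrace φ γ s - normalTrace φ γ t| / d := by gcongr; linarith
        _ = 2 * Real.pi * (|normalTrace φ γ s - normalTrace φ γ t| / d) := by ring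
        _ ≤ 10 * (8 * W * (d ^ (-(1 / 2) : ℝ) + 1 / r)) := by
            gcongr; linarith
        _ = _ := by ring
    have t4 : d ^ (-(1 / 2) : ℝ) + 1 / r ≤ pairError ε d r := by
      unfold pairError
      have : 0 ≤ ε / (d + ε) ^ 2 := by positivity
      linarith
    calc _ ≤ C * W * pairError ε d r + 80 * W * (d ^ (-(1 / 2) : ℝ) + 1 / r) := by
          refine le_trans (le_of_eq ?_) ((abs_add_le _ _).trans (add_le_add t1 t3))
          congr 1; ring
      _ ≤ C * W * pairError ε d r + 80 * W * pairError ε d r := by gcongr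
      _ = _ := by ring

end

end VortexFilament

namespace VortexFilament

noncomputable section

/-! ### The quadratic integral as a double integral over the curve -/

open Set

variable {γ : ℝ → E3} {ρ : E3 → ℝ} {ε : ℝ}

/-- Lebesgue measure on pairs of parameters in one period. -/
abbrev pairMeasure : Measure (ℝ × ℝ) :=
  (volume.restrict (Ioc (0 : ℝ) 1)).prod (volume.restrict (Ioc (0 : ℝ) 1))

/-- The square of an integral as a double integral. -/
lemma ddot_tensor_integral {α : Type*} [MeasurableSpace α] {μ : Measure α} [SFinite μ] (A : M3)
    {f : α → E3} (hf : Integrable f μ) :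
    ddot A (tensor (∫ s, f s ∂μ) (∫ t, f t ∂μ)) =
      ∫ p : α × α, ddot A (tensor (f p.1) (f p.2)) ∂(μ.prod μ) := by
  have hi : ∀ i : Fin 3, Integrable (fun s => inner ℝ (EuclideanSpace.single i (1 : ℝ)) (f s)) μ :=
    fun i => hf.const_inner _
  have hij : ∀ i j : Fin 3, Integrable (fun p : α × α =>
      A (i, j) * (inner ℝ (EuclideanSpace.single i (1 : ℝ)) (f p.1) *
        inner ℝ (EuclideanSpace.single j (1 : ℝ)) (f p.2))) (μ.prod μ) := fun i j =>
    ((hi i).mul_prod (hi j)).const_mul _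
  simp_rw [ddot_tensor_eq_sum]
  rw [integral_finsetSum _ fun i _ => integrable_finsetSum _ fun j _ => hij i j]
  refine Finset.sum_congr rfl fun i _ => ?_
  rw [integral_finsetSum _ fun j _ => hij i j]
  refine Finset.sum_congr rfl fun j _ => ?_
  rw [integral_const_mul, integral_prod_mul (fun s => inner ℝ (EuclideanSpace.single i (1 : ℝ)) (f s))
    (fun s => inner ℝ (EuclideanSpace.single j (1 : ℝ)) (f s)), integral_inner hf, integral_inner hf]

lemma measurable_cross_kernE_comp (hρ : IsRadialMollifier ρ) (hε : 0 < ε) (hγ : IsArclengthLoop γ)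
    {α : Type*} [MeasurableSpace α] {x : α → E3} {s : α → ℝ} (hx : Measurable x)
    (hs : Measurable s) :
    Measurable fun a => cross (kernE ρ ε (γ (s a) - x a)) (deriv γ (s a)) := by
  have h1 : Measurable fun a => γ (s a) - x a := (hγ.continuous.measurable.comp hs).sub hx
  exact measurable_cross ((measurable_kernE hρ hε).comp h1) (hγ.measurable_deriv.comp hs)

lemma integrable_cross_kernE (hρ : IsRadialMollifier ρ) (hε : 0 < ε) (hγ : IsArclengthLoop γ)
    (x : E3) :
    Integrable (fun s => cross (kernE ρ ε (γ s - x)) (deriv γ s)) (volume.restrict (Ioc (0 : ℝ) 1)) := by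
  obtain ⟨C, hC, h⟩ := exists_norm_cross_kernE_le hρ
  have hm : Measurable fun s => cross (kernE ρ ε (γ s - x)) (deriv γ s) :=
    measurable_cross_kernE_comp hρ hε hγ measurable_const measurable_id
  refine Integrable.mono' (g := fun _ => C * (ε ^ 2)⁻¹) (integrable_const _)
    hm.aestronglyMeasurable (.of_forall fun s => (h γ hγ ε hε x s).trans ?_)
  unfold reg
  gcongr
  linarith [norm_nonneg (γ s - x)]

lemma ddot_smul_smul (A : M3) (c : ℝ) (a b : E3) :
    ddot A (tensor (c • a) (c • b)) = c ^ 2 * ddot A (tensor a b) := by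
  simp only [ddot, tensor_apply, PiLp.smul_apply, smul_eq_mul, Finset.mul_sum]
  refine Finset.sum_congr rfl fun i _ => Finset.sum_congr rfl fun j _ => ?_
  ring

lemma ddot_prototypeField (hρ : IsRadialMollifier ρ) (hε : 0 < ε) (hγ : IsArclengthLoop γ)
    (A : M3) (x : E3) :
    ddot A (tensor (prototypeField ρ ε γ x) (prototypeField ρ ε γ x)) =
      (1 / (4 * Real.pi)) ^ 2 * ∫ p : ℝ × ℝ, ddot A
        (tensor (cross (kernE ρ ε (γ p.1 - x)) (deriv γ p.1))
          (cross (kernE ρ ε (γ p.2 - x)) (deriv γ p.2))) ∂pairMeasure := by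
  rw [prototypeField_eq hρ hε hγ, ddot_smul_smul,
    ddot_tensor_integral A (integrable_cross_kernE hρ hε hγ x)]

lemma exists_integral_norm_ddot_le (hρ : IsRadialMollifier ρ) (hε : 0 < ε)
    {φ : E3 → M3} {W : ℝ} (hφ : Measurable φ) (hW : ∀ x, ‖φ x‖ ≤ W) :
    ∃ C : ℝ, ∀ a b τ σ : E3, ‖τ‖ ≤ 1 → ‖σ‖ ≤ 1 → ∫ x, ‖ddot (φ x)
      (tensor (cross (kernE ρ ε (a - x)) τ) (cross (kernE ρ ε (b - x)) σ))‖ ≤ C := by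
  obtain ⟨C, hC, h⟩ := exists_abs_ddot_tensor_le hρ
  obtain ⟨C', hC', h'⟩ := exists_integral_reg_mul_reg_le
  have hW0 : 0 ≤ W := (norm_nonneg _).trans (hW 0)
  refine ⟨C * W * (C' / ε), fun a b τ σ hτ hσ => ?_⟩
  have hi := integrable_reg_mul_reg hε a b
  calc _ ≤ ∫ x, C * W * (reg ε (a - x) * reg ε (b - x)) := by
        refine integral_mono (integrable_interaction hρ hε hφ hW hτ hσ a b).norm
          (hi.const_mul _) fun x => ?_
        refine (h ε hε _ _ _ _ _ x hτ hσ).trans ?_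
        have := hW x
        have := mul_nonneg (reg_nonneg ε (a - x)) (reg_nonneg ε (b - x))
        gcongr
    _ ≤ C * W * (C' / (‖a - b‖ + ε)) := by
        rw [integral_const_mul]
        gcongr
        exact h' ε hε _ _
    _ ≤ _ := by
        gcongr
        linarith [norm_nonneg (a - b)]

lemma integrable_ddot_cross_kernE (hρ : IsRadialMollifier ρ) (hε : 0 < ε) (hγ : IsArclengthLoop γ)
    {φ : E3 → M3} {W : ℝ} (hφ : Measurable φ) (hW : ∀ x, ‖φ x‖ ≤ W) :
    Integrable (fun z : E3 × (ℝ × ℝ) => ddot (φ z.1)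
      (tensor (cross (kernE ρ ε (γ z.2.1 - z.1)) (deriv γ z.2.1))
        (cross (kernE ρ ε (γ z.2.2 - z.1)) (deriv γ z.2.2)))) (volume.prod pairMeasure) := by
  obtain ⟨C, h⟩ := exists_integral_norm_ddot_le hρ hε hφ hW
  have f1 : Measurable fun z : E3 × (ℝ × ℝ) =>
      cross (kernE ρ ε (γ z.2.1 - z.1)) (deriv γ z.2.1) :=
    measurable_cross_kernE_comp (x := fun z : E3 × (ℝ × ℝ) => z.1)
      (s := fun z : E3 × (ℝ × ℝ) => z.2.1) hρ hε hγ measurable_fst measurable_snd.fst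
  have f2 : Measurable fun z : E3 × (ℝ × ℝ) =>
      cross (kernE ρ ε (γ z.2.2 - z.1)) (deriv γ z.2.2) :=
    measurable_cross_kernE_comp (x := fun z : E3 × (ℝ × ℝ) => z.1)
      (s := fun z : E3 × (ℝ × ℝ) => z.2.2) hρ hε hγ measurable_fst measurable_snd.snd
  have f3 : Measurable fun z : E3 × (ℝ × ℝ) => φ z.1 := hφ.comp measurable_fst
  have hm := (measurable_ddot_tensor f3 f1 f2).aestronglyMeasurable (μ := volume.prod pairMeasure)
  refine (integrable_prod_iff' hm).2 ⟨?_, ?_⟩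
  · refine .of_forall fun p => ?_
    exact integrable_interaction hρ hε hφ hW (hγ.norm_deriv_le p.1) (hγ.norm_deriv_le p.2)
      (γ p.1) (γ p.2)
  · refine Integrable.mono' (g := fun _ => C) (integrable_const C)
      hm.norm.prod_swap.integral_prod_right' (.of_forall fun p => ?_)
    have hp := h (γ p.1) (γ p.2) (deriv γ p.1) (deriv γ p.2) (hγ.norm_deriv_le p.1)
      (hγ.norm_deriv_le p.2)
    refine (le_of_eq ?_).trans hp
    exact Real.norm_of_nonneg (integral_nonneg fun x => norm_nonneg _)

/-- The double integral of the interaction, by Fubini's theorem. -/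
lemma integral_ddot_prototypeField (hρ : IsRadialMollifier ρ) (hε : 0 < ε)
    (hγ : IsArclengthLoop γ) {φ : E3 → M3} {W : ℝ} (hφ : Measurable φ) (hW : ∀ x, ‖φ x‖ ≤ W) :
    Integrable (fun x => ddot (φ x) (tensor (prototypeField ρ ε γ x) (prototypeField ρ ε γ x))) ∧
    Integrable (fun p : ℝ × ℝ => interaction ρ ε φ (γ p.1) (γ p.2) (deriv γ p.1) (deriv γ p.2))
      pairMeasure ∧
    (4 * Real.pi) ^ 2 *
      ∫ x, ddot (φ x) (tensor (prototypeField ρ ε γ x) (prototypeField ρ ε γ x)) =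
      ∫ p : ℝ × ℝ, interaction ρ ε φ (γ p.1) (γ p.2) (deriv γ p.1) (deriv γ p.2) ∂pairMeasure := by
  have hi := integrable_ddot_cross_kernE hρ hε hγ hφ hW
  have e : (fun x => ddot (φ x) (tensor (prototypeField ρ ε γ x) (prototypeField ρ ε γ x))) =
      fun x => (1 / (4 * Real.pi)) ^ 2 * ∫ p : ℝ × ℝ, ddot (φ x)
        (tensor (cross (kernE ρ ε (γ p.1 - x)) (deriv γ p.1))
          (cross (kernE ρ ε (γ p.2 - x)) (deriv γ p.2))) ∂pairMeasure :=
    funext fun x => ddot_prototypeField hρ hε hγ (φ x) x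
  have h1 := hi.integral_prod_left
  have h2 := hi.integral_prod_right
  have h3 := integral_integral_swap (f := fun (x : E3) (p : ℝ × ℝ) => ddot (φ x)
        (tensor (cross (kernE ρ ε (γ p.1 - x)) (deriv γ p.1))
          (cross (kernE ρ ε (γ p.2 - x)) (deriv γ p.2)))) hi
  rw [e]
  refine ⟨h1.const_mul ((1 / (4 * Real.pi)) ^ 2), h2, ?_⟩
  rw [integral_const_mul, h3, ← mul_assoc, ← mul_pow,
    mul_one_div_cancel (by positivity), one_pow, one_mul]
  rfl

lemma ddot_idMatrix_tensor_self (a : E3) : ddot idMatrix (tensor a a) = ‖a‖ ^ 2 := by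
  rw [norm_sq_eq_sum]
  simp [ddot, idMatrix, Fin.sum_univ_three]
  ring

lemma memLp_two_prototypeField (hρ : IsRadialMollifier ρ) (hε : 0 < ε) (hγ : IsArclengthLoop γ) :
    MemLp (prototypeField ρ ε γ) 2 volume := by
  rw [memLp_two_iff_integrable_sq_norm (measurable_prototypeField hρ hε hγ).aestronglyMeasurable]
  -- The identity matrix as coefficient gives the squared norm.
  have := (integral_ddot_prototypeField hρ hε hγ (φ := fun _ => idMatrix) measurable_const
    (fun _ => le_rfl)).1
  simpa only [ddot_idMatrix_tensor_self] using this

/-! ### Integrals over the circle -/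

/-- A function of the distance on the circle is integrated over both arcs of length `1 / 2`. -/
lemma lintegral_norm_coe_sub (s : ℝ) {G : ℝ → ENNReal} (hG : Measurable G) :
    ∫⁻ t in Ioc (0 : ℝ) 1, G ‖((t - s : ℝ) : UnitAddCircle)‖ =
      2 * ∫⁻ h in Ioc (0 : ℝ) (1 / 2), G h := by
  have h1 : ∫⁻ t in Ioc (0 : ℝ) 1, G ‖((t - s : ℝ) : UnitAddCircle)‖ =
      ∫⁻ b : UnitAddCircle, G ‖b‖ := by
    have := UnitAddCircle.lintegral_preimage 0 fun b : UnitAddCircle => G ‖b - (s : UnitAddCircle)‖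
    rw [zero_add] at this
    rw [lintegral_sub_right_eq_self (fun b : UnitAddCircle => G ‖b‖)] at this
    rw [← this]
    rfl
  have h2 := UnitAddCircle.lintegral_preimage (-(1 / 2)) fun b : UnitAddCircle => G ‖b‖
  rw [h1, ← h2, show -(1 / 2 : ℝ) + 1 = 1 / 2 by norm_num,
    ← Ioc_union_Ioc_eq_Ioc (b := 0) (by norm_num) (by norm_num),
    lintegral_union measurableSet_Ioc (by
      rw [Set.disjoint_left]; rintro x hx hx'; exact absurd hx.2 (not_le.2 hx'.1))]
  have hpos : ∫⁻ h in Ioc (0 : ℝ) (1 / 2), G ‖((h : ℝ) : UnitAddCircle)‖ =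
      ∫⁻ h in Ioc (0 : ℝ) (1 / 2), G h := by
    refine setLIntegral_congr_fun measurableSet_Ioc fun h hh => ?_
    rw [norm_coe_unitAddCircle_eq (by rw [abs_of_pos hh.1]; exact hh.2), abs_of_pos hh.1]
  have hneg : ∫⁻ h in Ioc (-(1 / 2) : ℝ) 0, G ‖((h : ℝ) : UnitAddCircle)‖ =
      ∫⁻ h in Ioc (0 : ℝ) (1 / 2), G h := by
    have e := (Measure.measurePreserving_neg (volume : Measure ℝ)).setLIntegral_comp_preimage
      (s := Ioc (-(1 / 2) : ℝ) 0) measurableSet_Ioc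
      (f := fun h : ℝ => G ‖((h : ℝ) : UnitAddCircle)‖) (by
        exact hG.comp (measurable_norm.comp AddCircle.measurable_mk'))
    rw [← e, ← hpos]
    simp only [neg_preimage, neg_Ioc, neg_zero, neg_neg, AddCircle.coe_neg, norm_neg]
    exact setLIntegral_congr Ico_ae_eq_Ioc
  rw [hpos, hneg, two_mul]

lemma integral_one_div_add (hε : 0 < ε) :
    ∫⁻ h in Ioc (0 : ℝ) (1 / 2), ENNReal.ofReal (1 / (h + ε)) =
      ENNReal.ofReal (Real.log ((1 / 2 + ε) / ε)) := by
  have hc : ContinuousOn (fun h : ℝ => 1 / (h + ε)) (uIcc 0 (1 / 2)) := by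
    rw [uIcc_of_le (by norm_num)]
    exact continuousOn_const.div (by fun_prop) fun h hh => by linarith [hh.1]
  rw [← ofReal_integral_eq_lintegral_ofReal]
  · rw [← intervalIntegral.integral_of_le (by norm_num)]
    rw [intervalIntegral.integral_comp_add_right (fun h : ℝ => 1 / h), zero_add,
      integral_one_div_of_pos hε (by linarith)]
  · exact (intervalIntegrable_iff_integrableOn_Ioc_of_le (by norm_num)).1 hc.intervalIntegrable
  · refine (ae_restrict_iff' measurableSet_Ioc).2 (.of_forall fun h hh => ?_)
    have := hh.1
    simp only [Pi.zero_apply]; positivity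

lemma lintegral_div_add_sq_le (hε : 0 < ε) :
    ∫⁻ h in Ioc (0 : ℝ) (1 / 2), ENNReal.ofReal (ε / (h + ε) ^ 2) ≤ 1 := by
  have hd : ∀ h ∈ uIcc (0 : ℝ) (1 / 2),
      HasDerivAt (fun h : ℝ => -(ε / (h + ε))) (ε / (h + ε) ^ 2) h := by
    intro h hh
    rw [uIcc_of_le (by norm_num)] at hh
    have h0 : h + ε ≠ 0 := by linarith [hh.1]
    refine HasDerivAt.congr_deriv (f := fun h : ℝ => -(ε / (h + ε)))
      ((((hasDerivAt_id h).add_const ε).inv h0).const_mul ε).neg ?_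
    simp only [id]
    field_simp
  have hc : ContinuousOn (fun h : ℝ => ε / (h + ε) ^ 2) (uIcc 0 (1 / 2)) := by
    rw [uIcc_of_le (by norm_num)]
    refine continuousOn_const.div (by fun_prop) fun h hh => ?_
    have := hh.1
    positivity
  rw [← ofReal_integral_eq_lintegral_ofReal]
  · rw [← intervalIntegral.integral_of_le (by norm_num),
      intervalIntegral.integral_eq_sub_of_hasDerivAt hd hc.intervalIntegrable]
    rw [← ENNReal.ofReal_one]
    refine ENNReal.ofReal_le_ofReal ?_
    rw [zero_add, div_self hε.ne']
    have : 0 ≤ ε / (1 / 2 + ε) := by positivity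
    linarith
  · exact (intervalIntegrable_iff_integrableOn_Ioc_of_le (by norm_num)).1 hc.intervalIntegrable
  · exact .of_forall fun h => by simp only [Pi.zero_apply]; positivity

lemma lintegral_rpow_neg_half_le :
    ∫⁻ h in Ioc (0 : ℝ) (1 / 2), ENNReal.ofReal (h ^ (-(1 / 2) : ℝ)) ≤ 2 := by
  rw [← ofReal_integral_eq_lintegral_ofReal]
  · rw [← intervalIntegral.integral_of_le (by norm_num), integral_rpow (Or.inl (by norm_num))]
    refine ENNReal.ofReal_le_of_le_toReal ?_
    have : (1 / 2 : ℝ) ^ (-(1 / 2) + 1 : ℝ) ≤ 1 :=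
      Real.rpow_le_one (by norm_num) (by norm_num) (by norm_num)
    rw [Real.zero_rpow (by norm_num)]
    norm_num at this ⊢
    linarith
  · exact (intervalIntegrable_iff_integrableOn_Ioc_of_le (by norm_num)).1
      (intervalIntegral.intervalIntegrable_rpow' (by norm_num))
  · refine (ae_restrict_iff' measurableSet_Ioc).2 (.of_forall fun h hh => ?_)
    have := hh.1
    simp only [Pi.zero_apply]; positivity

lemma lintegral_pairMeasure_norm_coe_sub {G : ℝ → ENNReal} (hG : Measurable G) :
    ∫⁻ p : ℝ × ℝ, G ‖((p.2 - p.1 : ℝ) : UnitAddCircle)‖ ∂pairMeasure =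
      2 * ∫⁻ h in Ioc (0 : ℝ) (1 / 2), G h := by
  have hm : Measurable fun p : ℝ × ℝ => G ‖((p.2 - p.1 : ℝ) : UnitAddCircle)‖ :=
    hG.comp (measurable_norm.comp (AddCircle.measurable_mk'.comp (by fun_prop)))
  rw [lintegral_prod _ hm.aemeasurable]
  simp only [lintegral_norm_coe_sub _ hG]
  simp

end

end VortexFilament

namespace VortexFilament

noncomputable section

/-! ### The energy and the limit of the quadratic integrals -/

open Set

variable {γ : ℝ → E3} {ρ : E3 → ℝ} {ε : ℝ}

lemma measurable_normalTrace (hγ : IsArclengthLoop γ) {φ : E3 → M3} (hφ : Measurable φ) :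
    Measurable (normalTrace φ γ) := by
  have h1 : Measurable fun s => φ (γ s) := hφ.comp hγ.continuous.measurable
  have hd := hγ.measurable_deriv
  have h2 : Measurable fun s => tensor (deriv γ s) (deriv γ s) := by
    simp_rw [← tensorL_apply]
    exact tensorL.continuous₂.measurable.comp (hd.prodMk hd)
  have h3 : Measurable fun s => idMatrix - tensor (deriv γ s) (deriv γ s) :=
    measurable_const.sub h2
  unfold normalTrace
  simp_rw [ddot_eq_inner]
  exact h1.inner h3

lemma measurable_norm_coe_sub : Measurable fun p : ℝ × ℝ => ‖((p.2 - p.1 : ℝ) : UnitAddCircle)‖ :=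
  measurable_norm.comp (AddCircle.measurable_mk'.comp (by fun_prop))

/-- The total weight of the pairwise errors. -/
lemma lintegral_pairError_le (hγ : IsArclengthLoop γ) (hε : 0 < ε) :
    ∫⁻ p : ℝ × ℝ, (ENNReal.ofReal (ε / (‖((p.2 - p.1 : ℝ) : UnitAddCircle)‖ + ε) ^ 2) +
      ENNReal.ofReal (‖((p.2 - p.1 : ℝ) : UnitAddCircle)‖ ^ (-(1 / 2) : ℝ)) +
      (1 + 2 * pairKappa γ p.1 p.2)) ∂pairMeasure ≤ 6 * kappaNorm γ ^ 2 := by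
  have hG1 : Measurable fun h : ℝ => ENNReal.ofReal (ε / (h + ε) ^ 2) := by fun_prop
  have hG2 : Measurable fun h : ℝ => ENNReal.ofReal (h ^ (-(1 / 2) : ℝ)) := by fun_prop
  have hD := measurable_norm_coe_sub
  have m1 : Measurable fun p : ℝ × ℝ =>
      ENNReal.ofReal (ε / (‖((p.2 - p.1 : ℝ) : UnitAddCircle)‖ + ε) ^ 2) := hG1.comp hD
  have m2 : Measurable fun p : ℝ × ℝ =>
      ENNReal.ofReal (‖((p.2 - p.1 : ℝ) : UnitAddCircle)‖ ^ (-(1 / 2) : ℝ)) := hG2.comp hD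
  have m12 : Measurable fun p : ℝ × ℝ =>
      ENNReal.ofReal (ε / (‖((p.2 - p.1 : ℝ) : UnitAddCircle)‖ + ε) ^ 2) +
      ENNReal.ofReal (‖((p.2 - p.1 : ℝ) : UnitAddCircle)‖ ^ (-(1 / 2) : ℝ)) := m1.add m2
  rw [lintegral_add_left m12, lintegral_add_left m1,
    lintegral_add_left measurable_const, lintegral_const_mul _ (measurable_pairKappa γ),
    lintegral_pairMeasure_norm_coe_sub hG1, lintegral_pairMeasure_norm_coe_sub hG2]
  have e1 := lintegral_div_add_sq_le hε
  have e2 := lintegral_rpow_neg_half_le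
  have e3 := lintegral_pairKappa_le γ
  have e4 : ∫⁻ _ : ℝ × ℝ, 1 ∂pairMeasure = 1 := by
    rw [lintegral_one, ← univ_prod_univ, Measure.prod_prod]
    simp
  rw [e4]
  have hK := two_le_kappaNorm hγ
  -- As `2 ≤ kappaNorm γ`, the terms of order one are absorbed by the term of the curvature.
  have h7 : (7 : ENNReal) ≤ 2 * kappaNorm γ ^ 2 := by
    calc (7 : ENNReal) ≤ 2 * 2 ^ 2 := by norm_num
      _ ≤ _ := by gcongr
  calc _ ≤ 2 * 1 + 2 * 2 + (1 + 2 * (2 * kappaNorm γ ^ 2)) := by gcongr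
    _ = 7 + 4 * kappaNorm γ ^ 2 := by ring
    _ ≤ 2 * kappaNorm γ ^ 2 + 4 * kappaNorm γ ^ 2 := by gcongr
    _ = _ := by ring

lemma ofReal_pairError_le {d r : ℝ} {κ : ENNReal} (hε : 0 < ε) (hd : 0 ≤ d) (hr : 0 < r)
    (h : ENNReal.ofReal (1 / r) ≤ κ) : ENNReal.ofReal (pairError ε d r) ≤
      ENNReal.ofReal (ε / (d + ε) ^ 2) + ENNReal.ofReal (d ^ (-(1 / 2) : ℝ)) + κ := by
  unfold pairError
  rw [ENNReal.ofReal_add (by positivity) (by positivity),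
    ENNReal.ofReal_add (by positivity) (by positivity)]
  gcongr

lemma ae_pairMeasure (P : ℝ → Prop) (h : ∀ᵐ s ∂(volume.restrict (Ioc (0 : ℝ) 1)), P s) :
    (∀ᵐ p ∂pairMeasure, P p.1) ∧ ∀ᵐ p ∂pairMeasure, P p.2 :=
  ⟨Measure.quasiMeasurePreserving_fst.ae h, Measure.quasiMeasurePreserving_snd.ae h⟩

lemma ae_pairMeasure_norm_pos :
    ∀ᵐ p ∂pairMeasure, 0 < ‖((p.2 - p.1 : ℝ) : UnitAddCircle)‖ := by
  have h := lintegral_pairMeasure_norm_coe_sub (G := ({0} : Set ℝ).indicator fun _ => 1)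
    (measurable_const.indicator (measurableSet_singleton 0))
  have h0 : ∫⁻ h in Ioc (0 : ℝ) (1 / 2), ({0} : Set ℝ).indicator (fun _ => (1 : ENNReal)) h = 0 := by
    rw [lintegral_indicator_const (measurableSet_singleton 0)]
    simp
  have hm : Measurable fun p : ℝ × ℝ =>
      ({0} : Set ℝ).indicator (fun _ => (1 : ENNReal)) ‖((p.2 - p.1 : ℝ) : UnitAddCircle)‖ :=
    (measurable_const.indicator (measurableSet_singleton 0)).comp measurable_norm_coe_sub
  rw [h0, mul_zero, lintegral_eq_zero_iff hm] at h
  filter_upwards [h] with p hp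
  refine (norm_nonneg _).lt_of_ne' fun h0 => ?_
  rw [h0, indicator_of_mem (mem_singleton 0)] at hp
  exact one_ne_zero hp

/-- The leading part of the double integral. The integral of the inverse distance over the circle,
regularised at scale `ε`, produces the logarithm. -/
lemma integral_leading (hγ : IsArclengthLoop γ) (hε : 0 < ε) {φ : E3 → M3} {W : ℝ}
    (hφ : Measurable φ) (hW : ∀ x, ‖φ x‖ ≤ W) :
    Integrable (fun p : ℝ × ℝ => 2 * Real.pi * normalTrace φ γ p.1 /
      (‖((p.2 - p.1 : ℝ) : UnitAddCircle)‖ + ε)) pairMeasure ∧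
    ∫ p : ℝ × ℝ, 2 * Real.pi * normalTrace φ γ p.1 /
      (‖((p.2 - p.1 : ℝ) : UnitAddCircle)‖ + ε) ∂pairMeasure =
      4 * Real.pi * Real.log ((1 / 2 + ε) / ε) * ∫ s in Ioc (0 : ℝ) 1, normalTrace φ γ s := by
  have hm := measurable_normalTrace hγ hφ
  have hm1 : Measurable fun p : ℝ × ℝ => normalTrace φ γ p.1 := hm.comp measurable_fst
  have hW0 : 0 ≤ W := (norm_nonneg _).trans (hW 0)
  have hi : Integrable (fun p : ℝ × ℝ => 2 * Real.pi * normalTrace φ γ p.1 /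
      (‖((p.2 - p.1 : ℝ) : UnitAddCircle)‖ + ε)) pairMeasure := by
    refine Integrable.mono' (g := fun _ => 2 * Real.pi * (3 * W) / ε) (integrable_const _)
      ((hm1.const_mul _).div (measurable_norm_coe_sub.add_const ε)).aestronglyMeasurable
      (.of_forall fun p => ?_)
    have h1 := abs_normalTrace_le hγ hW p.1
    have h2 := norm_nonneg ((p.2 - p.1 : ℝ) : UnitAddCircle)
    have hpi := Real.pi_pos
    rw [Real.norm_eq_abs, abs_div, abs_mul, abs_of_pos (by positivity : 0 < 2 * Real.pi),
      abs_of_pos (by positivity : 0 < ‖((p.2 - p.1 : ℝ) : UnitAddCircle)‖ + ε)]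
    gcongr
    linarith
  refine ⟨hi, ?_⟩
  have hcirc : ∀ s : ℝ, ∫ t in Ioc (0 : ℝ) 1, 1 / (‖((t - s : ℝ) : UnitAddCircle)‖ + ε) =
      2 * Real.log ((1 / 2 + ε) / ε) := by
    intro s
    have hms : Measurable fun t : ℝ => ‖((t - s : ℝ) : UnitAddCircle)‖ :=
      measurable_norm.comp (AddCircle.measurable_mk'.comp (by fun_prop))
    have hmd : Measurable fun t : ℝ => 1 / (‖((t - s : ℝ) : UnitAddCircle)‖ + ε) :=
      measurable_const.div (hms.add_const ε)
    have hnn : ∀ t : ℝ, 0 ≤ 1 / (‖((t - s : ℝ) : UnitAddCircle)‖ + ε) := fun t => by positivity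
    rw [integral_eq_lintegral_of_nonneg_ae (.of_forall hnn) hmd.aestronglyMeasurable,
      lintegral_norm_coe_sub s (G := fun h => ENNReal.ofReal (1 / (h + ε))) (by fun_prop),
      integral_one_div_add hε, ENNReal.toReal_mul, ENNReal.toReal_ofReal]
    · simp
    · refine Real.log_nonneg ?_
      rw [le_div_iff₀ hε]; linarith
  rw [integral_prod _ hi]
  have : ∀ s, ∫ t in Ioc (0 : ℝ) 1, 2 * Real.pi * normalTrace φ γ s /
      (‖((t - s : ℝ) : UnitAddCircle)‖ + ε) =
      4 * Real.pi * Real.log ((1 / 2 + ε) / ε) * normalTrace φ γ s := by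
    intro s
    simp_rw [div_eq_mul_one_div (2 * Real.pi * normalTrace φ γ s)]
    rw [integral_const_mul, hcirc]
    ring
  simp only [this]
  rw [integral_const_mul]

/-- Integration of the pairwise comparison over all pairs of points. -/
lemma exists_abs_integral_interaction_sub_le (hρ : IsRadialMollifier ρ) : ∃ C : ℝ, 0 ≤ C ∧
    ∀ γ : ℝ → E3, IsArclengthLoop γ → kappaNorm γ < ⊤ → ∀ ε : ℝ, 0 < ε →
    ∀ (φ : E3 → M3) (W : ℝ), Measurable φ →
    (∀ x, ‖φ x‖ ≤ W) → (∀ x y, ‖φ x - φ y‖ ≤ 2 * W * ‖y - x‖ ^ (1 / 2 : ℝ)) →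
    |(∫ p : ℝ × ℝ, interaction ρ ε φ (γ p.1) (γ p.2) (deriv γ p.1) (deriv γ p.2) ∂pairMeasure) -
      4 * Real.pi * Real.log ((1 / 2 + ε) / ε) * ∫ s in Ioc (0 : ℝ) 1, normalTrace φ γ s| ≤
      C * W * (kappaNorm γ).toReal ^ 2 := by
  obtain ⟨C, hC, h⟩ := exists_abs_interaction_sub_le hρ
  refine ⟨6 * C, by positivity, fun γ hγ hK ε hε φ W hφ hW hH => ?_⟩
  have hW0 : 0 ≤ W := (norm_nonneg _).trans (hW 0)
  obtain ⟨j1, j2⟩ := integral_leading hγ hε hφ hW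
  have j3 := (integral_ddot_prototypeField hρ hε hγ hφ hW).2.1
  rw [← j2, ← integral_sub j3 j1, ← Real.norm_eq_abs]
  have hle : ∀ᵐ p ∂pairMeasure, ‖interaction ρ ε φ (γ p.1) (γ p.2) (deriv γ p.1) (deriv γ p.2) -
      2 * Real.pi * normalTrace φ γ p.1 / (‖((p.2 - p.1 : ℝ) : UnitAddCircle)‖ + ε)‖ₑ ≤
      ENNReal.ofReal (C * W) *
      (ENNReal.ofReal (ε / (‖((p.2 - p.1 : ℝ) : UnitAddCircle)‖ + ε) ^ 2) +
      ENNReal.ofReal (‖((p.2 - p.1 : ℝ) : UnitAddCircle)‖ ^ (-(1 / 2) : ℝ)) +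
      (1 + 2 * pairKappa γ p.1 p.2)) := by
    obtain ⟨a1, a2⟩ := ae_pairMeasure _ (ae_restrict_of_ae hγ.speed)
    obtain ⟨a3, a4⟩ := ae_pairMeasure _ (ae_restrict_mem (μ := volume)
      (measurableSet_Ioc (a := (0 : ℝ)) (b := 1)))
    obtain ⟨a5, -⟩ := ae_pairMeasure _ (ae_kappaStar_lt_top hK)
    filter_upwards [a1, a2, a3, a4, a5, ae_pairMeasure_norm_pos] with p p1 p2 p3 p4 p5 p6
    obtain ⟨r, hr, hrk, hsec⟩ := exists_isSecure_or p3 p4 p5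
    have key := h γ hγ ε hε φ W hφ hW hH p.1 p.2 r p1 p2 p6 hr hsec
    rw [← ofReal_norm, Real.norm_eq_abs]
    refine (ENNReal.ofReal_le_ofReal key).trans ?_
    rw [ENNReal.ofReal_mul (by positivity)]
    exact mul_le_mul_right (ofReal_pairError_le hε p6.le hr hrk) _
  have htot : ‖∫ p, (interaction ρ ε φ (γ p.1) (γ p.2) (deriv γ p.1) (deriv γ p.2) -
      2 * Real.pi * normalTrace φ γ p.1 / (‖((p.2 - p.1 : ℝ) : UnitAddCircle)‖ + ε))
      ∂pairMeasure‖ₑ ≤ ENNReal.ofReal (C * W) * (6 * kappaNorm γ ^ 2) := by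
    refine (enorm_integral_le_lintegral_enorm _).trans ((lintegral_mono_ae hle).trans ?_)
    rw [lintegral_const_mul' _ _ ENNReal.ofReal_ne_top]
    exact mul_le_mul_right (lintegral_pairError_le hγ hε) _
  rw [← ofReal_norm] at htot
  have hfin : ENNReal.ofReal (C * W) * (6 * kappaNorm γ ^ 2) ≠ ⊤ :=
    ENNReal.mul_ne_top ENNReal.ofReal_ne_top
      (ENNReal.mul_ne_top (by simp) (ENNReal.pow_ne_top hK.ne))
  refine ((ENNReal.ofReal_le_iff_le_toReal hfin).1 htot).trans (le_of_eq ?_)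
  rw [ENNReal.toReal_mul, ENNReal.toReal_mul, ENNReal.toReal_pow,
    ENNReal.toReal_ofReal (by positivity)]
  simp
  ring

/-- The logarithm of the double integral lies within `log 2` of `|log ε|`. -/
lemma abs_log_sub_le (hε : 0 < ε) (hε2 : ε < 1 / 2) :
    abs (Real.log ((1 / 2 + ε) / ε) - |Real.log ε|) ≤ 1 := by
  rw [abs_of_neg (Real.log_neg hε (by linarith)), Real.log_div (by linarith) hε.ne']
  rw [show Real.log (1 / 2 + ε) - Real.log ε - -Real.log ε = Real.log (1 / 2 + ε) by ring]
  have h1 : Real.log (1 / 2 + ε) ≤ 0 := Real.log_nonpos (by linarith) (by linarith)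
  have h2 : Real.log (1 / 2) ≤ Real.log (1 / 2 + ε) := Real.log_le_log (by norm_num) (by linarith)
  rw [Real.log_div one_ne_zero two_ne_zero, Real.log_one] at h2
  have h3 := Real.log_two_lt_d9
  rw [abs_of_nonpos h1]
  linarith

/-- The quadratic integral, up to an error of order one. -/
lemma exists_abs_integral_ddot_sub_le (hρ : IsRadialMollifier ρ) : ∃ C : ℝ, 0 ≤ C ∧
    ∀ γ : ℝ → E3, IsArclengthLoop γ → kappaNorm γ < ⊤ → ∀ ε : ℝ, 0 < ε → ε < 1 / 2 →
    ∀ (φ : E3 → M3) (W : ℝ), Measurable φ →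
    (∀ x, ‖φ x‖ ≤ W) → (∀ x y, ‖φ x - φ y‖ ≤ 2 * W * ‖y - x‖ ^ (1 / 2 : ℝ)) →
    |4 * Real.pi *
      (∫ x, ddot (φ x) (tensor (prototypeField ρ ε γ x) (prototypeField ρ ε γ x))) -
      |Real.log ε| * ∫ s in Ioc (0 : ℝ) 1, normalTrace φ γ s| ≤
      C * ((kappaNorm γ).toReal ^ 2 * W) := by
  obtain ⟨C, hC, h⟩ := exists_abs_integral_interaction_sub_le hρ
  refine ⟨C + 3, by positivity, fun γ hγ hK ε hε hε2 φ W hφ hW hH => ?_⟩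
  have hW0 : 0 ≤ W := (norm_nonneg _).trans (hW 0)
  have key := h γ hγ hK ε hε φ W hφ hW hH
  rw [← (integral_ddot_prototypeField hρ hε hγ hφ hW).2.2] at key
  have hf : |∫ s in Ioc (0 : ℝ) 1, normalTrace φ γ s| ≤ 3 * W := by
    have := norm_setIntegral_le_of_norm_le_const (μ := volume) (s := Ioc (0 : ℝ) 1) (by simp)
      fun s _ => (Real.norm_eq_abs _).trans_le (abs_normalTrace_le hγ hW s)
    simpa using this
  have hK2 : (2 : ℝ) ≤ (kappaNorm γ).toReal := by
    have := ENNReal.toReal_mono hK.ne (two_le_kappaNorm hγ)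
    simpa using this
  have hlog := abs_log_sub_le hε hε2
  generalize ∫ x, ddot (φ x) (tensor (prototypeField ρ ε γ x) (prototypeField ρ ε γ x)) = I at *
  generalize ∫ s in Ioc (0 : ℝ) 1, normalTrace φ γ s = J at *
  generalize Real.log ((1 / 2 + ε) / ε) = L at *
  generalize |Real.log ε| = Λ at *
  have hpi := Real.pi_gt_three
  have e1 : (4 * Real.pi) ^ 2 * I - 4 * Real.pi * L * J =
      4 * Real.pi * (4 * Real.pi * I - L * J) := by ring
  rw [e1, abs_mul, abs_of_pos (by positivity)] at key
  -- Division by `4 * π ≥ 1` only improves the bound.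
  have t1 : |4 * Real.pi * I - L * J| ≤ C * W * (kappaNorm γ).toReal ^ 2 := by
    nlinarith [abs_nonneg (4 * Real.pi * I - L * J)]
  have t2 : |(L - Λ) * J| ≤ 3 * W * (kappaNorm γ).toReal ^ 2 := by
    rw [abs_mul]
    calc _ ≤ 1 * (3 * W) := mul_le_mul hlog hf (abs_nonneg _) zero_le_one
      _ ≤ _ := by
        rw [one_mul]
        exact le_mul_of_one_le_right (by positivity) (by nlinarith)
  calc _ ≤ |4 * Real.pi * I - L * J| + |(L - Λ) * J| := by
        refine le_trans (le_of_eq ?_) (abs_add_le _ _)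
        congr 1; ring
    _ ≤ _ := add_le_add t1 t2
    _ = _ := by ring

lemma exists_abs_energy_sub_le (hρ : IsRadialMollifier ρ) :
    ∃ C : ℝ, ∀ γ : ℝ → E3, IsArclengthLoop γ → kappaNorm γ < ⊤ → ∀ ε : ℝ, 0 < ε → ε < 1 / 2 →
      MemLp (prototypeField ρ ε γ) 2 volume ∧
      |(∫ x, ‖prototypeField ρ ε γ x‖ ^ 2) - (|Real.log ε| / (2 * Real.pi))|
          ≤ C * (kappaNorm γ).toReal ^ 2 := by
  obtain ⟨C, hC, h⟩ := exists_abs_integral_ddot_sub_le hρ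
  refine ⟨C * ‖idMatrix‖, fun γ hγ hK ε hε hε2 => ⟨memLp_two_prototypeField hρ hε hγ, ?_⟩⟩
  have key := h γ hγ hK ε hε hε2 (fun _ => idMatrix) ‖idMatrix‖ measurable_const (fun _ => le_rfl)
    (fun x y => by rw [sub_self, norm_zero]; positivity)
  simp_rw [ddot_idMatrix_tensor_self] at key
  -- The trace of `I - τ ⊗ τ` is `2`.
  have hJ : ∫ s in Ioc (0 : ℝ) 1, normalTrace (fun _ => idMatrix) γ s = 2 := by
    have : ∀ᵐ s ∂(volume.restrict (Ioc (0 : ℝ) 1)),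
        normalTrace (fun _ => idMatrix) γ s = (2 : ℝ) := by
      filter_upwards [ae_restrict_of_ae hγ.speed] with s hs
      have e : ddot idMatrix (idMatrix - tensor (deriv γ s) (deriv γ s)) =
          ddot idMatrix idMatrix - ‖deriv γ s‖ ^ 2 := by
        rw [← ddot_idMatrix_tensor_self]
        simp only [ddot_eq_inner, inner_sub_right]
      rw [normalTrace, e, hs]
      simp [ddot, idMatrix]
      norm_num
    rw [integral_congr_ae this]
    simp
  rw [hJ] at key
  generalize ∫ x, ‖prototypeField ρ ε γ x‖ ^ 2 = I at *
  have hpi := Real.pi_gt_three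
  have e : 4 * Real.pi * I - |Real.log ε| * 2 =
      4 * Real.pi * (I - |Real.log ε| / (2 * Real.pi)) := by field_simp; ring
  rw [e, abs_mul, abs_of_pos (by positivity)] at key
  nlinarith [abs_nonneg (I - |Real.log ε| / (2 * Real.pi))]

end

end VortexFilament

namespace VortexFilament

noncomputable section

/-! ### Regularity of functions in `W^{1,∞}` -/

open Set

open scoped Convolution

variable {φ : E3 → M3} {g : E3 → E3 →L[ℝ] M3}

lemma IsW1Infty.ae_norm_le (h : IsW1Infty φ g) : ∀ᵐ x, ‖φ x‖ ≤ (eLpNorm φ ⊤ volume).toReal := by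
  have h1 := ae_le_eLpNormEssSup (f := φ) (μ := volume)
  filter_upwards [h1] with x hx
  rw [← eLpNorm_exponent_top, ← ofReal_norm] at hx
  exact (ENNReal.ofReal_le_iff_le_toReal h.memLp.eLpNorm_lt_top.ne).1 hx

lemma IsW1Infty.ae_norm_grad_le (h : IsW1Infty φ g) :
    ∀ᵐ x, ‖g x‖ ≤ (eLpNorm g ⊤ volume).toReal := by
  have h1 := ae_le_eLpNormEssSup (f := g) (μ := volume)
  filter_upwards [h1] with x hx
  rw [← eLpNorm_exponent_top, ← ofReal_norm] at hx
  exact (ENNReal.ofReal_le_iff_le_toReal h.memLp_grad.eLpNorm_lt_top.ne).1 hx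

/-- A continuous function is bounded everywhere by its essential supremum. -/
lemma IsW1Infty.norm_le (h : IsW1Infty φ g) (x : E3) : ‖φ x‖ ≤ (eLpNorm φ ⊤ volume).toReal := by
  have ho : IsOpen {x | (eLpNorm φ ⊤ volume).toReal < ‖φ x‖} :=
    isOpen_lt continuous_const h.continuous.norm
  have h0 : volume {x | (eLpNorm φ ⊤ volume).toReal < ‖φ x‖} = 0 := by
    have := h.ae_norm_le
    rw [ae_iff] at this
    simpa only [not_le] using this
  have he := (ho.measure_eq_zero_iff volume).1 h0
  by_contra! hx
  have : x ∈ ({x | (eLpNorm φ ⊤ volume).toReal < ‖φ x‖} : Set E3) := hx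
  rw [he] at this
  exact this

/-- The derivative of a mollification is the mollification of the weak gradient. -/
lemma IsW1Infty.fderiv_convolution_apply (h : IsW1Infty φ g) {ψ : E3 → ℝ} (hψ : ContDiff ℝ ∞ ψ)
    (hc : HasCompactSupport ψ) (x v : E3) :
    fderiv ℝ (ψ ⋆[ContinuousLinearMap.lsmul ℝ ℝ, volume] φ) x v = ∫ y, ψ (x - y) • g y v := by
  have hloc : LocallyIntegrable φ volume := h.continuous.locallyIntegrable
  have hψ1 : ContDiff ℝ 1 ψ := hψ.of_le (by exact_mod_cast le_top)
  rw [(hc.hasFDerivAt_convolution_left (ContinuousLinearMap.lsmul ℝ ℝ) hψ1 hloc x).fderiv]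
  have hex := (hc.fderiv ℝ).convolutionExists_left
    ((ContinuousLinearMap.lsmul ℝ ℝ : ℝ →L[ℝ] M3 →L[ℝ] M3).precompL E3)
    (hψ1.continuous_fderiv one_ne_zero) hloc x
  rw [convolution_def, ContinuousLinearMap.integral_apply hex]
  simp only [ContinuousLinearMap.precompL_apply, ContinuousLinearMap.lsmul_apply]
  rw [← integral_sub_left_eq_self _ volume x]
  simp only [sub_sub_cancel]
  have hw := h.weakGradient (fun y => ψ (x - y)) (hψ.comp (contDiff_const.sub contDiff_id))
    (hc.comp_homeomorph (Homeomorph.subLeft x)) v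
  have e : ∀ y, fderiv ℝ (fun y => ψ (x - y)) y v = - fderiv ℝ ψ (x - y) v := by
    intro y
    have hd : HasFDerivAt (fun y => ψ (x - y))
        ((fderiv ℝ ψ (x - y)).comp (-ContinuousLinearMap.id ℝ E3)) y := by
      have h1 : HasFDerivAt ψ (fderiv ℝ ψ (x - y)) (x - y) :=
        (hψ1.differentiable one_ne_zero _).hasFDerivAt
      exact h1.comp y ((hasFDerivAt_id y).const_sub x)
    rw [hd.fderiv]
    simp
  simp only [e, neg_smul] at hw
  rw [integral_neg, neg_inj] at hw
  exact hw

lemma IsW1Infty.norm_fderiv_convolution_le (h : IsW1Infty φ g) {ψ : E3 → ℝ}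
    (hψ : ContDiff ℝ ∞ ψ) (hc : HasCompactSupport ψ) (h0 : ∀ x, 0 ≤ ψ x) (h1 : ∫ x, ψ x = 1)
    (x : E3) : ‖fderiv ℝ (ψ ⋆[ContinuousLinearMap.lsmul ℝ ℝ, volume] φ) x‖ ≤
      (eLpNorm g ⊤ volume).toReal := by
  refine ContinuousLinearMap.opNorm_le_bound _ ENNReal.toReal_nonneg fun v => ?_
  rw [h.fderiv_convolution_apply hψ hc]
  have hi : Integrable ψ := hψ.continuous.integrable_of_hasCompactSupport hc
  have hi' : Integrable (fun y => ψ (x - y)) := hi.comp_sub_left x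
  refine (norm_integral_le_of_norm_le (hi'.mul_const ((eLpNorm g ⊤ volume).toReal * ‖v‖)) ?_).trans
    (le_of_eq ?_)
  · filter_upwards [h.ae_norm_grad_le] with y hy
    rw [norm_smul, Real.norm_of_nonneg (h0 _)]
    have := h0 (x - y)
    gcongr
    exact ((g y).le_opNorm v).trans (by gcongr)
  · rw [integral_mul_const, integral_sub_left_eq_self ψ volume x, h1, one_mul]

/-- The continuous representative is Lipschitz, as the limit of its mollifications. -/
lemma IsW1Infty.norm_sub_le (h : IsW1Infty φ g) (x y : E3) :
    ‖φ x - φ y‖ ≤ (eLpNorm g ⊤ volume).toReal * ‖x - y‖ := by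
  let b : ℕ → ContDiffBump (0 : E3) := fun n =>
    { rIn := 1 / ((n : ℝ) + 1)
      rOut := 2 * (1 / ((n : ℝ) + 1))
      rIn_pos := by positivity
      rIn_lt_rOut := by
        have : 0 < 1 / ((n : ℝ) + 1) := by positivity
        linarith }
  have hb : Filter.Tendsto (fun n => (b n).rOut) Filter.atTop (nhds 0) := by
    have := (tendsto_one_div_add_atTop_nhds_zero_nat (𝕜 := ℝ)).const_mul 2
    rwa [mul_zero] at this
  have hx := ContDiffBump.convolution_tendsto_right_of_continuous (μ := volume) hb h.continuous x
  have hy := ContDiffBump.convolution_tendsto_right_of_continuous (μ := volume) hb h.continuous y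
  refine le_of_tendsto (hx.sub hy).norm (.of_forall fun n => ?_)
  have hs : ContDiff ℝ ∞ ((b n).normed volume) := (b n).contDiff_normed
  have hc := (b n).hasCompactSupport_normed (μ := volume)
  refine Convex.norm_image_sub_le_of_norm_fderiv_le (𝕜 := ℝ) (s := univ) (fun z _ => ?_)
    (fun z _ => h.norm_fderiv_convolution_le hs hc (b n).nonneg_normed (b n).integral_normed z)
    convex_univ (mem_univ _) (mem_univ _)
  exact (hc.hasFDerivAt_convolution_left (ContinuousLinearMap.lsmul ℝ ℝ)
    (hs.of_le (by exact_mod_cast le_top)) h.continuous.locallyIntegrable z).differentiableAt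

lemma IsW1Infty.norm_le_norm (h : IsW1Infty φ g) (x : E3) : ‖φ x‖ ≤ w1InftyNorm φ g :=
  (h.norm_le x).trans (le_add_of_nonneg_right ENNReal.toReal_nonneg)

/-- A bounded Lipschitz function is Hölder continuous. The exponent `1 / 2` is enough for the
error of freezing the coefficient to be integrable along the curve, while it keeps that error
integrable in space. -/
lemma IsW1Infty.holder (h : IsW1Infty φ g) (x y : E3) :
    ‖φ x - φ y‖ ≤ 2 * w1InftyNorm φ g * ‖y - x‖ ^ (1 / 2 : ℝ) := by
  have hW0 : 0 ≤ w1InftyNorm φ g := (norm_nonneg _).trans (h.norm_le_norm 0)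
  rw [norm_sub_rev y]
  rcases le_total 1 ‖x - y‖ with h1 | h1
  · have h2 := _root_.norm_sub_le (φ x) (φ y)
    have h3 := h.norm_le_norm x
    have h4 := h.norm_le_norm y
    have h5 : 1 ≤ ‖x - y‖ ^ (1 / 2 : ℝ) := Real.one_le_rpow h1 (by norm_num)
    nlinarith
  · have h2 : ‖x - y‖ ≤ ‖x - y‖ ^ (1 / 2 : ℝ) := by
      have := Real.rpow_le_rpow_of_exponent_ge' (norm_nonneg (x - y)) h1
        (by norm_num : (0 : ℝ) ≤ 1 / 2) (by norm_num : (1 / 2 : ℝ) ≤ 1)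
      rwa [Real.rpow_one] at this
    have h3 : (eLpNorm g ⊤ volume).toReal ≤ w1InftyNorm φ g :=
      le_add_of_nonneg_left ENNReal.toReal_nonneg
    calc _ ≤ (eLpNorm g ⊤ volume).toReal * ‖x - y‖ := h.norm_sub_le x y
      _ ≤ w1InftyNorm φ g * ‖x - y‖ ^ (1 / 2 : ℝ) := by gcongr
      _ ≤ _ := by nlinarith [mul_nonneg hW0 (Real.rpow_nonneg (norm_nonneg (x - y)) (1 / 2))]

lemma exists_abs_limit_sub_le {ρ : E3 → ℝ} (hρ : IsRadialMollifier ρ) :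
    ∃ C : ℝ, ∀ γ : ℝ → E3, IsArclengthLoop γ → kappaNorm γ < ⊤ → ∀ ε : ℝ, 0 < ε → ε < 1 / 2 →
      ∀ (φ : E3 → M3) (g : E3 → E3 →L[ℝ] M3), IsW1Infty φ g →
        |4 * Real.pi / |Real.log ε| *
              (∫ x, ddot (φ x) (tensor (prototypeField ρ ε γ x) (prototypeField ρ ε γ x)))
            - ∫ s in (0 : ℝ)..1, ddot (φ (γ s)) (idMatrix - tensor (deriv γ s) (deriv γ s))|
          ≤ C * ((kappaNorm γ).toReal ^ 2 * w1InftyNorm φ g / |Real.log ε|) := by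
  obtain ⟨C, hC, h⟩ := exists_abs_integral_ddot_sub_le hρ
  refine ⟨C, fun γ hγ hK ε hε hε2 φ g hφ => ?_⟩
  have key := h γ hγ hK ε hε hε2 φ (w1InftyNorm φ g) hφ.continuous.measurable hφ.norm_le_norm
    hφ.holder
  rw [intervalIntegral.integral_of_le zero_le_one]
  unfold normalTrace at key
  have hlog : 0 < |Real.log ε| := abs_pos.2 (Real.log_neg hε (by linarith)).ne
  generalize ∫ x, ddot (φ x) (tensor (prototypeField ρ ε γ x) (prototypeField ρ ε γ x)) = I at *
  generalize ∫ s in Ioc (0 : ℝ) 1, ddot (φ (γ s)) (idMatrix - tensor (deriv γ s) (deriv γ s)) = J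
    at *
  generalize |Real.log ε| = Λ at *
  have e : 4 * Real.pi / Λ * I - J = (4 * Real.pi * I - Λ * J) / Λ := by field_simp
  rw [e, abs_div, abs_of_pos hlog, mul_div_assoc']
  gcongr

end

end VortexFilament

namespace VortexFilament

noncomputable section

/-! ### The kernel as a fundamental solution -/

open Set

variable {ρ : E3 → ℝ} {ε : ℝ} {F : Type*} [NormedAddCommGroup F] [NormedSpace ℝ F]

/-- Integration in polar coordinates. -/
lemma integral_polar [CompleteSpace F] {f : E3 → F} (hf : Integrable f) :
    ∫ x, f x = ∫ θ : Metric.sphere (0 : E3) 1, ∫ r in Ioi (0 : ℝ), r ^ 2 • f (r • (θ : E3))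
      ∂volume ∂(volume : Measure E3).toSphere := by
  have hmp := (volume : Measure E3).measurePreserving_homeomorphUnitSphereProd
  rw [finrank_E3] at hmp
  have hemb := Homeomorph.measurableEmbedding (homeomorphUnitSphereProd E3)
  let G : Metric.sphere (0 : E3) 1 × Ioi (0 : ℝ) → F := fun p => f ((p.2 : ℝ) • (p.1 : E3))
  have hG : ∀ x : ({0}ᶜ : Set E3), G (homeomorphUnitSphereProd E3 x) = f x := by
    intro x
    have hx : ‖(x : E3)‖ ≠ 0 := norm_ne_zero_iff.2 x.2
    simp only [G]
    congr 1
    simp [smul_smul, hx]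
  have hfi : Integrable (fun x : ({0}ᶜ : Set E3) => f x) (volume.comap Subtype.val) :=
    (integrableOn_iff_comap_subtypeVal (measurableSet_singleton _).compl).1 hf.integrableOn
  have hGi : Integrable G ((volume : Measure E3).toSphere.prod (Measure.volumeIoiPow 2)) := by
    rw [← hmp.integrable_comp_emb hemb]
    exact hfi.congr (.of_forall fun x => (hG x).symm)
  calc ∫ x, f x = ∫ x : ({0}ᶜ : Set E3), f x ∂(volume.comap Subtype.val) := by
        rw [integral_subtype_comap (measurableSet_singleton _).compl f,
          restrict_compl_singleton]
    _ = ∫ x : ({0}ᶜ : Set E3), G (homeomorphUnitSphereProd E3 x) ∂(volume.comap Subtype.val) := by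
        simp_rw [hG]
    _ = ∫ p, G p ∂((volume : Measure E3).toSphere.prod (Measure.volumeIoiPow 2)) :=
        hmp.integral_comp hemb G
    _ = _ := by
        rw [integral_prod _ hGi]
        refine integral_congr_ae (.of_forall fun θ => ?_)
        simp only [G, Measure.volumeIoiPow, ENNReal.ofReal]
        rw [integral_withDensity_eq_integral_smul
          ((measurable_subtype_coe.pow_const _).real_toNNReal),
          integral_subtype_comap measurableSet_Ioi
            fun r : ℝ => Real.toNNReal (r ^ 2) • f (r • (θ : E3))]
        refine setIntegral_congr_fun measurableSet_Ioi fun r hr => ?_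
        rw [NNReal.smul_def, Real.coe_toNNReal _ (by positivity)]

lemma exists_norm_le_rpow {T : E3 → F} (hT : Continuous T) (hc : HasCompactSupport T) :
    ∃ M : ℝ, 0 ≤ M ∧ ∀ z, ‖T z‖ ≤ M * (1 + ‖z‖) ^ (-2 : ℝ) := by
  have hcont : Continuous fun z => (1 + ‖z‖) ^ 2 • T z := by fun_prop
  obtain ⟨M, hM⟩ := (hc.smul_left (f := fun z : E3 => (1 + ‖z‖) ^ 2)).exists_bound_of_continuous hcont
  refine ⟨M, (norm_nonneg _).trans (hM 0), fun z => ?_⟩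
  have h1 : 0 < (1 + ‖z‖) ^ 2 := by positivity
  have := hM z
  simp only [Pi.smul_apply', norm_smul] at this
  rw [Real.norm_of_nonneg h1.le] at this
  rw [Real.rpow_neg (by positivity), Real.rpow_two, ← div_eq_mul_inv, le_div_iff₀ h1, mul_comm]
  exact this

lemma exists_integral_norm_apply_kern_le {T : E3 → E3 →L[ℝ] F} (hT : Continuous T)
    (hc : HasCompactSupport T) : ∃ C : ℝ, ∀ u : E3,
      Integrable (fun z => T z (kern (z + u))) ∧
      (‖u‖ ≤ ε → ∫ z, ‖T z (kern (z + u))‖ ≤ C) := by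
  obtain ⟨M, hM, h⟩ := exists_norm_le_rpow hT hc
  obtain ⟨C, hC, hI⟩ := exists_integral_rpow_mul_add_rpow (p := 2) (q := 2) (by norm_num)
    (by norm_num) (by norm_num)
  have hm := measurable_kern
  have hb : ∀ u z : E3, ‖T z (kern (z + u))‖ ≤
      (1 + ‖u‖) ^ 2 * M * (‖-u - z‖ ^ (-2 : ℝ) * (1 + ‖-u - z‖) ^ (-2 : ℝ)) := by
    intro u z
    have e : ‖-u - z‖ = ‖z + u‖ := by rw [← norm_neg]; congr 1; abel
    rw [e]
    have h1 : (1 + ‖z‖) ^ (-2 : ℝ) ≤ (1 + ‖u‖) ^ 2 * (1 + ‖z + u‖) ^ (-2 : ℝ) := by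
      rw [Real.rpow_neg (by positivity), Real.rpow_neg (by positivity), Real.rpow_two,
        Real.rpow_two, ← div_eq_mul_inv, inv_eq_one_div, div_le_div_iff₀ (by positivity)
        (by positivity), one_mul, ← mul_pow]
      have := norm_add_le z u
      have := norm_nonneg z
      have := norm_nonneg u
      gcongr
      nlinarith
    calc _ ≤ ‖T z‖ * ‖kern (z + u)‖ := (T z).le_opNorm _
      _ ≤ (M * ((1 + ‖u‖) ^ 2 * (1 + ‖z + u‖) ^ (-2 : ℝ))) * ‖z + u‖ ^ (-2 : ℝ) := by
          rw [norm_kern]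
          gcongr
          exact (h z).trans (by gcongr)
      _ = _ := by ring
  have hmeas : ∀ u, AEStronglyMeasurable (fun z => T z (kern (z + u))) volume := by
    intro u
    have h1 : Measurable fun z : E3 => kern (z + u) := hm.comp (by fun_prop)
    exact (ContinuousLinearMap.apply ℝ F).flip.aestronglyMeasurable_comp₂
      hT.aestronglyMeasurable h1.aestronglyMeasurable
  refine ⟨(1 + ε) ^ 2 * M * C, fun u => ?_⟩
  obtain ⟨i1, i2⟩ := hI 1 one_pos (-u)
  have hi : Integrable (fun z => T z (kern (z + u))) :=
    (i1.const_mul ((1 + ‖u‖) ^ 2 * M)).mono' (hmeas u) (.of_forall (hb u))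
  refine ⟨hi, fun hu => (integral_mono hi.norm (i1.const_mul _) (hb u)).trans ?_⟩
  rw [integral_const_mul, i2, Real.one_rpow, mul_one]
  gcongr

/-- The divergence of `kern` is `4π` times the Dirac mass at the origin: along every ray, the
integrand is the derivative of `g`. -/
lemma integral_fderiv_kern [CompleteSpace F] {g : E3 → F} (hg : ContDiff ℝ 1 g)
    (hc : HasCompactSupport g) : ∫ z, fderiv ℝ g z (kern z) = -((4 * Real.pi) • g 0) := by
  have hi : Integrable (fun z => fderiv ℝ g z (kern z)) := by
    obtain ⟨C, h⟩ := exists_integral_norm_apply_kern_le (ε := 0)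
      (hg.continuous_fderiv one_ne_zero) (hc.fderiv ℝ)
    simpa using (h 0).1
  rw [integral_polar hi]
  have hθ : ∀ θ : Metric.sphere (0 : E3) 1, ∫ r in Ioi (0 : ℝ),
      r ^ 2 • fderiv ℝ g (r • (θ : E3)) (kern (r • (θ : E3))) = -g 0 := by
    intro θ
    have hn : ‖(θ : E3)‖ = 1 := by simp
    have h1 : ContDiff ℝ 1 fun r : ℝ => g (r • (θ : E3)) :=
      hg.comp (contDiff_id.smul contDiff_const)
    have h2 : HasCompactSupport fun r : ℝ => g (r • (θ : E3)) := by
      refine hc.comp_isClosedEmbedding (g := fun r : ℝ => r • (θ : E3)) ?_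
      refine (Isometry.of_dist_eq fun a b => ?_).isClosedEmbedding
      rw [dist_eq_norm, ← sub_smul, norm_smul, hn, mul_one, ← dist_eq_norm]
    have h3 := HasCompactSupport.integral_Ioi_deriv_eq h1 h2 0
    rw [zero_smul] at h3
    rw [← h3]
    refine setIntegral_congr_fun measurableSet_Ioi fun r hr => ?_
    have hr0 : 0 < r := hr
    have hd : HasDerivAt (fun r : ℝ => g (r • (θ : E3)))
        (fderiv ℝ g (r • (θ : E3)) ((1 : ℝ) • (θ : E3))) r :=
      ((hg.differentiable one_ne_zero _).hasFDerivAt).comp_hasDerivAt r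
        ((hasDerivAt_id r).smul_const (θ : E3))
    rw [hd.deriv, ← map_smul]
    congr 1
    rw [kern, norm_smul, hn, Real.norm_of_nonneg hr0.le, smul_smul, smul_smul]
    congr 1
    field_simp
  simp_rw [hθ]
  rw [integral_const, Measure.toSphere_real_apply_univ, finrank_E3, Measure.real,
    EuclideanSpace.volume_ball_fin_three]
  rw [smul_neg]
  congr 2
  rw [ENNReal.toReal_mul, ENNReal.toReal_pow, ENNReal.toReal_ofReal zero_le_one,
    ENNReal.toReal_ofReal (by positivity)]
  push_cast
  ring

/-- The divergence of the mollified kernel, in integrated form. -/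
lemma integral_fderiv_kernE [CompleteSpace F] (hρ : IsRadialMollifier ρ) (hε : 0 < ε) {ξ : E3 → F}
    (hξ : ContDiff ℝ 1 ξ) (hc : HasCompactSupport ξ) (a : E3) :
    ∫ z, fderiv ℝ ξ (a - z) (kernE ρ ε z) =
      (4 * Real.pi) • ∫ u, ξ (a + u) ∂(mollMeasure ρ ε) := by
  have := isProbabilityMeasure_mollMeasure hρ hε
  have hTc : Continuous fun z => fderiv ℝ ξ (a - z) :=
    (hξ.continuous_fderiv one_ne_zero).comp (by fun_prop)
  have hTs : HasCompactSupport fun z => fderiv ℝ ξ (a - z) :=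
    (hc.fderiv ℝ).comp_homeomorph (Homeomorph.subLeft a)
  obtain ⟨C, h⟩ := exists_integral_norm_apply_kern_le (ε := ε) hTc hTs
  have hm := measurable_kern
  have hmk : Measurable fun p : E3 × E3 => kern (p.1 + p.2) := hm.comp (by fun_prop)
  have hmeas : AEStronglyMeasurable (fun p : E3 × E3 => fderiv ℝ ξ (a - p.1) (kern (p.1 + p.2)))
      (volume.prod (mollMeasure ρ ε)) := by
    have h1 : Continuous fun p : E3 × E3 => fderiv ℝ ξ (a - p.1) := hTc.comp continuous_fst
    exact (ContinuousLinearMap.apply ℝ F).flip.aestronglyMeasurable_comp₂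
      h1.aestronglyMeasurable hmk.aestronglyMeasurable
  have hi : Integrable (fun p : E3 × E3 => fderiv ℝ ξ (a - p.1) (kern (p.1 + p.2)))
      (volume.prod (mollMeasure ρ ε)) := by
    refine (integrable_prod_iff' hmeas).2 ⟨.of_forall fun u => (h u).1, ?_⟩
    refine Integrable.mono' (g := fun _ => C) (integrable_const C)
      hmeas.norm.prod_swap.integral_prod_right' ?_
    filter_upwards [ae_mollMeasure hρ hε] with u hu
    refine (le_of_eq ?_).trans ((h u).2 hu)
    exact Real.norm_of_nonneg (integral_nonneg fun x => norm_nonneg _)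
  have e1 : ∀ z, fderiv ℝ ξ (a - z) (kernE ρ ε z) =
      ∫ u, fderiv ℝ ξ (a - z) (kern (z + u)) ∂(mollMeasure ρ ε) := fun z =>
    ((fderiv ℝ ξ (a - z)).integral_comp_comm (integrable_kern hρ hε z)).symm
  simp_rw [e1]
  rw [integral_integral_swap (f := fun z u => fderiv ℝ ξ (a - z) (kern (z + u))) hi,
    ← integral_smul]
  refine integral_congr_ae (.of_forall fun u => ?_)
  simp only
  rw [← integral_add_right_eq_self (fun z => fderiv ℝ ξ (a - z) (kern (z + u))) (-u)]
  have hgs : HasCompactSupport fun z => ξ (a + u - z) := hc.comp_homeomorph (Homeomorph.subLeft _)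
  have hgd : ContDiff ℝ 1 fun z => ξ (a + u - z) := hξ.comp (contDiff_const.sub contDiff_id)
  have key := integral_fderiv_kern hgd hgs
  have e2 : ∀ z, fderiv ℝ (fun z => ξ (a + u - z)) z (kern z) =
      - fderiv ℝ ξ (a - (z + -u)) (kern (z + -u + u)) := by
    intro z
    have hd : HasFDerivAt (fun z => ξ (a + u - z))
        ((fderiv ℝ ξ (a + u - z)).comp (-ContinuousLinearMap.id ℝ E3)) z :=
      ((hξ.differentiable one_ne_zero _).hasFDerivAt).comp z ((hasFDerivAt_id z).const_sub _)
    have e3 : a - (z + -u) = a + u - z := by abel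
    rw [hd.fderiv, e3, neg_add_cancel_right]
    simp
  simp_rw [e2] at key
  rw [integral_neg, neg_inj, sub_zero] at key
  exact key

end

end VortexFilament

namespace VortexFilament

noncomputable section

/-! ### Smoothness of the field -/

open Set

open scoped Convolution

variable {γ : ℝ → E3} {ρ : E3 → ℝ} {ε : ℝ}

lemma rescale_neg (hρ : IsRadialMollifier ρ) (x : E3) : rescale ρ ε (-x) = rescale ρ ε x := by
  unfold rescale
  rw [hρ.radial (ε⁻¹ • -x) (ε⁻¹ • x) (by rw [smul_neg, norm_neg])]

lemma locallyIntegrable_kern : LocallyIntegrable kern := by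
  rw [locallyIntegrable_iff]
  intro K hK
  obtain ⟨C, hC, hI⟩ := exists_integral_rpow_mul_add_rpow (p := 2) (q := 2) (by norm_num)
    (by norm_num) (by norm_num)
  obtain ⟨R, hR⟩ := hK.isBounded.exists_norm_le
  have hm := measurable_kern
  refine Integrable.mono' (((hI 1 one_pos 0).1.integrableOn (s := K)).const_mul ((1 + R) ^ 2))
    hm.aestronglyMeasurable ?_
  filter_upwards [ae_restrict_mem hK.measurableSet] with z hz
  have hzR := hR z hz
  have h0 := norm_nonneg z
  rw [norm_kern, zero_sub, norm_neg, Real.rpow_neg (by positivity : 0 ≤ 1 + ‖z‖), Real.rpow_two,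
    mul_left_comm]
  refine le_mul_of_one_le_right (by positivity) ?_
  rw [← div_eq_mul_inv, one_le_div (by positivity)]
  gcongr

lemma contDiff_kernE (hρ : IsRadialMollifier ρ) (hε : 0 < ε) : ContDiff ℝ ∞ (kernE ρ ε) := by
  have e : kernE ρ ε =
      (kern ⋆[(ContinuousLinearMap.lsmul ℝ ℝ : ℝ →L[ℝ] E3 →L[ℝ] E3).flip, volume] rescale ρ ε) := by
    ext1 z
    rw [kernE, integral_mollMeasure hρ hε, convolution_def,
      ← integral_sub_right_eq_self _ z]
    refine integral_congr_ae (.of_forall fun t => ?_)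
    simp only [ContinuousLinearMap.flip_apply, ContinuousLinearMap.lsmul_apply,
      add_sub_cancel]
    rw [← rescale_neg hρ, neg_sub]
  rw [e]
  exact (rescale_hasCompactSupport hρ hε).contDiff_convolution_right _ locallyIntegrable_kern
    (rescale_contDiff hρ ε)

/-- Differentiation under the integral along the curve. The derivative is again an integral of this
form, with the flipped derivative of `K` in place of `K`, so that the lemma can be iterated. -/
lemma hasFDerivAt_integral_curve {G : Type} [NormedAddCommGroup G] [NormedSpace ℝ G]
    (hγ : IsArclengthLoop γ) {K : E3 → E3 →L[ℝ] G} (hK : ContDiff ℝ 1 K) (x : E3) :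
    HasFDerivAt (fun x => ∫ s in Ioc (0 : ℝ) 1, K (x - γ s) (deriv γ s))
      (∫ s in Ioc (0 : ℝ) 1, (fderiv ℝ K (x - γ s)).flip (deriv γ s)) x := by
  have hc := hγ.continuous
  have hdm := hγ.measurable_deriv
  have hK' : Continuous fun z => (fderiv ℝ K z).flip :=
    (ContinuousLinearMap.flipₗᵢ ℝ E3 E3 G).continuous.comp (hK.continuous_fderiv one_ne_zero)
  have hmeas : ∀ {G' : Type} [NormedAddCommGroup G'] [NormedSpace ℝ G'] {L : E3 → E3 →L[ℝ] G'},
      Continuous L → ∀ x, AEStronglyMeasurable (fun s => L (x - γ s) (deriv γ s))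
        (volume.restrict (Ioc (0 : ℝ) 1)) := by
    intro G' _ _ L hL x
    have h1 : Continuous fun s => L (x - γ s) := hL.comp (continuous_const.sub hc)
    exact (ContinuousLinearMap.apply ℝ G').flip.aestronglyMeasurable_comp₂
      h1.aestronglyMeasurable hdm.aestronglyMeasurable
  obtain ⟨R, hR⟩ := (isCompact_Icc.image hc : IsCompact (γ '' Icc (0 : ℝ) 1)).isBounded.exists_norm_le
  have hRs : ∀ s ∈ Ioc (0 : ℝ) 1, ‖γ s‖ ≤ R := fun s hs =>
    hR _ (mem_image_of_mem γ ⟨hs.1.le, hs.2⟩)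
  obtain ⟨M, hM⟩ := (isCompact_closedBall (0 : E3) (‖x‖ + 1 + R)).exists_bound_of_continuousOn
    (hK.continuous.continuousOn)
  obtain ⟨M', hM'⟩ := (isCompact_closedBall (0 : E3) (‖x‖ + 1 + R)).exists_bound_of_continuousOn
    (f := fun z => (fderiv ℝ K z).flip) hK'.continuousOn
  have hball : ∀ y ∈ Metric.ball x 1, ∀ s ∈ Ioc (0 : ℝ) 1,
      y - γ s ∈ Metric.closedBall (0 : E3) (‖x‖ + 1 + R) := by
    intro y hy s hs
    rw [mem_ball_iff_norm] at hy
    rw [mem_closedBall_zero_iff]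
    have h1 := norm_sub_le y (γ s)
    have h2 := norm_sub_norm_le y x
    have := hRs s hs
    linarith
  refine hasFDerivAt_integral_of_dominated_of_fderiv_le (bound := fun _ => M')
    (F := fun x s => K (x - γ s) (deriv γ s))
    (F' := fun x s => (fderiv ℝ K (x - γ s)).flip (deriv γ s))
    (Metric.ball_mem_nhds x one_pos) (.of_forall fun y => hmeas hK.continuous y) ?_
    (hmeas hK' x) ?_ (integrable_const _) ?_
  · refine Integrable.mono' (g := fun _ => M) (integrable_const _) (hmeas hK.continuous x) ?_
    filter_upwards [ae_restrict_mem measurableSet_Ioc] with s hs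
    have h1 := hM _ (hball x (Metric.mem_ball_self one_pos) s hs)
    calc _ ≤ ‖K (x - γ s)‖ * ‖deriv γ s‖ := (K (x - γ s)).le_opNorm _
      _ ≤ M * 1 := mul_le_mul h1 (hγ.norm_deriv_le s) (norm_nonneg _) ((norm_nonneg _).trans h1)
      _ = M := mul_one M
  · filter_upwards [ae_restrict_mem measurableSet_Ioc] with s hs y hy
    have h1 := hM' _ (hball y hy s hs)
    calc _ ≤ ‖(fderiv ℝ K (y - γ s)).flip‖ * ‖deriv γ s‖ := ContinuousLinearMap.le_opNorm _ _
      _ ≤ M' * 1 := mul_le_mul h1 (hγ.norm_deriv_le s) (norm_nonneg _) ((norm_nonneg _).trans h1)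
      _ = M' := mul_one M'
  · refine .of_forall fun s y _ => ?_
    have h1 : HasFDerivAt (fun y => K (y - γ s)) (fderiv ℝ K (y - γ s)) y := by
      have := ((hK.differentiable one_ne_zero (y - γ s)).hasFDerivAt).comp y
        ((hasFDerivAt_id y).sub_const (γ s))
      rwa [ContinuousLinearMap.comp_id] at this
    exact ((ContinuousLinearMap.apply ℝ G (deriv γ s)).hasFDerivAt.comp y h1)

lemma contDiff_flip {G : Type} [NormedAddCommGroup G] [NormedSpace ℝ G] :
    ContDiff ℝ ∞ fun L : E3 →L[ℝ] E3 →L[ℝ] G => L.flip := by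
  refine IsBoundedLinearMap.contDiff ⟨⟨fun a b => rfl, fun a b => rfl⟩, 1, one_pos, fun L => ?_⟩
  rw [one_mul, ContinuousLinearMap.opNorm_flip]

lemma contDiff_integral_curve (hγ : IsArclengthLoop γ) (n : ℕ) :
    ∀ {G : Type} [NormedAddCommGroup G] [NormedSpace ℝ G] {K : E3 → E3 →L[ℝ] G},
      ContDiff ℝ ∞ K → ContDiff ℝ n fun x => ∫ s in Ioc (0 : ℝ) 1, K (x - γ s) (deriv γ s) := by
  induction n with
  | zero =>
    intro G _ _ K hK
    refine contDiff_zero.2 (continuous_iff_continuousAt.2 fun x => ?_)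
    exact (hasFDerivAt_integral_curve hγ (hK.of_le (by exact_mod_cast le_top)) x).continuousAt
  | succ n ih =>
    intro G _ _ K hK
    have hd := fun x =>
      hasFDerivAt_integral_curve hγ (K := K) (hK.of_le (by exact_mod_cast le_top)) x
    push_cast
    rw [contDiff_succ_iff_fderiv]
    refine ⟨fun x => (hd x).differentiableAt, by simp, ?_⟩
    have e : fderiv ℝ (fun x => ∫ s in Ioc (0 : ℝ) 1, K (x - γ s) (deriv γ s)) =
        fun x => ∫ s in Ioc (0 : ℝ) 1, (fderiv ℝ K (x - γ s)).flip (deriv γ s) :=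
      funext fun x => (hd x).fderiv
    rw [e]
    exact ih (K := fun z => (fderiv ℝ K z).flip)
      (contDiff_flip.comp (hK.fderiv_right (m := ∞) le_rfl))

lemma contDiff_prototypeField (hρ : IsRadialMollifier ρ) (hε : 0 < ε) (hγ : IsArclengthLoop γ) :
    ContDiff ℝ ∞ (prototypeField ρ ε γ) := by
  have hK : ContDiff ℝ ∞ fun z => crossL (kernE ρ ε (-z)) :=
    crossL.contDiff.comp ((contDiff_kernE hρ hε).comp contDiff_neg)
  have e : prototypeField ρ ε γ = fun x => (1 / (4 * Real.pi)) •
      ∫ s in Ioc (0 : ℝ) 1, crossL (kernE ρ ε (-(x - γ s))) (deriv γ s) := by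
    ext1 x
    rw [prototypeField_eq hρ hε hγ]
    simp only [neg_sub, crossL_apply]
  rw [e, contDiff_infty]
  exact fun n => (contDiff_integral_curve hγ n hK).const_smul (1 / (4 * Real.pi))

end

end VortexFilament

namespace VortexFilament

noncomputable section

/-! ### Integral identities for the curl -/

open Set

variable {γ : ℝ → E3} {ρ : E3 → ℝ} {ε : ℝ}

/-- The antisymmetric part of the derivative is the curl. -/
lemma inner_fderiv_sub (ξ : E3 → E3) (x a b : E3) :
    inner ℝ (fderiv ℝ ξ x a) b - inner ℝ (fderiv ℝ ξ x b) a =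
      (inner ℝ (curl ξ x) (cross a b) : ℝ) := by
  have h : ∀ (a : E3) (j : Fin 3), fderiv ℝ ξ x a j = a 0 * partialDeriv ξ 0 j x +
      a 1 * partialDeriv ξ 1 j x + a 2 * partialDeriv ξ 2 j x := by
    intro a j
    have e : a = a 0 • EuclideanSpace.single 0 1 + a 1 • EuclideanSpace.single 1 1 +
        a 2 • EuclideanSpace.single 2 (1 : ℝ) := by
      refine ext3 ?_ ?_ ?_ <;> simp
    conv_lhs => rw [e]
    simp [partialDeriv]
  simp only [inner_eq_sum, h, cross_apply_zero, cross_apply_one, cross_apply_two]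
  simp [curl]
  ring

lemma continuous_partialDeriv {f : E3 → E3} (hf : ContDiff ℝ 1 f) (i j : Fin 3) :
    Continuous (partialDeriv f i j) := by
  have h := hf.continuous_fderiv one_ne_zero
  unfold partialDeriv
  exact (PiLp.continuous_apply 2 (fun _ : Fin 3 => ℝ) j).comp (h.clm_apply continuous_const)

lemma continuous_curl {f : E3 → E3} (hf : ContDiff ℝ 1 f) : Continuous (curl f) := by
  have h := continuous_partialDeriv hf
  refine (PiLp.continuous_toLp 2 _).comp (continuous_pi fun i => ?_)
  fin_cases i
  · exact (h 1 2).sub (h 2 1)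
  · exact (h 2 0).sub (h 0 2)
  · exact (h 0 1).sub (h 1 0)

lemma hasCompactSupport_curl {f : E3 → E3} (hc : HasCompactSupport f) :
    HasCompactSupport (curl f) := by
  refine (hc.fderiv ℝ).mono fun x hx h0 => hx ?_
  refine ext3 ?_ ?_ ?_ <;> simp [curl, partialDeriv, h0]

/-- Integration by parts for a product of components. -/
lemma integral_mul_partialDeriv_add {ξ v : E3 → E3} (hξ : ContDiff ℝ 1 ξ)
    (hc : HasCompactSupport ξ) (hv : ContDiff ℝ 1 v) (i j k : Fin 3) :
    Integrable (fun x => ξ x k * partialDeriv v i j x + partialDeriv ξ i k x * v x j) ∧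
    ∫ x, (ξ x k * partialDeriv v i j x + partialDeriv ξ i k x * v x j) = 0 := by
  have hproj : ∀ l : Fin 3, ContDiff ℝ 1 fun x : E3 => x l := fun l => by fun_prop
  have hξk : ContDiff ℝ 1 fun x => ξ x k := (hproj k).comp hξ
  have hvj : ContDiff ℝ 1 fun x => v x j := (hproj j).comp hv
  have hck : HasCompactSupport fun x => ξ x k := hc.comp_left (g := fun y : E3 => y k) rfl
  have e : ∀ (f : E3 → E3) (l : Fin 3), ContDiff ℝ 1 f → ∀ x,
      partialDeriv f i l x = fderiv ℝ (fun y => f y l) x (EuclideanSpace.single i 1) := by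
    intro f l hf x
    have h1 : HasFDerivAt (fun y => f y l)
        ((EuclideanSpace.proj l : E3 →L[ℝ] ℝ).comp (fderiv ℝ f x)) x :=
      (EuclideanSpace.proj l : E3 →L[ℝ] ℝ).hasFDerivAt.comp x
        (hf.differentiable one_ne_zero x).hasFDerivAt
    rw [h1.fderiv]
    rfl
  have hcd : HasCompactSupport (partialDeriv ξ i k) := by
    refine (hc.fderiv ℝ).mono fun x hx h0 => hx ?_
    simp [partialDeriv, h0]
  have i1 : Integrable fun x => ξ x k * partialDeriv v i j x :=
    (hξk.continuous.mul (continuous_partialDeriv hv i j)).integrable_of_hasCompactSupport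
      hck.mul_right
  have i2 : Integrable fun x => partialDeriv ξ i k x * v x j :=
    ((continuous_partialDeriv hξ i k).mul hvj.continuous).integrable_of_hasCompactSupport
      hcd.mul_right
  have i3 : Integrable fun x => ξ x k * v x j :=
    (hξk.continuous.mul hvj.continuous).integrable_of_hasCompactSupport hck.mul_right
  refine ⟨i1.add i2, ?_⟩
  rw [integral_add i1 i2]
  simp only [e ξ k hξ, e v j hv] at i1 i2 ⊢
  rw [integral_mul_fderiv_eq_neg_fderiv_mul_of_integrable i2 i1 i3
    (fun x _ => hξk.differentiable one_ne_zero x) (fun x _ => hvj.differentiable one_ne_zero x),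
    neg_add_cancel]

/-- The curl is formally self-adjoint. -/
lemma integral_inner_curl {ξ v : E3 → E3} (hξ : ContDiff ℝ 1 ξ) (hc : HasCompactSupport ξ)
    (hv : ContDiff ℝ 1 v) :
    ∫ x, inner ℝ (ξ x) (curl v x) = ∫ x, inner ℝ (curl ξ x) (v x) := by
  have i1 : Integrable fun x => (inner ℝ (ξ x) (curl v x) : ℝ) :=
    (hξ.continuous.inner (continuous_curl hv)).integrable_of_hasCompactSupport
      (hc.mono fun x hx h0 => hx (by simp [h0]))
  have i2 : Integrable fun x => (inner ℝ (curl ξ x) (v x) : ℝ) :=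
    ((continuous_curl hξ).inner hv.continuous).integrable_of_hasCompactSupport
      ((hasCompactSupport_curl hc).mono fun x hx h0 => hx (by simp [h0]))
  rw [← sub_eq_zero, ← integral_sub i1 i2]
  have Q := integral_mul_partialDeriv_add hξ hc hv
  have e : ∀ x, (inner ℝ (ξ x) (curl v x) - inner ℝ (curl ξ x) (v x) : ℝ) =
      ((ξ x 0 * partialDeriv v 1 2 x + partialDeriv ξ 1 0 x * v x 2) -
        (ξ x 0 * partialDeriv v 2 1 x + partialDeriv ξ 2 0 x * v x 1)) +
      ((ξ x 1 * partialDeriv v 2 0 x + partialDeriv ξ 2 1 x * v x 0) -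
        (ξ x 1 * partialDeriv v 0 2 x + partialDeriv ξ 0 1 x * v x 2)) +
      ((ξ x 2 * partialDeriv v 0 1 x + partialDeriv ξ 0 2 x * v x 1) -
        (ξ x 2 * partialDeriv v 1 0 x + partialDeriv ξ 1 2 x * v x 0)) := by
    intro x
    simp only [inner_eq_sum]
    simp [curl]
    ring
  simp_rw [e]
  have P : ∀ i j k i' j' k' : Fin 3,
      Integrable (fun x => (ξ x k * partialDeriv v i j x + partialDeriv ξ i k x * v x j) -
        (ξ x k' * partialDeriv v i' j' x + partialDeriv ξ i' k' x * v x j')) ∧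
      ∫ x, ((ξ x k * partialDeriv v i j x + partialDeriv ξ i k x * v x j) -
        (ξ x k' * partialDeriv v i' j' x + partialDeriv ξ i' k' x * v x j')) = 0 := by
    intro i j k i' j' k'
    refine ⟨(Q i j k).1.sub (Q i' j' k').1, ?_⟩
    rw [integral_sub (Q i j k).1 (Q i' j' k').1, (Q i j k).2, (Q i' j' k').2, sub_zero]
  have h12 := (P 1 2 0 2 1 0).1.add (P 2 0 1 0 2 1).1
  have e1 := integral_add h12 (P 0 1 2 1 0 2).1
  have e2 := integral_add (P 1 2 0 2 1 0).1 (P 2 0 1 0 2 1).1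
  simp only [Pi.add_apply] at e1
  rw [e1, e2, (P 1 2 0 2 1 0).2, (P 2 0 1 0 2 1).2, (P 0 1 2 1 0 2).2]
  norm_num

/-- A gradient integrates to zero along a closed curve. -/
lemma integral_inner_fderiv_curve (hγ : IsArclengthLoop γ) {ξ : E3 → E3} (hξ : ContDiff ℝ 1 ξ)
    (hc : HasCompactSupport ξ) (c p : E3) :
    ∫ s in Ioc (0 : ℝ) 1, inner ℝ (fderiv ℝ ξ (γ s + c) (deriv γ s)) p = 0 := by
  obtain ⟨L, hL⟩ := hξ.lipschitzWith_of_hasCompactSupport hc one_ne_zero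
  have hadd : LipschitzWith 1 fun s => γ s + c :=
    LipschitzWith.of_dist_le_mul fun a b => by
      rw [dist_add_right]; exact hγ.lipschitz.dist_le_mul a b
  have hlip : LipschitzWith (‖innerSL ℝ p‖₊ * (L * 1)) fun s => inner ℝ p (ξ (γ s + c)) :=
    (innerSL ℝ p).lipschitz.comp (hL.comp hadd)
  have h := integral_deriv_of_lipschitz hlip 0 1
  have hper : γ 1 = γ 0 := by simpa using hγ.periodic 0
  rw [hper, sub_self, intervalIntegral.integral_of_le zero_le_one] at h
  refine Eq.trans (integral_congr_ae (ae_restrict_of_ae ?_)) h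
  filter_upwards [hγ.ae_differentiableAt] with s hs
  have hd : HasDerivAt (fun s => ξ (γ s + c)) (fderiv ℝ ξ (γ s + c) (deriv γ s)) s :=
    ((hξ.differentiable one_ne_zero _).hasFDerivAt).comp_hasDerivAt s (hs.hasDerivAt.add_const c)
  have hd' : HasDerivAt (fun s => inner ℝ p (ξ (γ s + c)))
      (inner ℝ p (fderiv ℝ ξ (γ s + c) (deriv γ s))) s :=
    (innerSL ℝ p).hasFDerivAt.comp_hasDerivAt s hd
  rw [hd'.deriv, real_inner_comm]

end

end VortexFilament

namespace VortexFilament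

noncomputable section

/-! ### Translation of the curve -/

open Set

variable {γ : ℝ → E3} {ρ : E3 → ℝ} {ε : ℝ}

lemma measurable_inner_fderiv_apply {α : Type*} [MeasurableSpace α] {ξ : E3 → E3}
    (hξ : ContDiff ℝ 1 ξ) {x a b : α → E3} (hx : Measurable x) (ha : Measurable a)
    (hb : Measurable b) : Measurable fun p => (inner ℝ (fderiv ℝ ξ (x p) (a p)) (b p) : ℝ) := by
  have hcont : Continuous fun q : E3 × E3 => fderiv ℝ ξ q.1 q.2 :=
    ((hξ.continuous_fderiv one_ne_zero).comp continuous_fst).clm_apply continuous_snd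
  have h1 : Measurable fun p => fderiv ℝ ξ (x p) (a p) := hcont.measurable.comp (hx.prodMk ha)
  exact h1.inner hb

/-- Translating the curve by `u` changes the circulation of `ξ` by the flux of its curl through the
surface swept out, whose area is at most `‖u‖`. -/
lemma abs_circulation_sub_le (hγ : IsArclengthLoop γ) {ξ : E3 → E3} (hξ : ContDiff ℝ 1 ξ)
    (hc : HasCompactSupport ξ) (h1 : ∀ x, ‖curl ξ x‖ ≤ 1) (u : E3) :
    |(∫ s in Ioc (0 : ℝ) 1, inner ℝ (ξ (γ s + u)) (deriv γ s)) -
      ∫ s in Ioc (0 : ℝ) 1, inner ℝ (ξ (γ s)) (deriv γ s)| ≤ ‖u‖ := by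
  obtain ⟨M, hM⟩ := (hc.fderiv ℝ).exists_bound_of_continuous (hξ.continuous_fderiv one_ne_zero)
  obtain ⟨B, hB⟩ := hc.exists_bound_of_continuous hξ.continuous
  have hM0 : 0 ≤ M := (norm_nonneg _).trans (hM 0)
  have hγc := hγ.continuous
  have hdm := hγ.measurable_deriv
  have hbd : ∀ x a b : E3, ‖b‖ ≤ 1 → ‖(inner ℝ (fderiv ℝ ξ x a) b : ℝ)‖ ≤ M * ‖a‖ := by
    intro x a b hb
    calc _ ≤ ‖fderiv ℝ ξ x a‖ * ‖b‖ := norm_inner_le_norm _ _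
      _ ≤ (M * ‖a‖) * 1 := by
          gcongr
          exact ((fderiv ℝ ξ x).le_opNorm a).trans (by gcongr; exact hM x)
      _ = _ := mul_one _
  have hint : ∀ w : E3, IntegrableOn (fun s => (inner ℝ (ξ (γ s + w)) (deriv γ s) : ℝ))
      (Ioc (0 : ℝ) 1) := by
    intro w
    have hm : Measurable fun s => ξ (γ s + w) :=
      (hξ.continuous.comp (hγc.add continuous_const)).measurable
    refine Integrable.mono' (g := fun _ => B * 1) (integrable_const _)
      (hm.inner hdm).aestronglyMeasurable (.of_forall fun s => ?_)
    refine (norm_inner_le_norm _ _).trans ?_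
    exact mul_le_mul (hB _) (hγ.norm_deriv_le s) (norm_nonneg _) ((norm_nonneg _).trans (hB 0))
  have hint0 := hint 0
  simp only [add_zero] at hint0
  rw [← integral_sub (hint u) hint0]
  have hftc : ∀ s, (inner ℝ (ξ (γ s + u)) (deriv γ s) - inner ℝ (ξ (γ s)) (deriv γ s) : ℝ) =
      ∫ t in Ioc (0 : ℝ) 1, inner ℝ (fderiv ℝ ξ (γ s + t • u) u) (deriv γ s) := by
    intro s
    have hd : ∀ t ∈ uIcc (0 : ℝ) 1, HasDerivAt (fun t : ℝ => (inner ℝ (deriv γ s) (ξ (γ s + t • u)) : ℝ))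
        (inner ℝ (deriv γ s) (fderiv ℝ ξ (γ s + t • u) u)) t := by
      intro t _
      have h2 : HasDerivAt (fun t : ℝ => γ s + t • u) ((1 : ℝ) • u) t :=
        ((hasDerivAt_id t).smul_const u).const_add (γ s)
      rw [one_smul] at h2
      have h3 : HasDerivAt (fun t : ℝ => ξ (γ s + t • u)) (fderiv ℝ ξ (γ s + t • u) u) t :=
        ((hξ.differentiable one_ne_zero _).hasFDerivAt).comp_hasDerivAt t h2
      exact (innerSL ℝ (deriv γ s)).hasFDerivAt.comp_hasDerivAt t h3
    have hcont : Continuous fun t : ℝ => (inner ℝ (deriv γ s) (fderiv ℝ ξ (γ s + t • u) u) : ℝ) := by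
      have h4 : Continuous fun t : ℝ => fderiv ℝ ξ (γ s + t • u) u :=
        ((hξ.continuous_fderiv one_ne_zero).comp (by fun_prop)).clm_apply continuous_const
      exact continuous_const.inner h4
    have h5 := intervalIntegral.integral_eq_sub_of_hasDerivAt hd (hcont.intervalIntegrable 0 1)
    rw [one_smul, zero_smul, add_zero, intervalIntegral.integral_of_le zero_le_one] at h5
    simp_rw [real_inner_comm (deriv γ s)]
    exact h5.symm
  simp_rw [hftc]
  have hprod : Integrable (fun p : ℝ × ℝ =>
      (inner ℝ (fderiv ℝ ξ (γ p.1 + p.2 • u) u) (deriv γ p.1) : ℝ))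
      ((volume.restrict (Ioc (0 : ℝ) 1)).prod (volume.restrict (Ioc (0 : ℝ) 1))) := by
    have hx : Measurable fun p : ℝ × ℝ => γ p.1 + p.2 • u := by
      have := hγc.measurable
      fun_prop
    have hd1 : Measurable fun p : ℝ × ℝ => deriv γ p.1 := hdm.comp measurable_fst
    refine Integrable.mono' (g := fun _ => M * ‖u‖) (integrable_const _)
      (measurable_inner_fderiv_apply hξ hx measurable_const hd1).aestronglyMeasurable
      (.of_forall fun p => hbd _ _ _ (hγ.norm_deriv_le p.1))
  rw [integral_integral_swap
    (f := fun s t => (inner ℝ (fderiv ℝ ξ (γ s + t • u) u) (deriv γ s) : ℝ)) hprod]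
  have hslice : ∀ t : ℝ, ‖∫ s in Ioc (0 : ℝ) 1,
      (inner ℝ (fderiv ℝ ξ (γ s + t • u) u) (deriv γ s) : ℝ)‖ ≤ ‖u‖ := by
    intro t
    have hx : Measurable fun s => γ s + t • u := hγc.measurable.add_const _
    have j1 : IntegrableOn (fun s => (inner ℝ (fderiv ℝ ξ (γ s + t • u) u) (deriv γ s) : ℝ))
        (Ioc (0 : ℝ) 1) :=
      Integrable.mono' (g := fun _ => M * ‖u‖) (integrable_const _)
        (measurable_inner_fderiv_apply hξ hx measurable_const hdm).aestronglyMeasurable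
        (.of_forall fun s => hbd _ _ _ (hγ.norm_deriv_le s))
    have j2 : IntegrableOn (fun s => (inner ℝ (fderiv ℝ ξ (γ s + t • u) (deriv γ s)) u : ℝ))
        (Ioc (0 : ℝ) 1) := by
      refine Integrable.mono' (g := fun _ => M * 1 * ‖u‖) (integrable_const _)
        (measurable_inner_fderiv_apply hξ hx hdm measurable_const).aestronglyMeasurable
        (.of_forall fun s => (norm_inner_le_norm _ _).trans ?_)
      gcongr
      exact ((fderiv ℝ ξ _).le_opNorm _).trans
        (mul_le_mul (hM _) (hγ.norm_deriv_le s) (norm_nonneg _) hM0)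
    have h0 := integral_inner_fderiv_curve hγ hξ hc (t • u) u
    -- The curve is closed, so that only the antisymmetric part of the derivative contributes.
    have e : ∫ s in Ioc (0 : ℝ) 1, (inner ℝ (fderiv ℝ ξ (γ s + t • u) u) (deriv γ s) : ℝ) =
        ∫ s in Ioc (0 : ℝ) 1, inner ℝ (curl ξ (γ s + t • u)) (cross u (deriv γ s)) := by
      simp_rw [← inner_fderiv_sub]
      rw [integral_sub j1 j2, h0, sub_zero]
    rw [e]
    have := norm_setIntegral_le_of_norm_le_const (μ := volume) (s := Ioc (0 : ℝ) 1) (C := ‖u‖)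
      (f := fun s => (inner ℝ (curl ξ (γ s + t • u)) (cross u (deriv γ s)) : ℝ)) (by simp)
      fun s _ => by
        refine (norm_inner_le_norm _ _).trans ?_
        calc _ ≤ 1 * (‖u‖ * 1) := by
              refine mul_le_mul (h1 _) ((norm_cross_le _ _).trans ?_) (norm_nonneg _) zero_le_one
              have := hγ.norm_deriv_le s
              gcongr
          _ = _ := by ring
    simpa using this
  have := norm_setIntegral_le_of_norm_le_const (μ := volume) (s := Ioc (0 : ℝ) 1) (C := ‖u‖)
    (by simp) fun t _ => hslice t
  rw [← Real.norm_eq_abs]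
  simpa using this

end

end VortexFilament

namespace VortexFilament

noncomputable section

/-! ### The curl of the field in the flat norm -/

open Set

variable {γ : ℝ → E3} {ρ : E3 → ℝ} {ε : ℝ}

lemma exists_norm_kernE_le_const (hρ : IsRadialMollifier ρ) (hε : 0 < ε) :
    ∃ B : ℝ, 0 ≤ B ∧ ∀ z, ‖kernE ρ ε z‖ ≤ B := by
  obtain ⟨C, hC, h⟩ := exists_norm_kernE_le hρ
  refine ⟨C * (ε ^ 2)⁻¹, by positivity, fun z => (h ε hε z).trans ?_⟩
  unfold reg
  gcongr
  linarith [norm_nonneg z]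

/-- The two pairings of the derivative of a test field with the mollified kernel and a unit vector
are integrable, jointly with the parameter of the curve. -/
lemma integrable_inner_fderiv_kernE (hρ : IsRadialMollifier ρ) (hε : 0 < ε) (hγ : IsArclengthLoop γ)
    {ξ : E3 → E3} (hξ : ContDiff ℝ 1 ξ) (hc : HasCompactSupport ξ) :
    Integrable (fun p : E3 × ℝ =>
      (inner ℝ (fderiv ℝ ξ (γ p.2 - p.1) (kernE ρ ε p.1)) (deriv γ p.2) : ℝ))
      (volume.prod (volume.restrict (Ioc (0 : ℝ) 1))) ∧
    Integrable (fun p : E3 × ℝ =>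
      (inner ℝ (fderiv ℝ ξ (γ p.2 - p.1) (deriv γ p.2)) (kernE ρ ε p.1) : ℝ))
      (volume.prod (volume.restrict (Ioc (0 : ℝ) 1))) := by
  obtain ⟨B, hB, hk⟩ := exists_norm_kernE_le_const hρ hε
  have hkm : Measurable fun p : E3 × ℝ => kernE ρ ε p.1 :=
    (measurable_kernE hρ hε).comp measurable_fst
  have hdm : Measurable fun p : E3 × ℝ => deriv γ p.2 := hγ.measurable_deriv.comp measurable_snd
  have hx : Measurable fun p : E3 × ℝ => γ p.2 - p.1 :=
    (hγ.continuous.measurable.comp measurable_snd).sub measurable_fst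
  have hDc : Continuous fun y => ‖fderiv ℝ ξ y‖ := (hξ.continuous_fderiv one_ne_zero).norm
  have hDi : Integrable fun y => ‖fderiv ℝ ξ y‖ :=
    hDc.integrable_of_hasCompactSupport (hc.fderiv ℝ).norm
  have hdom : Integrable (fun p : E3 × ℝ => ‖fderiv ℝ ξ (γ p.2 - p.1)‖)
      (volume.prod (volume.restrict (Ioc (0 : ℝ) 1))) := by
    have hm : Measurable fun p : E3 × ℝ => ‖fderiv ℝ ξ (γ p.2 - p.1)‖ := hDc.measurable.comp hx
    refine (integrable_prod_iff' hm.aestronglyMeasurable).2 ⟨.of_forall fun s => ?_, ?_⟩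
    · exact hDi.comp_sub_left (γ s)
    · have e : ∀ s : ℝ, ∫ y, ‖‖fderiv ℝ ξ (γ s - y)‖‖ = ∫ y, ‖fderiv ℝ ξ y‖ := fun s => by
        simp_rw [norm_norm]
        exact integral_sub_left_eq_self (fun y => ‖fderiv ℝ ξ y‖) volume (γ s)
      simp_rw [e]
      exact integrable_const _
  refine ⟨(hdom.mul_const B).mono'
    (measurable_inner_fderiv_apply hξ hx hkm hdm).aestronglyMeasurable (.of_forall fun p => ?_),
    (hdom.mul_const B).mono'
    (measurable_inner_fderiv_apply hξ hx hdm hkm).aestronglyMeasurable (.of_forall fun p => ?_)⟩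
  · calc _ ≤ ‖fderiv ℝ ξ (γ p.2 - p.1) (kernE ρ ε p.1)‖ * ‖deriv γ p.2‖ := norm_inner_le_norm _ _
      _ ≤ (‖fderiv ℝ ξ (γ p.2 - p.1)‖ * B) * 1 := by
          have h1 := hγ.norm_deriv_le p.2
          have h2 := hk p.1
          gcongr
          exact ((fderiv ℝ ξ _).le_opNorm _).trans (by gcongr)
      _ = _ := mul_one _
  · calc _ ≤ ‖fderiv ℝ ξ (γ p.2 - p.1) (deriv γ p.2)‖ * ‖kernE ρ ε p.1‖ := norm_inner_le_norm _ _
      _ ≤ (‖fderiv ℝ ξ (γ p.2 - p.1)‖ * 1) * B := by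
          have h1 := hγ.norm_deriv_le p.2
          have h2 := hk p.1
          gcongr
          exact ((fderiv ℝ ξ _).le_opNorm _).trans (by gcongr)
      _ = _ := by rw [mul_one]

/-- The curl of the test field against the fields of the line elements splits into two pairings: the
first is governed by the divergence of the kernel, and the second vanishes because the curve is
closed. -/
lemma integral_inner_curl_cross_kernE (hρ : IsRadialMollifier ρ) (hε : 0 < ε)
    (hγ : IsArclengthLoop γ) {ξ : E3 → E3} (hξ : ContDiff ℝ 1 ξ) (hc : HasCompactSupport ξ) :
    ∫ s in Ioc (0 : ℝ) 1, ∫ z, (inner ℝ (curl ξ (γ s - z)) (cross (kernE ρ ε z) (deriv γ s)) : ℝ) =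
      4 * Real.pi * ∫ s in Ioc (0 : ℝ) 1, ∫ u, (inner ℝ (ξ (γ s + u)) (deriv γ s) : ℝ)
        ∂(mollMeasure ρ ε) := by
  obtain ⟨i1, i2⟩ := integrable_inner_fderiv_kernE hρ hε hγ hξ hc
  have hDc := hξ.continuous_fderiv one_ne_zero
  have hkc := (contDiff_kernE hρ hε).continuous
  have hDs : ∀ s, HasCompactSupport fun z => fderiv ℝ ξ (γ s - z) := fun s =>
    (hc.fderiv ℝ).comp_homeomorph (Homeomorph.subLeft (γ s))
  have hcs : ∀ s, Continuous fun z => fderiv ℝ ξ (γ s - z) := fun s => hDc.comp (by fun_prop)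
  have k1 : ∀ s, Integrable fun z => fderiv ℝ ξ (γ s - z) (kernE ρ ε z) := fun s =>
    ((hcs s).clm_apply hkc).integrable_of_hasCompactSupport
      ((hDs s).mono fun z hz h0 => hz (by simp only [h0]; rfl))
  have k2 : ∀ s, Integrable fun z => (inner ℝ (fderiv ℝ ξ (γ s - z) (deriv γ s)) (kernE ρ ε z) : ℝ) :=
    fun s => (((hcs s).clm_apply continuous_const).inner hkc).integrable_of_hasCompactSupport
      ((hDs s).mono fun z hz h0 => hz (by simp [h0]))
  have hzero : ∫ s in Ioc (0 : ℝ) 1, ∫ z,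
      (inner ℝ (fderiv ℝ ξ (γ s - z) (deriv γ s)) (kernE ρ ε z) : ℝ) = 0 := by
    rw [← integral_integral_swap
      (f := fun z s => (inner ℝ (fderiv ℝ ξ (γ s - z) (deriv γ s)) (kernE ρ ε z) : ℝ)) i2]
    have : ∀ z, ∫ s in Ioc (0 : ℝ) 1,
        (inner ℝ (fderiv ℝ ξ (γ s - z) (deriv γ s)) (kernE ρ ε z) : ℝ) = 0 := by
      intro z
      have := integral_inner_fderiv_curve hγ hξ hc (-z) (kernE ρ ε z)
      simpa only [← sub_eq_add_neg] using this
    simp_rw [this]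
    exact integral_zero _ _
  have hfirst : ∀ s, ∫ z, (inner ℝ (fderiv ℝ ξ (γ s - z) (kernE ρ ε z)) (deriv γ s) : ℝ) =
      4 * Real.pi * ∫ u, (inner ℝ (ξ (γ s + u)) (deriv γ s) : ℝ) ∂(mollMeasure ρ ε) := by
    intro s
    have hu : Integrable (fun u => ξ (γ s + u)) (mollMeasure ρ ε) :=
      integrable_mollMeasure_of_continuous hρ hε (hξ.continuous.comp (by fun_prop))
    simp_rw [real_inner_comm (deriv γ s)]
    rw [integral_inner (k1 s), integral_inner hu, integral_fderiv_kernE hρ hε hξ hc,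
      real_inner_smul_right]
  have hsplit : ∀ s, ∫ z, (inner ℝ (curl ξ (γ s - z)) (cross (kernE ρ ε z) (deriv γ s)) : ℝ) =
      4 * Real.pi * (∫ u, (inner ℝ (ξ (γ s + u)) (deriv γ s) : ℝ) ∂(mollMeasure ρ ε)) -
      ∫ z, (inner ℝ (fderiv ℝ ξ (γ s - z) (deriv γ s)) (kernE ρ ε z) : ℝ) := by
    intro s
    simp_rw [← inner_fderiv_sub]
    rw [integral_sub _ (k2 s), hfirst]
    exact (k1 s).inner_const _
  have j2 := i2.integral_prod_right
  have j1 := i1.integral_prod_right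
  simp only [hfirst] at j1
  simp_rw [hsplit]
  rw [integral_sub j1 j2, hzero, sub_zero, integral_const_mul]

/-- The curl of the field is the mollified curve, tested against compactly supported fields. -/
lemma densityPairing_curl_prototypeField (hρ : IsRadialMollifier ρ) (hε : 0 < ε)
    (hγ : IsArclengthLoop γ) {ξ : E3 → E3} (hξ : ContDiff ℝ 1 ξ) (hc : HasCompactSupport ξ) :
    densityPairing (curl (prototypeField ρ ε γ)) ξ =
      ∫ s in Ioc (0 : ℝ) 1, ∫ u, (inner ℝ (ξ (γ s + u)) (deriv γ s) : ℝ) ∂(mollMeasure ρ ε) := by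
  have hv : ContDiff ℝ 1 (prototypeField ρ ε γ) :=
    (contDiff_prototypeField hρ hε hγ).of_le (by exact_mod_cast le_top)
  rw [densityPairing, integral_inner_curl hξ hc hv]
  obtain ⟨B, hB, hk⟩ := exists_norm_kernE_le_const hρ hε
  have hi : Integrable (fun p : E3 × ℝ =>
      (inner ℝ (curl ξ p.1) (cross (kernE ρ ε (γ p.2 - p.1)) (deriv γ p.2)) : ℝ))
      (volume.prod (volume.restrict (Ioc (0 : ℝ) 1))) := by
    have h1 : Integrable (curl ξ) :=
      (continuous_curl hξ).integrable_of_hasCompactSupport (hasCompactSupport_curl hc)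
    have h2 : Integrable (fun p : E3 × ℝ => ‖curl ξ p.1‖ * B)
        (volume.prod (volume.restrict (Ioc (0 : ℝ) 1))) := by
      have := h1.norm.mul_prod (integrable_const (μ := volume.restrict (Ioc (0 : ℝ) 1)) B)
      exact this
    have h3 : Measurable fun p : E3 × ℝ => curl ξ p.1 :=
      (continuous_curl hξ).measurable.comp measurable_fst
    refine h2.mono' (h3.inner (measurable_cross_kernE hρ hε hγ)).aestronglyMeasurable
      (.of_forall fun p => (norm_inner_le_norm _ _).trans ?_)
    gcongr
    calc _ ≤ ‖kernE ρ ε (γ p.2 - p.1)‖ * ‖deriv γ p.2‖ := norm_cross_le _ _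
      _ ≤ B * 1 := mul_le_mul (hk _) (hγ.norm_deriv_le _) (norm_nonneg _) hB
      _ = B := mul_one B
  have e : ∀ x, (inner ℝ (curl ξ x) (prototypeField ρ ε γ x) : ℝ) = 1 / (4 * Real.pi) *
      ∫ s in Ioc (0 : ℝ) 1,
        (inner ℝ (curl ξ x) (cross (kernE ρ ε (γ s - x)) (deriv γ s)) : ℝ) := by
    intro x
    rw [prototypeField_eq hρ hε hγ, real_inner_smul_right,
      integral_inner (integrable_cross_kernE hρ hε hγ x)]
  simp_rw [e]
  rw [integral_const_mul, integral_integral_swap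
    (f := fun x s => (inner ℝ (curl ξ x) (cross (kernE ρ ε (γ s - x)) (deriv γ s)) : ℝ)) hi]
  have e2 : ∀ s, ∫ x, (inner ℝ (curl ξ x) (cross (kernE ρ ε (γ s - x)) (deriv γ s)) : ℝ) =
      ∫ z, (inner ℝ (curl ξ (γ s - z)) (cross (kernE ρ ε z) (deriv γ s)) : ℝ) := by
    intro s
    rw [← integral_sub_left_eq_self (fun x =>
      (inner ℝ (curl ξ x) (cross (kernE ρ ε (γ s - x)) (deriv γ s)) : ℝ)) volume (γ s)]
    simp only [sub_sub_cancel]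
  simp_rw [e2]
  rw [integral_inner_curl_cross_kernE hρ hε hγ hξ hc, ← mul_assoc,
    one_div_mul_cancel (by positivity), one_mul]

/-- Mollification at scale `ε` moves the curve by at most `ε` in the flat norm. -/
lemma flatNorm_curl_prototypeField_sub_le (hρ : IsRadialMollifier ρ) (hε : 0 < ε)
    (hγ : IsArclengthLoop γ) :
    flatNorm (fun ξ => densityPairing (curl (prototypeField ρ ε γ)) ξ - curvePairing γ ξ) ≤
      (ε : EReal) := by
  refine iSup₂_le fun ξ hξ => ?_
  obtain ⟨h1, hc, hcurl⟩ := hξ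
  have := isProbabilityMeasure_mollMeasure hρ hε
  rw [EReal.coe_le_coe_iff]
  obtain ⟨B, hB⟩ := hc.exists_bound_of_continuous h1.continuous
  have hi : Integrable (fun p : ℝ × E3 => (inner ℝ (ξ (γ p.1 + p.2)) (deriv γ p.1) : ℝ))
      ((volume.restrict (Ioc (0 : ℝ) 1)).prod (mollMeasure ρ ε)) := by
    have hx : Continuous fun p : ℝ × E3 => ξ (γ p.1 + p.2) := by
      have h2 := h1.continuous
      have h3 := hγ.continuous
      fun_prop
    have hd : Measurable fun p : ℝ × E3 => deriv γ p.1 := hγ.measurable_deriv.comp measurable_fst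
    refine Integrable.mono' (g := fun _ => B * 1) (integrable_const _)
      (hx.measurable.inner hd).aestronglyMeasurable (.of_forall fun p => ?_)
    exact (norm_inner_le_norm _ _).trans
      (mul_le_mul (hB _) (hγ.norm_deriv_le _) (norm_nonneg _) ((norm_nonneg _).trans (hB 0)))
  have j := hi.integral_prod_right
  beta_reduce
  rw [densityPairing_curl_prototypeField hρ hε hγ h1 hc, curvePairing,
    intervalIntegral.integral_of_le zero_le_one, integral_integral_swap
    (f := fun s u => (inner ℝ (ξ (γ s + u)) (deriv γ s) : ℝ)) hi]
  have hconst : ∫ s in Ioc (0 : ℝ) 1, (inner ℝ (ξ (γ s)) (deriv γ s) : ℝ) =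
      ∫ _, (∫ s in Ioc (0 : ℝ) 1, (inner ℝ (ξ (γ s)) (deriv γ s) : ℝ)) ∂(mollMeasure ρ ε) := by
    simp
  rw [hconst, ← integral_sub j (integrable_const _)]
  refine (le_abs_self _).trans ?_
  rw [← Real.norm_eq_abs]
  have := norm_integral_le_of_norm_le_const (μ := mollMeasure ρ ε) (C := ε)
    (f := fun u => (∫ s in Ioc (0 : ℝ) 1, (inner ℝ (ξ (γ s + u)) (deriv γ s) : ℝ)) -
      ∫ s in Ioc (0 : ℝ) 1, (inner ℝ (ξ (γ s)) (deriv γ s) : ℝ)) (by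
      filter_upwards [ae_mollMeasure hρ hε] with u hu
      exact (abs_circulation_sub_le hγ h1 hc hcurl u).trans hu)
  simpa using this

end

end VortexFilament

theorem mainTheorem3 (ρ : E3 → ℝ) (hρ : VortexFilament.IsRadialMollifier ρ) :
    (∀ γ : ℝ → E3, VortexFilament.IsArclengthLoop γ → VortexFilament.kappaNorm γ < ⊤ →
      ∀ ε : ℝ, 0 < ε → ε < 1 / 2 →
        ContDiff ℝ ∞ (VortexFilament.prototypeField ρ ε γ) ∧
        VortexFilament.flatNorm (fun ξ =>
          VortexFilament.densityPairing
              (VortexFilament.curl (VortexFilament.prototypeField ρ ε γ)) ξ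
            - VortexFilament.curvePairing γ ξ) ≤ (ε : EReal)) ∧
    (∀ q : ENNReal, 2 < q → ∃ C : ℝ, ∀ γ : ℝ → E3, VortexFilament.IsArclengthLoop γ →
      VortexFilament.kappaNorm γ < ⊤ → ∀ ε : ℝ, 0 < ε → ε < 1 / 2 →
        MemLp (VortexFilament.prototypeField ρ ε γ) q volume ∧
        (eLpNorm (VortexFilament.prototypeField ρ ε γ) q volume).toReal
          ≤ C * ε ^ ((2 / q).toReal - 1) * (VortexFilament.kappaNorm γ).toReal) ∧
    (∃ C : ℝ, ∀ γ : ℝ → E3, VortexFilament.IsArclengthLoop γ →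
      VortexFilament.kappaNorm γ < ⊤ → ∀ ε : ℝ, 0 < ε → ε < 1 / 2 →
        MemLp (VortexFilament.prototypeField ρ ε γ) 2 volume ∧
        |(∫ x, ‖VortexFilament.prototypeField ρ ε γ x‖ ^ 2)
            - (|Real.log ε| / (2 * Real.pi))|
          ≤ C * (VortexFilament.kappaNorm γ).toReal ^ 2) ∧
    (∃ C : ℝ, ∀ γ : ℝ → E3, VortexFilament.IsArclengthLoop γ →
      VortexFilament.kappaNorm γ < ⊤ → ∀ ε : ℝ, 0 < ε → ε < 1 / 2 →
      ∀ (φ : E3 → M3) (g : E3 → E3 →L[ℝ] M3), VortexFilament.IsW1Infty φ g →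
        |4 * Real.pi / |Real.log ε| *
              (∫ x, VortexFilament.ddot (φ x)
                (VortexFilament.tensor (VortexFilament.prototypeField ρ ε γ x)
                  (VortexFilament.prototypeField ρ ε γ x)))
            - ∫ s in (0 : ℝ)..1, VortexFilament.ddot (φ (γ s))
                (VortexFilament.idMatrix - VortexFilament.tensor (deriv γ s) (deriv γ s))|
          ≤ C * ((VortexFilament.kappaNorm γ).toReal ^ 2 * VortexFilament.w1InftyNorm φ g
              / |Real.log ε|)) := by
  refine ⟨fun γ hγ _ ε hε _ => ⟨VortexFilament.contDiff_prototypeField hρ hε hγ,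
      VortexFilament.flatNorm_curl_prototypeField_sub_le hρ hε hγ⟩,
    fun q hq => VortexFilament.exists_memLp_and_eLpNorm_toReal_le hρ hq,
    VortexFilament.exists_abs_energy_sub_le hρ, VortexFilament.exists_abs_limit_sub_le hρ⟩
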